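/- **Theorem.** *Background.* Let $x_c>0$ and let $G,\psi$ be real functions, real-analytic on $(0,x_c]$ (the metric functions, in the similarity variable $x=v/r$, of a self-similar spherically symmetric spacetime $ds^2=-2Ge^{\psi}dv^2+2e^{\psi}dv\,dr+r^2d\Omega^2$ with a naked singularity and Cauchy horizon $x=x_c$), such that $x_c$ is the smallest positive root of $xG(x)-1=0$; the energy conditions $x\psi'\le 0$ and $G'-\psi'(1-xG)G\le 0$ hold on $(0,x_c]$; and $1+x_c^2G'(x_c)>0$, $G'(x_c)<0$. Put $$\alpha=-2x(1-xG),\qquad \beta=1-2xG,\qquad \gamma=2G .$$ Let $\ell\in\{0,1,2,\dots\}$ and $x_i\in(0,x_c)$. For $\kappa\ge0$ put $H=\ell(\ell+1)e^\psi-(\kappa^2-2\kappa)\gamma+\kappa\beta'$ and consider the rescaled multipole wave equation on $[x_i,x_c)\times\mathbb R$, $$\alpha\tilde\phi_{,xx}+2\beta\tilde\phi_{,x\rho}+\gamma\tilde\phi_{,\rho\rho}+(\alpha'+2(1-\kappa)\beta)\tilde\phi_{,x}+(\beta'+2(1-\kappa)\gamma)\tilde\phi_{,\rho}-H\tilde\phi=0.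 \qquad (*)$$ *Solutions.* For $f\in H^{1,2}(\mathbb R)$ and $g\in L^2(\mathbb R)$, a solution of the initial value problem is a $\tilde\phi\in C([x_i,x_c],H^{1,2}(\mathbb R))$ with $\tilde\phi|_{x=x_i}=f$ that satisfies $(*)$ and $\tilde\phi_{,x}|_{x=x_i}=g$ weakly in $\rho$: for every $\eta\in C_0^\infty(\mathbb R)$ the functions $x\mapsto\int_{\mathbb R}\tilde\phi(x,\cdot)\eta\,d\rho$ and $x\mapsto\int_{\mathbb R}\tilde\phi_{,\rho}(x,\cdot)\eta\,d\rho$ are $C^2$ and $C^1$ respectively on $[x_i,x_c)$, the equation obtained by multiplying $(*)$ by $\eta$ and integrating over $\rho$ (with $\int\tilde\phi_{,\rho\rho}\eta\,d\rho$ read as $-\int\tilde\phi_{,\rho}\eta'\,d\rho$) holds on $[x_i,x_c)$, and $\frac{d}{dx}\int\tilde\phi\,\eta\,d\rho\big|_{x=x_i}=\int g\,\eta\,d\rho$. *Energies.* Put $$\hat E(0)=\int_{\mathbb R}f^2+\big(\alpha(x_i)g+\beta(x_i)f'\big)^2+f'^2\,d\rho,\qquad E[\tilde\phi](x)=\int_{\mathbb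 R}-\alpha\tilde\phi_{,x}^2+\gamma\tilde\phi_{,\rho}^2+H\tilde\phi^2\,d\rho,$$ where the first term of $E$ is absent at $x=x_c$, because $\alpha(x_c)=0$. *Claim.* There are constants $C_1,C_2>0$, depending only on $G,\psi$ (hence $x_c$), $\ell$ and the initial slice $x_i$, such that for every $\kappa\in\big[0,\min\{2,\tfrac12(1-x_c^2G'(x_c))\}\big]$, every $f\in H^{1,2}(\mathbb R)$ and every $g\in L^2(\mathbb R)$ the initial value problem has a unique solution $\tilde\phi\in C([x_i,x_c],H^{1,2}(\mathbb R))$. Moreover, $\tilde\phi$ has a derivative $\tilde\phi_{,x}\in C([x_i,x_c),L^2(\mathbb R))$ (in the $L^2$ sense) with $\tilde\phi_{,x}|_{x=x_i}=g$; $\tilde\phi$ has a representative that is continuous on $[x_i,x_c]\times\mathbb R$; and $$|\tilde\phi(x,\rho)|^2\le C_1\hat E(0)\quad\text{for all }(x,\rho)\in[x_i,x_c]\times\mathbb R,\qquad E[\tilde\phi](x)\le C_2\hat E(0)\quad\text{for all }x\in[x_i,x_c].$$ -/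

import Mathlib

open MeasureTheory Set
open scoped ContDiff

noncomputable section

namespace MultipoleWave

/-- Real `L²(ℝ)` with respect to Lebesgue measure. -/
abbrev L2 : Type := Lp ℝ 2 (volume : Measure ℝ)

/-- Test functions: the space `C₀^∞(ℝ)` of smooth compactly supported real functions. -/
def IsTest (η : ℝ → ℝ) : Prop := ContDiff ℝ ∞ η ∧ HasCompactSupport η

/-- The pairing `∫ u η dρ`. -/
def pairing (u : L2) (η : ℝ → ℝ) : ℝ := ∫ ρ, u ρ * η ρ

/-- `u'` is the weak (distributional) derivative of `u`. -/
def IsWeakDeriv (u u' : L2) : Prop :=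
  ∀ η : ℝ → ℝ, IsTest η → pairing u (deriv η) = -pairing u' η

lemma IsTest.deriv {η : ℝ → ℝ} (h : IsTest η) : IsTest (deriv η) :=
  ⟨(contDiff_infty_iff_deriv.1 h.1).2, h.2.deriv⟩

lemma IsTest.integrable_mul {η : ℝ → ℝ} (h : IsTest η) (u : L2) :
    Integrable (fun ρ => u ρ * η ρ) := by
  have hu : LocallyIntegrable (fun ρ => u ρ) (volume : Measure ℝ) :=
    (Lp.memLp u).locallyIntegrable (by norm_num)
  simpa [mul_comm] using hu.integrable_smul_left_of_hasCompactSupport h.1.continuous h.2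

lemma pairing_zero (η : ℝ → ℝ) : pairing 0 η = 0 := by
  have : (fun ρ => (0 : L2) ρ * η ρ) =ᵐ[volume] fun _ => 0 := by
    filter_upwards [Lp.coeFn_zero ℝ 2 (volume : Measure ℝ)] with ρ hρ
    rw [hρ, Pi.zero_apply, zero_mul]
  rw [pairing, integral_congr_ae this, integral_zero]

lemma pairing_add (u v : L2) {η : ℝ → ℝ} (h : IsTest η) :
    pairing (u + v) η = pairing u η + pairing v η := by
  unfold pairing
  rw [← integral_add (h.integrable_mul u) (h.integrable_mul v)]
  refine integral_congr_ae ?_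
  filter_upwards [Lp.coeFn_add u v] with ρ hρ
  rw [hρ, Pi.add_apply, add_mul]

lemma pairing_smul (c : ℝ) (u : L2) (η : ℝ → ℝ) :
    pairing (c • u) η = c * pairing u η := by
  unfold pairing
  rw [← integral_const_mul]
  refine integral_congr_ae ?_
  filter_upwards [Lp.coeFn_smul c u] with ρ hρ
  rw [hρ, Pi.smul_apply, smul_eq_mul, mul_assoc]

/-- The Sobolev space `H^{1,2}(ℝ)` of those `u ∈ L²(ℝ)` that have a weak derivative
`u' ∈ L²(ℝ)`. An element is stored as the pair `(u, u')` (`u'` is determined by `u`); the norm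
inherited from the `ℓ²` product is the usual one, `(‖u‖² + ‖u'‖²)^(1/2)`. -/
def H1Submodule : Submodule ℝ (WithLp 2 (L2 × L2)) where
  carrier := {w | IsWeakDeriv w.fst w.snd}
  zero_mem' := by
    intro η _
    simp [pairing_zero]
  add_mem' := by
    intro a b ha hb η hη
    have h1 := ha η hη
    have h2 := hb η hη
    simp only [WithLp.add_fst, WithLp.add_snd, pairing_add _ _ hη, pairing_add _ _ hη.deriv]
    linarith
  smul_mem' := by
    intro c a ha η hη
    have h1 := ha η hη
    simp only [WithLp.smul_fst, WithLp.smul_snd, pairing_smul]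
    rw [h1]
    ring

/-- `H^{1,2}(ℝ)` as a normed space. -/
abbrev H1 : Type := H1Submodule

/-- The function underlying an element of `H^{1,2}(ℝ)`. -/
def H1.val (u : H1) : L2 := u.1.fst

/-- The weak derivative of an element of `H^{1,2}(ℝ)`. -/
def H1.grad (u : H1) : L2 := u.1.snd

/-- The metric functions `G, ψ` of the similarity variable `x`, between the past null cone `x = 0`
and the Cauchy horizon `x = xc`, of a self-similar spherically symmetric spacetime
`ds² = -2 G e^ψ dv² + 2 e^ψ dv dr + r² dΩ²`, `x = v / r`, with a naked singularity. -/
structure IsNakedBackground (G ψ : ℝ → ℝ) (xc : ℝ) : Prop where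
  analytic_G : AnalyticOnNhd ℝ G (Ioc 0 xc)
  analytic_psi : AnalyticOnNhd ℝ ψ (Ioc 0 xc)
  /-- the two consequences of the null energy condition -/
  energy_psi : ∀ x ∈ Ioc 0 xc, x * deriv ψ x ≤ 0
  energy_G : ∀ x ∈ Ioc 0 xc, deriv G x - deriv ψ x * (1 - x * G x) * G x ≤ 0
  /-- the Cauchy horizon is the smallest positive root of `x G(x) - 1 = 0` -/
  horizon : IsLeast {x : ℝ | 0 < x ∧ x * G x - 1 = 0} xc
  nondegenerate : 0 < 1 + xc ^ 2 * deriv G xc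
  flux : deriv G xc < 0

/-- `α(x) = -2x(1 - xG)`. -/
def alpha (G : ℝ → ℝ) (x : ℝ) : ℝ := -2 * x * (1 - x * G x)

/-- `β(x) = 1 - 2xG`. -/
def beta (G : ℝ → ℝ) (x : ℝ) : ℝ := 1 - 2 * x * G x

/-- `γ(x) = 2G`. -/
def gamma (G : ℝ → ℝ) (x : ℝ) : ℝ := 2 * G x

/-- `H = ℓ(ℓ+1)e^ψ - (κ² - 2κ)γ + κβ'`; the zeroth order coefficient of the equation is `-H`. -/
def potential (G ψ : ℝ → ℝ) (l : ℕ) (κ x : ℝ) : ℝ :=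
  (l : ℝ) * (l + 1) * Real.exp (ψ x) - (κ ^ 2 - 2 * κ) * gamma G x + κ * deriv (beta G) x

/-- `φ ∈ C([xi, xc], H^{1,2}(ℝ))` solves the initial value problem
`αφ_xx + 2βφ_xρ + γφ_ρρ + (α' + 2(1-κ)β)φ_x + (β' + 2(1-κ)γ)φ_ρ
  + [(κ²-2κ)γ - κβ' - ℓ(ℓ+1)e^ψ]φ = 0` on `[xi, xc) × ℝ`,
`φ|_{x=xi} = f`, `φ_x|_{x=xi} = g`, in the weak sense: the equation and the second initial
condition hold after pairing with an arbitrary test function of `ρ`. -/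
structure IsSolution (G ψ : ℝ → ℝ) (l : ℕ) (κ xi xc : ℝ) (f : H1) (g : L2) (φ : ℝ → H1) :
    Prop where
  cont : ContinuousOn φ (Icc xi xc)
  init : φ xi = f
  smooth : ∀ η : ℝ → ℝ, IsTest η →
    ContDiffOn ℝ 2 (fun x => pairing (φ x).val η) (Ico xi xc)
  smooth_grad : ∀ η : ℝ → ℝ, IsTest η →
    ContDiffOn ℝ 1 (fun x => pairing (φ x).grad η) (Ico xi xc)
  init_deriv : ∀ η : ℝ → ℝ, IsTest η →
    derivWithin (fun x => pairing (φ x).val η) (Ico xi xc) xi = pairing g η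
  equation : ∀ η : ℝ → ℝ, IsTest η → ∀ x ∈ Ico xi xc,
    alpha G x * iteratedDerivWithin 2 (fun y => pairing (φ y).val η) (Ico xi xc) x
      + 2 * beta G x * derivWithin (fun y => pairing (φ y).grad η) (Ico xi xc) x
      - gamma G x * pairing (φ x).grad (deriv η)
      + (deriv (alpha G) x + 2 * (1 - κ) * beta G x)
          * derivWithin (fun y => pairing (φ y).val η) (Ico xi xc) x
      + (deriv (beta G) x + 2 * (1 - κ) * gamma G x) * pairing (φ x).grad η
      - potential G ψ l κ x * pairing (φ x).val η = 0

/-- The energy `∫ -α v² + γ u_ρ² + H u² dρ` on the slice at `x`, where `u` is the field and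
`v` its `x`-derivative on that slice. -/
def energy (G ψ : ℝ → ℝ) (l : ℕ) (κ x : ℝ) (u : H1) (v : L2) : ℝ :=
  ∫ ρ, (-alpha G x * v ρ ^ 2 + gamma G x * u.grad ρ ^ 2 + potential G ψ l κ x * u.val ρ ^ 2)

/-- The first-order energy `∫ u² + (αv + βu_ρ)² + u_ρ² dρ` on the slice at `x`, i.e. the squared
`L²` norm of the vector `(u, αv + βu_ρ, u_ρ)`. -/
def hatEnergy (G : ℝ → ℝ) (x : ℝ) (u : H1) (v : L2) : ℝ :=
  ∫ ρ, (u.val ρ ^ 2 + (alpha G x * v ρ + beta G x * u.grad ρ) ^ 2 + u.grad ρ ^ 2)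

end MultipoleWave

end

open MultipoleWave

/-! ### Linear differential equations on a half-open interval. -/

section
open MeasureTheory Set Filter Topology
open scoped ContDiff BoundedContinuousFunction

section LinearODE
variable {E : Type*} [NormedAddCommGroup E] [NormedSpace ℝ E] [CompleteSpace E]

/-! With `D = ∂_ρ` and `s = 2(1-κ)` the equation reads `a z'' + 2b Dz' + c D²z + (a' + sb) z' + (b'
+ sc) Dz - hz = 0`, where `a = α`, `b = β`, `c = γ`, `h = H`. Since `D` is skew, the energy `e =
-a‖z'‖² + c‖Dz‖² + ‖z‖²` satisfies `e' = (a' + 2sb)‖z'‖² + 2(b' + sc)⟪Dz, z'⟫ + c'‖Dz‖² + 2(1 -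
h)⟪z, z'⟫`. The term `‖z‖²` stands in place of `h‖z‖²` because `h` need not be positive (it is `0`
for `ℓ = κ = 0`); the bound on `E` follows afterwards from `h ≤ M`.

The difficulty is the horizon, where the weight `-a` of `‖z'‖²` vanishes. Put `A = 1 + xc² G'(xc)`.
At `xc` one has `a' = 2A`, `b = -1` and `b' + sc = 2(s - A)/xc`, and `A ≤ s` is exactly the upper
bound `κ ≤ (1 - xc² G'(xc))/2`. The first two terms then form `(s - A)(-2r² + 4rt/xc)`, in which the
negative square absorbs the cross term at the cost of `2(s - A)t²/xc²`, uniformly in `κ`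
(`degenerate_form_le`). Away from `xc` the form changes by `O(xc - x)`, which `-a ≥ m(xc - x)`
absorbs because the zero of `a` is simple. The term with `⟪z, z'⟫` costs a factor `(xc - x)^(-1/2)`,
which is integrable. Grönwall's argument gives `Regular.modeEnergy_le`, and `exists_regular`
verifies its hypotheses for the given background.

This computation is carried out for bounded `D`. On the Fourier side `∂_ρ` is replaced by its
spectral cut-offs, and the equation becomes a linear ODE in `L²`. The cut-offs are compatible, so
the difference of two approximate solutions is again a mode; the estimate for differences makes the
approximations converge uniformly up to the horizon (`Regular.exists_isLimitMode`). For uniqueness,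
the low-frequency part of any weak solution is shown to be a mode (`IsWeakSolution.exists_isMode`),
hence determined by its data. The pointwise bound is the one-dimensional Sobolev embedding applied
on each slice. -/

lemma intervalIntegrable_of_continuousOn_Ico {E : Type*} [NormedAddCommGroup E] {f : ℝ → E}
    {a b x : ℝ} (hf : ContinuousOn f (Ico a b)) (hx : x ∈ Ico a b) : IntervalIntegrable f volume a x :=
  (hf.mono (by rw [uIcc_of_le hx.1]; exact Icc_subset_Ico_right hx.2)).intervalIntegrable

lemma hasDerivWithinAt_primitive_Ico {f : ℝ → E} {a b x : ℝ} (hf : ContinuousOn f (Ico a b))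
    (hx : x ∈ Ico a b) :
    HasDerivWithinAt (fun y => ∫ t in a..y, f t) (f x) (Ico a b) x := by
  obtain ⟨c, hxc, hcb⟩ := exists_between hx.2
  have hfc : ContinuousOn f (Icc a c) := hf.mono (Icc_subset_Ico_right hcb)
  have hmem : x ∈ Icc a c := ⟨hx.1, hxc.le⟩
  have : Fact (x ∈ Icc a c) := ⟨hmem⟩
  have h := intervalIntegral.integral_hasDerivWithinAt_right (s := Icc a c) (t := Icc a c)
    (intervalIntegrable_of_continuousOn_Ico hf hx)
    (hfc.stronglyMeasurableAtFilter_nhdsWithin measurableSet_Icc x) (hfc x hmem)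
  refine h.mono_of_mem_nhdsWithin ?_
  filter_upwards [self_mem_nhdsWithin, mem_nhdsWithin_of_mem_nhds (Iio_mem_nhds hxc)] with y h1 h2
  exact ⟨h1.1, le_of_lt h2⟩

lemma continuousOn_primitive_Ico {f : ℝ → E} {a b : ℝ} (hf : ContinuousOn f (Ico a b)) :
    ContinuousOn (fun y => ∫ t in a..y, f t) (Ico a b) :=
  fun _ hx => (hasDerivWithinAt_primitive_Ico hf hx).continuousWithinAt

lemma eq_add_integral_of_hasDerivWithinAt_Ico {f f' : ℝ → E} {a b x : ℝ}
    (hf : ∀ x ∈ Ico a b, HasDerivWithinAt f (f' x) (Ico a b) x) (hf' : ContinuousOn f' (Ico a b))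
    (hx : x ∈ Ico a b) : f x = f a + ∫ t in a..x, f' t := by
  rw [intervalIntegral.integral_eq_sub_of_hasDeriv_right_of_le hx.1 _ _
    (intervalIntegrable_of_continuousOn_Ico hf' hx)]
  · abel
  · exact fun y hy => ((hf y ⟨hy.1, hy.2.trans_lt hx.2⟩).continuousWithinAt).mono
      (Icc_subset_Ico_right hx.2)
  · intro y hy
    refine ((hf y ⟨hy.1.le, hy.2.trans hx.2⟩).hasDerivAt ?_).hasDerivWithinAt
    exact Ico_mem_nhds hy.1 (hy.2.trans hx.2)

/-- Global solvability of a linear ODE on a half-open interval. -/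
theorem exists_hasDerivWithinAt_linear_Ico {A : ℝ → E →L[ℝ] E} {a b : ℝ}
    (hA : ContinuousOn A (Ico a b)) (v₀ : E) :
    ∃ v : ℝ → E, v a = v₀ ∧
      ∀ x ∈ Ico a b, HasDerivWithinAt v (A x (v x)) (Ico a b) x := by
  classical
  have hm : ContinuousOn (fun x => 2 * (1 + ‖A x‖)) (Ico a b) := by fun_prop
  -- `A` may be unbounded near `b`. The weight `exp W` with `W' = 2(1 + ‖A‖)` dominates the possible
  -- growth, so one contraction works on the whole interval.
  set W : ℝ → ℝ := fun x => ∫ t in a..x, 2 * (1 + ‖A t‖) with hW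
  have hWd := fun x (hx : x ∈ Ico a b) => hasDerivWithinAt_primitive_Ico hm hx
  have hWc : ContinuousOn W (Ico a b) := continuousOn_primitive_Ico hm
  have hW0 : ∀ x ∈ Ico a b, 0 ≤ W x := fun x hx =>
    intervalIntegral.integral_nonneg hx.1 fun t _ => by positivity
  let ext : (Ico a b →ᵇ E) → ℝ → E := fun u x => if h : x ∈ Ico a b then u ⟨x, h⟩ else 0
  have ext_c : ∀ u, ContinuousOn (ext u) (Ico a b) := by
    intro u
    rw [continuousOn_iff_continuous_domRestrict]
    convert u.continuous using 1
    ext x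
    simp only [domRestrict_apply, ext, x.2, dite_true]
  have ext_sub : ∀ u w x, ‖ext u x - ext w x‖ ≤ dist u w := by
    intro u w x
    by_cases h : x ∈ Ico a b
    · simpa only [ext, h, dite_true, ← dist_eq_norm] using BoundedContinuousFunction.dist_coe_le_dist _
    · simp only [ext, h, dite_false, sub_self, norm_zero, dist_nonneg]
  let I : (Ico a b →ᵇ E) → ℝ → E := fun u t => Real.exp (W t) • A t (ext u t)
  have I_c : ∀ u, ContinuousOn (I u) (Ico a b) := fun u =>
    (Real.continuous_exp.comp_continuousOn hWc).smul (hA.clm_apply (ext_c u))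
  have hexp : ∀ x ∈ Ico a b, ∫ t in a..x, Real.exp (W t) * (1 + ‖A t‖)
      = (Real.exp (W x) - 1) / 2 := by
    intro x hx
    have := eq_add_integral_of_hasDerivWithinAt_Ico (f := fun x => Real.exp (W x) / 2)
      (f' := fun t => Real.exp (W t) * (1 + ‖A t‖)) (a := a) (b := b) (x := x)
      (fun y hy => by
        convert! ((hWd y hy).exp.div_const 2) using 1
        ring)
      ((Real.continuous_exp.comp_continuousOn hWc).mul (by fun_prop)) hx
    have h0 : W a = 0 := by simp [hW]
    rw [h0] at this
    simp at this
    linarith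
  -- The Picard map for the rescaled unknown `u = exp(-W) v`, which is sought among bounded
  -- continuous functions.
  let Φ : (Ico a b →ᵇ E) → ℝ → E := fun u x => Real.exp (-W x) • (v₀ + ∫ t in a..x, I u t)
  have Φ_c : ∀ u, ContinuousOn (Φ u) (Ico a b) := fun u =>
    (Real.continuous_exp.comp_continuousOn hWc.neg).smul
      (continuousOn_const.add (continuousOn_primitive_Ico (I_c u)))
  have Φ_sub : ∀ u w, ∀ x ∈ Ico a b, ‖Φ u x - Φ w x‖ ≤ 1 / 2 * dist u w := by
    intro u w x hx
    have h1 : Φ u x - Φ w x = Real.exp (-W x) • ∫ t in a..x, (I u t - I w t) := by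
      rw [intervalIntegral.integral_sub (intervalIntegrable_of_continuousOn_Ico (I_c u) hx)
        (intervalIntegrable_of_continuousOn_Ico (I_c w) hx)]
      simp only [Φ, smul_add, smul_sub]
      abel
    have h2 : ‖∫ t in a..x, (I u t - I w t)‖ ≤ ∫ t in a..x, Real.exp (W t) * (1 + ‖A t‖) * dist u w := by
      refine intervalIntegral.norm_integral_le_of_norm_le hx.1 (ae_of_all _ fun t _ => ?_) ?_
      · simp only [I, ← smul_sub, ← map_sub, norm_smul, Real.norm_eq_abs, Real.abs_exp, mul_assoc]
        refine mul_le_mul_of_nonneg_left ?_ (Real.exp_pos _).le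
        refine ((A t).le_opNorm _).trans (mul_le_mul (by linarith) (ext_sub u w t) (norm_nonneg _)
          (by positivity))
      · exact intervalIntegrable_of_continuousOn_Ico
          (((Real.continuous_exp.comp_continuousOn hWc).mul (by fun_prop)).mul continuousOn_const) hx
    rw [intervalIntegral.integral_mul_const, hexp x hx] at h2
    rw [h1, norm_smul, Real.norm_eq_abs, Real.abs_exp]
    calc _ ≤ Real.exp (-W x) * ((Real.exp (W x) - 1) / 2 * dist u w) :=
          mul_le_mul_of_nonneg_left h2 (Real.exp_pos _).le
      _ = (1 - Real.exp (-W x)) / 2 * dist u w := by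
          have : Real.exp (-W x) * Real.exp (W x) = 1 := by rw [← Real.exp_add]; simp
          linear_combination (dist u w / 2) * this
      _ ≤ _ := by
          refine mul_le_mul_of_nonneg_right ?_ dist_nonneg
          have := (Real.exp_pos (-W x)).le
          linarith
  have Φ_zero : ∀ x ∈ Ico a b, ‖Φ 0 x‖ ≤ ‖v₀‖ := by
    intro x hx
    have : ∀ t, I 0 t = 0 := fun t => by
      have : ext 0 t = 0 := by
        by_cases h : t ∈ Ico a b <;> simp [ext]
      simp [I, this]
    simp only [Φ, this, intervalIntegral.integral_zero, add_zero, norm_smul, Real.norm_eq_abs,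
      Real.abs_exp]
    refine mul_le_of_le_one_left (norm_nonneg _) (Real.exp_le_one_iff.2 ?_)
    linarith [hW0 x hx]
  let T : (Ico a b →ᵇ E) → (Ico a b →ᵇ E) := fun u =>
    BoundedContinuousFunction.ofNormedAddCommGroup (fun x : Ico a b => Φ u x)
      (continuousOn_iff_continuous_domRestrict.1 (Φ_c u)) (1 / 2 * dist u 0 + ‖v₀‖) (fun x => by
        have h1 := Φ_sub u 0 x x.2
        have h2 := Φ_zero x x.2
        calc ‖Φ u x‖ = ‖(Φ u x - Φ 0 x) + Φ 0 x‖ := by simp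
          _ ≤ _ := (norm_add_le _ _).trans (add_le_add h1 h2))
  have hT : ContractingWith (1 / 2) T := by
    refine ⟨by rw [← NNReal.coe_lt_coe]; norm_num, LipschitzWith.of_dist_le_mul fun u w => ?_⟩
    have : (((1 / 2 : NNReal)) : ℝ) = 1 / 2 := by norm_num
    rw [this, BoundedContinuousFunction.dist_le (by positivity)]
    intro x
    rw [dist_eq_norm]
    exact Φ_sub u w x x.2
  set u := ContractingWith.fixedPoint T hT
  have hu : T u = u := hT.fixedPoint_isFixedPt
  have hux : ∀ x ∈ Ico a b, ext u x = Φ u x := by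
    intro x hx
    have : T u ⟨x, hx⟩ = u ⟨x, hx⟩ := by rw [hu]
    simp only [ext, hx, dite_true]
    exact this.symm
  refine ⟨fun x => v₀ + ∫ t in a..x, I u t, by simp, fun x hx => ?_⟩
  have h := (hasDerivWithinAt_primitive_Ico (I_c u) hx).const_add v₀
  convert! h using 1
  simp only [I, hux x hx, Φ, map_smul, smul_smul, ← Real.exp_add]
  simp
end LinearODE

end

/-! ### The energy estimate for a bounded skew operator in place of `∂_ρ`. -/

section
open MeasureTheory Set Filter Topology
open scoped ContDiff BoundedContinuousFunction RealInnerProductSpace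

namespace MultipoleWave

/-- Coefficients of the wave equation
`a z'' + 2 b D z' + c D² z + (a' + s b) z' + (b' + s c) D z - h z = 0` on `[x₀, x₁)`;
`da`, `db`, `dc` are the derivatives of `a`, `b`, `c`. -/
structure WaveCoeff where
  (a b c h da db dc : ℝ → ℝ)
  (s x₀ x₁ : ℝ)

namespace WaveCoeff

/-- Regularity of the coefficients up to the horizon `x₁`, where `a` degenerates, together with
the sign condition that makes the energy estimate work. -/
structure Regular (w : WaveCoeff) (m M : ℝ) : Prop where
  lt : w.x₀ < w.x₁
  m_pos : 0 < m
  M_nonneg : 0 ≤ M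
  hasDerivAt_a : ∀ x ∈ Icc w.x₀ w.x₁, HasDerivAt w.a (w.da x) x
  hasDerivAt_b : ∀ x ∈ Icc w.x₀ w.x₁, HasDerivAt w.b (w.db x) x
  hasDerivAt_c : ∀ x ∈ Icc w.x₀ w.x₁, HasDerivAt w.c (w.dc x) x
  cont_da : ContinuousOn w.da (Icc w.x₀ w.x₁)
  cont_db : ContinuousOn w.db (Icc w.x₀ w.x₁)
  cont_h : ContinuousOn w.h (Icc w.x₀ w.x₁)
  le_neg_a : ∀ x ∈ Icc w.x₀ w.x₁, m * (w.x₁ - x) ≤ -w.a x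
  le_c : ∀ x ∈ Icc w.x₀ w.x₁, m ≤ w.c x
  dc_le : ∀ x ∈ Icc w.x₀ w.x₁, w.dc x ≤ M
  abs_h_le : ∀ x ∈ Icc w.x₀ w.x₁, |w.h x| ≤ M
  form_le : ∀ x ∈ Icc w.x₀ w.x₁, ∀ r t : ℝ,
    (w.da x + 2 * w.s * w.b x) * r ^ 2 + 2 * (w.db x + w.s * w.c x) * r * t
      ≤ M * (-w.a x * r ^ 2 + t ^ 2)

/-- The energy of a mode. -/
noncomputable def modeEnergy {E : Type*} [NormedAddCommGroup E] (w : WaveCoeff) (x : ℝ)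
    (z y v : E) : ℝ :=
  -w.a x * ‖v‖ ^ 2 + w.c x * ‖y‖ ^ 2 + ‖z‖ ^ 2

variable {E : Type*} [NormedAddCommGroup E] [InnerProductSpace ℝ E]

/-- The velocity `z'` expressed through `z` and `Y = a z' + 2 b D z + s b z`. -/
noncomputable def vel (w : WaveCoeff) (D : E →L[ℝ] E) (z Y : ℝ → E) (x : ℝ) : E :=
  (w.a x)⁻¹ • (Y x - (2 * w.b x) • D (z x) - (w.s * w.b x) • z x)

/-- The right-hand side of the equation for `Y = a z' + 2 b D z + s b z`. -/
noncomputable def force (w : WaveCoeff) (D : E →L[ℝ] E) (z : ℝ → E) (x : ℝ) : E :=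
  -(w.c x • D (D (z x))) + (w.db x - w.s * w.c x) • D (z x) + (w.h x + w.s * w.db x) • z x

/-- A solution of the wave equation with a bounded operator `D` in place of `∂_ρ`, written as a
first-order system. -/
structure IsMode (w : WaveCoeff) (D : E →L[ℝ] E) (z Y : ℝ → E) : Prop where
  left : ∀ x ∈ Ico w.x₀ w.x₁, HasDerivWithinAt z (w.vel D z Y x) (Ico w.x₀ w.x₁) x
  right : ∀ x ∈ Ico w.x₀ w.x₁, HasDerivWithinAt Y (w.force D z x) (Ico w.x₀ w.x₁) x

/-- The growth factor in the energy estimate. -/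
noncomputable def growth (m M L : ℝ) : ℝ :=
  Real.exp ((M + 2 * M / m) * L + 2 * ((1 + M) / √m) * √L)

lemma growth_pos (m M L : ℝ) : 0 < growth m M L := Real.exp_pos _

section
variable {w : WaveCoeff} {m M : ℝ} (hw : w.Regular m M)
include hw

lemma Regular.neg_a_nonneg {x : ℝ} (hx : x ∈ Icc w.x₀ w.x₁) : 0 ≤ -w.a x :=
  (mul_nonneg hw.m_pos.le (sub_nonneg.2 hx.2)).trans (hw.le_neg_a x hx)

lemma Regular.a_neg {x : ℝ} (hx : x ∈ Ico w.x₀ w.x₁) : w.a x < 0 := by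
  have := hw.le_neg_a x (Ico_subset_Icc_self hx)
  have := mul_pos hw.m_pos (sub_pos.2 hx.2)
  linarith

lemma Regular.cont_a : ContinuousOn w.a (Icc w.x₀ w.x₁) :=
  fun x hx => (hw.hasDerivAt_a x hx).continuousAt.continuousWithinAt

lemma Regular.cont_b : ContinuousOn w.b (Icc w.x₀ w.x₁) :=
  fun x hx => (hw.hasDerivAt_b x hx).continuousAt.continuousWithinAt

lemma Regular.cont_c : ContinuousOn w.c (Icc w.x₀ w.x₁) :=
  fun x hx => (hw.hasDerivAt_c x hx).continuousAt.continuousWithinAt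

lemma Regular.cont_inv_a : ContinuousOn (fun x => (w.a x)⁻¹) (Ico w.x₀ w.x₁) :=
  (hw.cont_a.mono Ico_subset_Icc_self).inv₀ fun _ hx => (hw.a_neg hx).ne

lemma Regular.modeEnergy_nonneg {E : Type*} [NormedAddCommGroup E] {x : ℝ}
    (hx : x ∈ Icc w.x₀ w.x₁) (z y v : E) :
    0 ≤ w.modeEnergy x z y v := by
  have h1 := hw.neg_a_nonneg hx
  have h2 := hw.m_pos.le.trans (hw.le_c x hx)
  unfold modeEnergy
  positivity

/-- The bound on the derivative of the energy. -/
lemma Regular.energy_rate_le {x : ℝ} (hx : x ∈ Ico w.x₀ w.x₁) (z y v : E) :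
    (w.da x + 2 * w.s * w.b x) * ‖v‖ ^ 2 + 2 * (w.db x + w.s * w.c x) * ⟪y, v⟫
        + w.dc x * ‖y‖ ^ 2 + 2 * (1 - w.h x) * ⟪z, v⟫
      ≤ ((M + 2 * M / m) + (1 + M) / √m * (1 / √(w.x₁ - x))) * w.modeEnergy x z y v := by
  have hx' := Ico_subset_Icc_self hx
  have hm := hw.m_pos
  have hM := hw.M_nonneg
  set d := w.x₁ - x with hd
  have hd0 : 0 < d := sub_pos.2 hx.2
  have ha := hw.le_neg_a x hx'
  have hc := hw.le_c x hx'
  -- the quadratic form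
  have h1 : (w.da x + 2 * w.s * w.b x) * ‖v‖ ^ 2 + 2 * (w.db x + w.s * w.c x) * ⟪y, v⟫
      ≤ M * (-w.a x * ‖v‖ ^ 2 + ‖y‖ ^ 2) := by
    have hi := abs_real_inner_le_norm y v
    -- `form_le` holds for every real `t`. Taking `t = ‖y‖` or `t = -‖y‖` according to the sign of
    -- the cross coefficient lets Cauchy–Schwarz act in the right direction.
    rcases le_total 0 (w.db x + w.s * w.c x) with hq | hq
    · have := hw.form_le x hx' ‖v‖ ‖y‖
      have h2 : (w.db x + w.s * w.c x) * ⟪y, v⟫ ≤ (w.db x + w.s * w.c x) * (‖y‖ * ‖v‖) :=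
        mul_le_mul_of_nonneg_left ((le_abs_self _).trans hi) hq
      linarith
    · have := hw.form_le x hx' ‖v‖ (-‖y‖)
      have h2 : (w.db x + w.s * w.c x) * ⟪y, v⟫ ≤ (w.db x + w.s * w.c x) * (-(‖y‖ * ‖v‖)) :=
        mul_le_mul_of_nonpos_left (neg_le_of_abs_le hi) hq
      rw [neg_sq] at this
      linarith
  have h2 : w.dc x * ‖y‖ ^ 2 ≤ M * ‖y‖ ^ 2 :=
    mul_le_mul_of_nonneg_right (hw.dc_le x hx') (by positivity)
  have h3 : 2 * (1 - w.h x) * ⟪z, v⟫ ≤ (1 + M) * (2 * (‖z‖ * ‖v‖)) := by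
    have e1 : |1 - w.h x| ≤ 1 + M := by
      have := abs_le.1 (hw.abs_h_le x hx')
      rw [abs_le]; constructor <;> linarith
    have e2 := mul_le_mul e1 (abs_real_inner_le_norm z v) (abs_nonneg _) (by linarith)
    rw [← abs_mul] at e2
    linarith [le_abs_self ((1 - w.h x) * ⟪z, v⟫)]
  have hsm : 0 < √m := Real.sqrt_pos.2 hm
  have hsd : 0 < √d := Real.sqrt_pos.2 hd0
  -- Young's inequality with weight `√(m d)`; this produces the integrable singularity `d^(-1/2)`.
  have h4 : 2 * (‖z‖ * ‖v‖) ≤ (1 / (√m * √d)) * (‖z‖ ^ 2 + -w.a x * ‖v‖ ^ 2) := by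
    rw [one_div, ← div_eq_inv_mul, le_div_iff₀ (by positivity)]
    have e1 : (√m * √d * ‖v‖) ^ 2 ≤ -w.a x * ‖v‖ ^ 2 := by
      rw [mul_pow, mul_pow, Real.sq_sqrt hm.le, Real.sq_sqrt hd0.le]
      exact mul_le_mul_of_nonneg_right ha (by positivity)
    nlinarith [sq_nonneg (‖z‖ - √m * √d * ‖v‖)]
  have hy : ‖y‖ ^ 2 ≤ (1 / m) * (w.c x * ‖y‖ ^ 2) := by
    rw [one_div, ← div_eq_inv_mul, le_div_iff₀ hm]
    nlinarith [mul_le_mul_of_nonneg_right hc (sq_nonneg ‖y‖)]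
  have ev : 0 ≤ -w.a x * ‖v‖ ^ 2 := mul_nonneg (hw.neg_a_nonneg hx') (by positivity)
  have ey : 0 ≤ w.c x * ‖y‖ ^ 2 := mul_nonneg (hm.le.trans hc) (by positivity)
  have ez : 0 ≤ ‖z‖ ^ 2 := by positivity
  have h5 : M * (-w.a x * ‖v‖ ^ 2 + ‖y‖ ^ 2) + M * ‖y‖ ^ 2
      ≤ (M + 2 * M / m) * w.modeEnergy x z y v := by
    have e1 : 2 * M * ‖y‖ ^ 2 ≤ 2 * M / m * (w.c x * ‖y‖ ^ 2) := by
      have := mul_le_mul_of_nonneg_left hy (by positivity : 0 ≤ 2 * M)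
      calc _ ≤ _ := this
        _ = _ := by ring
    have e2 : 0 ≤ 2 * M / m := by positivity
    unfold modeEnergy
    nlinarith [mul_nonneg e2 ev, mul_nonneg e2 ez, mul_nonneg hM ey, mul_nonneg hM ez]
  have h6 : (1 + M) * (2 * (‖z‖ * ‖v‖)) ≤ (1 + M) / √m * (1 / √d) * w.modeEnergy x z y v := by
    calc _ ≤ (1 + M) * ((1 / (√m * √d)) * (‖z‖ ^ 2 + -w.a x * ‖v‖ ^ 2)) :=
          mul_le_mul_of_nonneg_left h4 (by linarith)
      _ = (1 + M) / √m * (1 / √d) * (‖z‖ ^ 2 + -w.a x * ‖v‖ ^ 2) := by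
          field_simp
      _ ≤ _ := by
          refine mul_le_mul_of_nonneg_left ?_ (by positivity)
          unfold modeEnergy
          linarith
  rw [add_mul]
  linarith

/-- The energy estimate for modes. -/
theorem Regular.modeEnergy_le {D : E →L[ℝ] E} (hD : ∀ u v : E, ⟪D u, v⟫ = -⟪u, D v⟫)
    {z Y : ℝ → E} (hz : w.IsMode D z Y) {x : ℝ} (hx : x ∈ Ico w.x₀ w.x₁) :
    w.modeEnergy x (z x) (D (z x)) (w.vel D z Y x)
      ≤ growth m M (w.x₁ - w.x₀) *
        w.modeEnergy w.x₀ (z w.x₀) (D (z w.x₀)) (w.vel D z Y w.x₀) := by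
  set K₁ := M + 2 * M / m with hK₁
  set K₂ := (1 + M) / √m with hK₂
  have hK₁0 : 0 ≤ K₁ := by have := hw.m_pos; have := hw.M_nonneg; positivity
  have hK₂0 : 0 ≤ K₂ := by have := hw.m_pos; have := hw.M_nonneg; positivity
  set v := w.vel D z Y with hv
  set e : ℝ → ℝ := fun x => w.modeEnergy x (z x) (D (z x)) (v x) with he
  -- The integrating factor: `q'/q = -K₁ - K₂ / √(x₁ - x)` is minus the rate in `energy_rate_le`, so
  -- `e q` decreases.
  set q : ℝ → ℝ := fun x => Real.exp (-K₁ * (x - w.x₀) + 2 * K₂ * √(w.x₁ - x)) with hq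
  have zc : ContinuousOn z (Ico w.x₀ w.x₁) := fun x hx => (hz.left x hx).continuousWithinAt
  have Yc : ContinuousOn Y (Ico w.x₀ w.x₁) := fun x hx => (hz.right x hx).continuousWithinAt
  have ac := hw.cont_a.mono (Ico_subset_Icc_self : Ico w.x₀ w.x₁ ⊆ Icc w.x₀ w.x₁)
  have bc := hw.cont_b.mono (Ico_subset_Icc_self : Ico w.x₀ w.x₁ ⊆ Icc w.x₀ w.x₁)
  have cc := hw.cont_c.mono (Ico_subset_Icc_self : Ico w.x₀ w.x₁ ⊆ Icc w.x₀ w.x₁)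
  have iac := hw.cont_inv_a
  have vc : ContinuousOn v (Ico w.x₀ w.x₁) := by
    simp only [hv]; unfold vel
    fun_prop
  have ec : ContinuousOn e (Ico w.x₀ w.x₁) := by
    simp only [he]; unfold modeEnergy
    fun_prop
  have qc : ContinuousOn q (Ico w.x₀ w.x₁) := by
    simp only [hq]; fun_prop
  have hanti : AntitoneOn (fun x => e x * q x) (Ico w.x₀ w.x₁) := by
    have key : ∀ x ∈ Ioo w.x₀ w.x₁, ∃ r ≤ 0, HasDerivAt (fun x => e x * q x) r x := by
      intro x hx
      have hxI : x ∈ Ico w.x₀ w.x₁ := Ioo_subset_Ico_self hx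
      have hx' : x ∈ Icc w.x₀ w.x₁ := Ioo_subset_Icc_self hx
      have hn := Ico_mem_nhds hx.1 hx.2
      have ane : w.a x ≠ 0 := (hw.a_neg hxI).ne
      have dz : HasDerivAt z (v x) x := (hz.left x hxI).hasDerivAt hn
      have dY : HasDerivAt Y (w.force D z x) x := (hz.right x hxI).hasDerivAt hn
      have dDz : HasDerivAt (fun x => D (z x)) (D (v x)) x := D.hasFDerivAt.comp_hasDerivAt x dz
      have da := hw.hasDerivAt_a x hx'
      have db := hw.hasDerivAt_b x hx'
      have dc := hw.hasDerivAt_c x hx'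
      obtain ⟨v', dv⟩ : ∃ v', HasDerivAt v v' x :=
        ⟨_, (da.inv ane).smul ((dY.sub ((db.const_mul 2).smul dDz)).sub
          ((db.const_mul w.s).smul dz))⟩
      -- Differentiating `a v + 2b Dz + s b z = Y` recovers the second-order equation from the
      -- system.
      have heq : w.a x • v' + w.da x • v x + (2 * w.b x) • D (v x) + (2 * w.db x) • D (z x)
          + (w.s * w.b x) • v x + (w.s * w.db x) • z x = w.force D z x := by
        have h1 : HasDerivAt (fun x => w.a x • v x + (2 * w.b x) • D (z x) + (w.s * w.b x) • z x)
            (w.a x • v' + w.da x • v x + ((2 * w.b x) • D (v x) + (2 * w.db x) • D (z x))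
              + ((w.s * w.b x) • v x + (w.s * w.db x) • z x)) x :=
          ((da.smul dv).add ((db.const_mul 2).smul dDz)).add ((db.const_mul w.s).smul dz)
        have h2 : (fun x => w.a x • v x + (2 * w.b x) • D (z x) + (w.s * w.b x) • z x)
            =ᶠ[𝓝 x] Y := by
          filter_upwards [Ico_mem_nhds hx.1 hx.2] with t ht
          simp only [hv, vel, smul_smul, mul_inv_cancel₀ (hw.a_neg ht).ne, one_smul]
          abel
        have := (h1.congr_of_eventuallyEq h2.symm).unique dY
        rw [← this]; abel
      -- Pairing the equation with `v`: skewness kills `⟪Dv, v⟫` and turns `⟪D²z, v⟫` into `-⟪Dz,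
      -- Dv⟫`, which later cancels against the derivative of `c‖Dz‖²`.
      have hav : w.a x * ⟪v', v x⟫ = -(w.da x + w.s * w.b x) * ‖v x‖ ^ 2
          - (w.db x + w.s * w.c x) * ⟪D (z x), v x⟫ + w.h x * ⟪z x, v x⟫
          + w.c x * ⟪D (z x), D (v x)⟫ := by
        have h1 := congrArg (fun u => ⟪u, v x⟫) heq
        have h2 : ⟪D (v x), v x⟫ = 0 := by
          have := hD (v x) (v x)
          rw [real_inner_comm] at this
          rw [real_inner_comm]
          linarith
        have h3 := hD (D (z x)) (v x)
        simp only [force, inner_add_left, inner_neg_left, real_inner_smul_left,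
          real_inner_self_eq_norm_sq, h2, h3] at h1
        linarith
      have de : HasDerivAt e ((w.da x + 2 * w.s * w.b x) * ‖v x‖ ^ 2
          + 2 * (w.db x + w.s * w.c x) * ⟪D (z x), v x⟫
          + w.dc x * ‖D (z x)‖ ^ 2 + 2 * (1 - w.h x) * ⟪z x, v x⟫) x := by
        have h1 := ((da.neg.mul dv.norm_sq).add (dc.mul dDz.norm_sq)).add dz.norm_sq
        convert! h1 using 1
        rw [real_inner_comm v' (v x), Pi.neg_apply]
        linear_combination 2 * hav
      have hd : 0 < w.x₁ - x := sub_pos.2 hx.2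
      have dq : HasDerivAt q (q x * (-K₁ - K₂ * (1 / √(w.x₁ - x)))) x := by
        have h1 : HasDerivAt (fun x => w.x₁ - x) (-1) x := by
          simpa using (hasDerivAt_id x).const_sub w.x₁
        have h2 := (((hasDerivAt_id x).sub_const w.x₀).const_mul (-K₁)).add
          ((h1.sqrt hd.ne').const_mul (2 * K₂))
        convert! h2.exp using 1
        have : 0 < √(w.x₁ - x) := Real.sqrt_pos.2 hd
        simp only [hq, id, Pi.add_apply]
        field_simp
        ring
      refine ⟨_, ?_, de.mul dq⟩
      have hrate := hw.energy_rate_le hxI (z x) (D (z x)) (v x)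
      have hqp : 0 < q x := Real.exp_pos _
      have hh := mul_le_mul_of_nonneg_right hrate hqp.le
      simp only [he]
      linarith
    refine antitoneOn_of_deriv_nonpos (convex_Ico _ _) (ec.mul qc) ?_ ?_
    · rw [interior_Ico]
      intro x hx
      obtain ⟨r, -, h⟩ := key x hx
      exact h.differentiableAt.differentiableWithinAt
    · rw [interior_Ico]
      intro x hx
      obtain ⟨r, hr, h⟩ := key x hx
      rwa [h.deriv]
  have h0 : w.x₀ ∈ Ico w.x₀ w.x₁ := ⟨le_rfl, hw.lt⟩
  have h1 : e x * q x ≤ e w.x₀ * q w.x₀ := hanti h0 hx hx.1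
  have he0 : 0 ≤ e w.x₀ := hw.modeEnergy_nonneg (Ico_subset_Icc_self h0) _ _ _
  have hq1 : Real.exp (-K₁ * (w.x₁ - w.x₀)) ≤ q x := by
    refine Real.exp_le_exp.2 ?_
    have := mul_le_mul_of_nonneg_left hx.2.le hK₁0
    have := mul_nonneg hK₂0 (Real.sqrt_nonneg (w.x₁ - x))
    linarith
  have hex : 0 ≤ e x := hw.modeEnergy_nonneg (Ico_subset_Icc_self hx) _ _ _
  have h2 : e x * Real.exp (-K₁ * (w.x₁ - w.x₀)) ≤ e w.x₀ * q w.x₀ :=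
    (mul_le_mul_of_nonneg_left hq1 hex).trans h1
  have h3 : q w.x₀ = Real.exp (2 * K₂ * √(w.x₁ - w.x₀)) := by simp [hq]
  rw [h3] at h2
  have h4 : growth m M (w.x₁ - w.x₀) = Real.exp (2 * K₂ * √(w.x₁ - w.x₀)) *
      Real.exp (K₁ * (w.x₁ - w.x₀)) := by
    rw [← Real.exp_add, growth]; congr 1; ring
  have h5 : Real.exp (-K₁ * (w.x₁ - w.x₀)) * Real.exp (K₁ * (w.x₁ - w.x₀)) = 1 := by
    rw [← Real.exp_add]; simp
  have h6 := mul_le_mul_of_nonneg_right h2 (Real.exp_pos (K₁ * (w.x₁ - w.x₀))).le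
  rw [mul_assoc, h5, mul_one] at h6
  rw [h4]
  calc _ ≤ _ := h6
    _ = _ := by simp only [he]; ring

/-- Modes exist for arbitrary data. -/
theorem Regular.exists_isMode [CompleteSpace E] (D : E →L[ℝ] E) (z₀ v₀ : E) :
    ∃ z Y : ℝ → E, w.IsMode D z Y ∧ z w.x₀ = z₀ ∧ w.vel D z Y w.x₀ = v₀ := by
  have ac := hw.cont_a.mono (Ico_subset_Icc_self : Ico w.x₀ w.x₁ ⊆ Icc w.x₀ w.x₁)
  have bc := hw.cont_b.mono (Ico_subset_Icc_self : Ico w.x₀ w.x₁ ⊆ Icc w.x₀ w.x₁)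
  have cc := hw.cont_c.mono (Ico_subset_Icc_self : Ico w.x₀ w.x₁ ⊆ Icc w.x₀ w.x₁)
  have dbc := hw.cont_db.mono (Ico_subset_Icc_self : Ico w.x₀ w.x₁ ⊆ Icc w.x₀ w.x₁)
  have hc := hw.cont_h.mono (Ico_subset_Icc_self : Ico w.x₀ w.x₁ ⊆ Icc w.x₀ w.x₁)
  have iac := hw.cont_inv_a
  let p₁ := ContinuousLinearMap.fst ℝ E E
  let p₂ := ContinuousLinearMap.snd ℝ E E
  let A : ℝ → (E × E) →L[ℝ] (E × E) := fun x =>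
    (ContinuousLinearMap.inl ℝ E E).comp
      ((w.a x)⁻¹ • (p₂ - (2 * w.b x) • D.comp p₁ - (w.s * w.b x) • p₁)) +
    (ContinuousLinearMap.inr ℝ E E).comp
      (-(w.c x • D.comp (D.comp p₁)) + (w.db x - w.s * w.c x) • D.comp p₁
        + (w.h x + w.s * w.db x) • p₁)
  have hA : ContinuousOn A (Ico w.x₀ w.x₁) := by
    simp only [A]
    fun_prop
  -- The second component is the value of `Y` for which the velocity at `x₀` is `v₀`.
  obtain ⟨u, hu0, hu⟩ := exists_hasDerivWithinAt_linear_Ico hA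
    (z₀, w.a w.x₀ • v₀ + (2 * w.b w.x₀) • D z₀ + (w.s * w.b w.x₀) • z₀)
  refine ⟨fun x => (u x).1, fun x => (u x).2, ⟨fun x hx => ?_, fun x hx => ?_⟩, by simp [hu0], ?_⟩
  · convert! p₁.hasFDerivAt.comp_hasDerivWithinAt x (hu x hx) using 1
    simp [A, p₁, p₂, vel]
  · convert! p₂.hasFDerivAt.comp_hasDerivWithinAt x (hu x hx) using 1
    simp [A, p₁, p₂, force]
  · have : w.a w.x₀ ≠ 0 := (hw.a_neg ⟨le_rfl, hw.lt⟩).ne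
    simp only [vel, hu0]
    rw [add_sub_right_comm, add_sub_cancel_right, add_sub_cancel_right, smul_smul,
      inv_mul_cancel₀ this, one_smul]

end

lemma vel_sub (w : WaveCoeff) (D : E →L[ℝ] E) (z z' Y Y' : ℝ → E) (x : ℝ) :
    w.vel D (fun x => z x - z' x) (fun x => Y x - Y' x) x = w.vel D z Y x - w.vel D z' Y' x := by
  simp only [vel, map_sub, smul_sub]; abel

lemma force_sub (w : WaveCoeff) (D : E →L[ℝ] E) (z z' : ℝ → E) (x : ℝ) :
    w.force D (fun x => z x - z' x) x = w.force D z x - w.force D z' x := by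
  simp only [force, map_sub, smul_sub]; abel

lemma IsMode.sub {w : WaveCoeff} {D : E →L[ℝ] E} {z z' Y Y' : ℝ → E} (h : w.IsMode D z Y)
    (h' : w.IsMode D z' Y') : w.IsMode D (fun x => z x - z' x) (fun x => Y x - Y' x) where
  left x hx := by rw [vel_sub]; exact (h.left x hx).sub (h'.left x hx)
  right x hx := by rw [force_sub]; exact (h.right x hx).sub (h'.right x hx)

lemma vel_map {w : WaveCoeff} {D D' P : E →L[ℝ] E} {z Y : ℝ → E} {x : ℝ}
    (h : D' (P (z x)) = P (D (z x))) :
    w.vel D' (fun x => P (z x)) (fun x => P (Y x)) x = P (w.vel D z Y x) := by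
  simp only [vel, map_smul, map_sub, h]

/-- A bounded operator that intertwines `D` and `D'` along a mode maps it to a mode. -/
lemma IsMode.map {w : WaveCoeff} {D D' : E →L[ℝ] E} {z Y : ℝ → E} (h : w.IsMode D z Y)
    (P : E →L[ℝ] E) (h1 : ∀ x ∈ Ico w.x₀ w.x₁, D' (P (z x)) = P (D (z x)))
    (h2 : ∀ x ∈ Ico w.x₀ w.x₁, D' (P (D (z x))) = P (D (D (z x)))) :
    w.IsMode D' (fun x => P (z x)) (fun x => P (Y x)) where
  left x hx := by
    rw [vel_map (h1 x hx)]
    exact P.hasFDerivAt.comp_hasDerivWithinAt x (h.left x hx)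
  right x hx := by
    convert! P.hasFDerivAt.comp_hasDerivWithinAt x (h.right x hx) using 1
    simp only [force, map_add, map_neg, map_smul, h1 x hx, h2 x hx]

/-- A mode with vanishing data vanishes. -/
lemma IsMode.eq_zero {w : WaveCoeff} {m M : ℝ} (hw : w.Regular m M) {D : E →L[ℝ] E}
    (hD : ∀ u v : E, ⟪D u, v⟫ = -⟪u, D v⟫) {z Y : ℝ → E} (h : w.IsMode D z Y)
    (h0 : z w.x₀ = 0) (h1 : w.vel D z Y w.x₀ = 0) {x : ℝ} (hx : x ∈ Ico w.x₀ w.x₁) : z x = 0 := by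
  have h2 := hw.modeEnergy_le hD h hx
  have h3 := hw.neg_a_nonneg (Ico_subset_Icc_self hx)
  have h4 := hw.m_pos.le.trans (hw.le_c x (Ico_subset_Icc_self hx))
  have h5 := mul_nonneg h3 (sq_nonneg ‖w.vel D z Y x‖)
  have h6 := mul_nonneg h4 (sq_nonneg ‖D (z x)‖)
  simp only [modeEnergy, h0, h1, map_zero, norm_zero] at h2
  have : ‖z x‖ ^ 2 ≤ 0 := by norm_num at h2; linarith
  simpa using this

end WaveCoeff
end MultipoleWave

end

/-! ### Limits of the cut-off modes, up to the horizon. -/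

section
open MeasureTheory Set Filter Topology
open scoped ContDiff BoundedContinuousFunction RealInnerProductSpace

section UniformLimits
variable {E : Type*} [NormedAddCommGroup E]

lemma exists_tendstoUniformlyOn [CompleteSpace E] {f : ℕ → ℝ → E} {S : Set ℝ}
    (h : ∀ ε > 0, ∃ N, ∀ m ≥ N, ∀ n ≥ N, ∀ x ∈ S, ‖f m x - f n x‖ < ε) :
    ∃ g : ℝ → E, TendstoUniformlyOn f g atTop S := by
  classical
  have hc : UniformCauchySeqOn f atTop S := by
    rw [Metric.uniformCauchySeqOn_iff]
    intro ε hε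
    obtain ⟨N, hN⟩ := h ε hε
    exact ⟨N, fun m hm n hn x hx => by rw [dist_eq_norm]; exact hN m hm n hn x hx⟩
  have : ∀ x, ∃ y, x ∈ S → Tendsto (fun n => f n x) atTop (𝓝 y) := by
    intro x
    by_cases hx : x ∈ S
    · obtain ⟨y, hy⟩ := cauchySeq_tendsto_of_complete (hc.cauchySeq hx)
      exact ⟨y, fun _ => hy⟩
    · exact ⟨0, fun h => (hx h).elim⟩
  choose g hg using this
  exact ⟨g, hc.tendstoUniformlyOn_of_tendsto hg⟩

lemma tendsto_intervalIntegral_of_bound_Ico [NormedSpace ℝ E] {f : ℕ → ℝ → E} {g : ℝ → E}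
    {B : ℝ → ℝ} {a b x : ℝ} (hf : ∀ n, ContinuousOn (f n) (Ico a b))
    (hB : ContinuousOn B (Ico a b)) (hfB : ∀ᶠ n in atTop, ∀ t ∈ Ico a b, ‖f n t‖ ≤ B t)
    (hfg : ∀ t ∈ Ico a b, Tendsto (fun n => f n t) atTop (𝓝 (g t))) (hx : x ∈ Ico a b) :
    Tendsto (fun n => ∫ t in a..x, f n t) atTop (𝓝 (∫ t in a..x, g t)) := by
  have hsub : uIoc a x ⊆ Ico a b := by
    rw [uIoc_of_le hx.1]; exact fun t ht => ⟨ht.1.le, ht.2.trans_lt hx.2⟩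
  refine intervalIntegral.tendsto_integral_filter_of_dominated_convergence B ?_ ?_
    (intervalIntegrable_of_continuousOn_Ico hB hx) ?_
  · exact Eventually.of_forall fun n =>
      ((hf n).mono hsub).aestronglyMeasurable measurableSet_uIoc
  · filter_upwards [hfB] with n hn
    exact ae_of_all _ fun t ht => hn t (hsub ht)
  · exact ae_of_all _ fun t ht => hfg t (hsub ht)

end UniformLimits

namespace MultipoleWave

/-- Bounded operators `P n`, `D n` that behave like the spectral cut-offs `1_{|D| ≤ n}` and
`D 1_{|D| ≤ n}` of a skew-adjoint operator `D`. -/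
structure IsSpectralFamily {E : Type*} [NormedAddCommGroup E] [InnerProductSpace ℝ E]
    (P D : ℕ → E →L[ℝ] E) : Prop where
  skew : ∀ n u v, ⟪D n u, v⟫ = -⟪u, D n v⟫
  tendsto : ∀ u, Tendsto (fun n => P n u) atTop (𝓝 u)
  P_P : ∀ {n m}, n ≤ m → ∀ u, P n (P m u) = P n u
  D_P : ∀ {n m}, n ≤ m → ∀ u, D m (P n u) = D n u
  P_D : ∀ {n m}, n ≤ m → ∀ u, P n (D m u) = D n u
  D_P_le : ∀ {n m}, n ≤ m → ∀ u, D n (P m u) = D n u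
  P_D_le : ∀ {n m}, n ≤ m → ∀ u, P m (D n u) = D n u

namespace WaveCoeff

variable {E : Type*} [NormedAddCommGroup E] [InnerProductSpace ℝ E] {w : WaveCoeff} {m M : ℝ}

lemma IsMode.continuousOn_left {D : E →L[ℝ] E} {z Y : ℝ → E} (hz : w.IsMode D z Y) :
    ContinuousOn z (Ico w.x₀ w.x₁) := fun x hx => (hz.left x hx).continuousWithinAt

lemma IsMode.continuousOn_right {D : E →L[ℝ] E} {z Y : ℝ → E} (hz : w.IsMode D z Y) :
    ContinuousOn Y (Ico w.x₀ w.x₁) := fun x hx => (hz.right x hx).continuousWithinAt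

lemma IsMode.continuousOn_vel (hw : w.Regular m M) {D : E →L[ℝ] E} {z Y : ℝ → E}
    (hz : w.IsMode D z Y) : ContinuousOn (w.vel D z Y) (Ico w.x₀ w.x₁) := by
  have zc := hz.continuousOn_left
  have Yc := hz.continuousOn_right
  have bc := hw.cont_b.mono (Ico_subset_Icc_self : Ico w.x₀ w.x₁ ⊆ Icc w.x₀ w.x₁)
  have iac := hw.cont_inv_a
  unfold vel
  fun_prop

lemma Regular.sq_norm_left_le {E : Type*} [NormedAddCommGroup E] (hw : w.Regular m M) {x : ℝ}
    (hx : x ∈ Icc w.x₀ w.x₁) (z y v : E) :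
    ‖z‖ ^ 2 ≤ w.modeEnergy x z y v := by
  have h1 := mul_nonneg (hw.neg_a_nonneg hx) (sq_nonneg ‖v‖)
  have h2 := mul_nonneg (hw.m_pos.le.trans (hw.le_c x hx)) (sq_nonneg ‖y‖)
  unfold modeEnergy
  linarith

lemma Regular.sq_norm_grad_le {E : Type*} [NormedAddCommGroup E] (hw : w.Regular m M) {x : ℝ}
    (hx : x ∈ Icc w.x₀ w.x₁) (z y v : E) :
    m * ‖y‖ ^ 2 ≤ w.modeEnergy x z y v := by
  have h1 := mul_nonneg (hw.neg_a_nonneg hx) (sq_nonneg ‖v‖)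
  have h2 := mul_le_mul_of_nonneg_right (hw.le_c x hx) (sq_nonneg ‖y‖)
  have h3 := sq_nonneg ‖z‖
  unfold modeEnergy
  linarith

lemma Regular.sq_norm_vel_le (hw : w.Regular m M) {x : ℝ} (hx : x ∈ Icc w.x₀ w.x₁) (z y v : E) :
    m * ‖√(w.x₁ - x) • v‖ ^ 2 ≤ w.modeEnergy x z y v := by
  have h1 := mul_le_mul_of_nonneg_right (hw.le_neg_a x hx) (sq_nonneg ‖v‖)
  have h2 := mul_nonneg (hw.m_pos.le.trans (hw.le_c x hx)) (sq_nonneg ‖y‖)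
  have h3 := sq_nonneg ‖z‖
  rw [norm_smul, mul_pow, Real.norm_eq_abs, sq_abs, Real.sq_sqrt (sub_nonneg.2 hx.2)]
  unfold modeEnergy
  linarith

/-- A mode extends continuously to the horizon. -/
lemma IsMode.exists_extension [CompleteSpace E] (hw : w.Regular m M) {D : E →L[ℝ] E}
    (hD : ∀ u v : E, ⟪D u, v⟫ = -⟪u, D v⟫) {z Y : ℝ → E} (hz : w.IsMode D z Y) :
    ∃ z' : ℝ → E, ContinuousOn z' (Icc w.x₀ w.x₁) ∧ EqOn z z' (Ico w.x₀ w.x₁) := by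
  set v := w.vel D z Y
  have vc := hz.continuousOn_vel hw
  -- The energy controls `(x₁ - x)‖v‖²`, so `v` blows up at most like `(x₁ - x)^(-1/2)` and its
  -- primitive is continuous at `x₁`.
  obtain ⟨B, hB0, hB⟩ : ∃ B, 0 ≤ B ∧ ∀ x ∈ Ico w.x₀ w.x₁, ‖v x‖ ≤ B * (w.x₁ - x) ^ (-(1 / 2) : ℝ) := by
    set e := growth m M (w.x₁ - w.x₀) *
        w.modeEnergy w.x₀ (z w.x₀) (D (z w.x₀)) (w.vel D z Y w.x₀)
    refine ⟨√(e / m), Real.sqrt_nonneg _, fun x hx => ?_⟩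
    have h1 := (hw.sq_norm_vel_le (Ico_subset_Icc_self hx) _ _ _).trans (hw.modeEnergy_le hD hz hx)
    have hd : 0 < w.x₁ - x := sub_pos.2 hx.2
    have h2 : ‖√(w.x₁ - x) • v x‖ ≤ √(e / m) := by
      refine Real.le_sqrt_of_sq_le ?_
      rw [le_div_iff₀ hw.m_pos, mul_comm]
      exact h1
    rw [norm_smul, Real.norm_eq_abs, abs_of_nonneg (Real.sqrt_nonneg _)] at h2
    rw [Real.rpow_neg hd.le, ← Real.sqrt_eq_rpow, ← div_eq_mul_inv,
      le_div_iff₀ (Real.sqrt_pos.2 hd), mul_comm]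
    exact h2
  have hint : IntervalIntegrable v volume w.x₀ w.x₁ := by
    have h1 : IntervalIntegrable (fun x => B * (w.x₁ - x) ^ (-(1 / 2) : ℝ)) volume w.x₀ w.x₁ := by
      have := (intervalIntegral.intervalIntegrable_rpow' (a := w.x₁ - w.x₀) (b := 0)
        (r := -(1 / 2)) (by norm_num)).comp_sub_left w.x₁
      simpa using this.const_mul B
    have hIoo : ∀ᵐ x ∂(volume.restrict (Ioc w.x₀ w.x₁)), x ∈ Ico w.x₀ w.x₁ := by
      rw [Measure.restrict_congr_set (Ico_ae_eq_Ioc (a := w.x₀) (b := w.x₁)).symm]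
      exact ae_restrict_mem measurableSet_Ico
    refine h1.mono_fun' ?_ ?_
    · rw [uIoc_of_le hw.lt.le,
        Measure.restrict_congr_set (Ico_ae_eq_Ioc (a := w.x₀) (b := w.x₁)).symm]
      exact vc.aestronglyMeasurable measurableSet_Ico
    · rw [uIoc_of_le hw.lt.le]
      filter_upwards [hIoo] with x hx using hB x hx
  refine ⟨fun x => z w.x₀ + ∫ t in w.x₀..x, v t, ?_, fun x hx => ?_⟩
  · rw [← uIcc_of_le hw.lt.le]
    exact continuousOn_const.add
      (intervalIntegral.continuousOn_primitive_interval' hint left_mem_uIcc)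
  · exact eq_add_integral_of_hasDerivWithinAt_Ico hz.left vc hx

section Galerkin
variable {P D : ℕ → E →L[ℝ] E} {z Y : ℕ → ℝ → E} {z₀ y₀ v₀ : E}

/-- The mode with cut-off `n` is the projection of the mode with cut-off `k ≥ n`. -/
lemma IsMode.proj_eq (hw : w.Regular m M) (hS : IsSpectralFamily P D)
    (hz : ∀ n, w.IsMode (D n) (z n) (Y n)) (h0 : ∀ n, z n w.x₀ = P n z₀)
    (h1 : ∀ n, w.vel (D n) (z n) (Y n) w.x₀ = P n v₀) {n k : ℕ} (hnk : n ≤ k) {ζ Υ : ℝ → E}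
    (hζ : w.IsMode (D n) ζ Υ) (hζ0 : ζ w.x₀ = P n z₀) (hζ1 : w.vel (D n) ζ Υ w.x₀ = P n v₀)
    {x : ℝ} (hx : x ∈ Ico w.x₀ w.x₁) : P n (z k x) = ζ x := by
  have hmap := (hz k).map (D' := D n) (P n)
    (fun x _ => by rw [hS.D_P le_rfl, hS.P_D hnk])
    (fun x _ => by rw [hS.D_P le_rfl, hS.P_D hnk])
  refine sub_eq_zero.1 ((hmap.sub hζ).eq_zero hw (hS.skew n) ?_ ?_ hx)
  · simp only [h0, hζ0, hS.P_P hnk, sub_self]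
  · rw [vel_sub, vel_map (D := D k) (by rw [hS.D_P le_rfl, hS.P_D hnk]), h1, hS.P_P hnk, hζ1, sub_self]

/-- On the range of `P n` the operators `D k` and `D n` agree, so the mode with cut-off `n` is also
a mode for `D k`. The difference is therefore a single `D k`-mode, to which the energy estimate
applies. -/
lemma IsMode.energy_sub_le (hw : w.Regular m M) (hS : IsSpectralFamily P D)
    (hz : ∀ n, w.IsMode (D n) (z n) (Y n)) (h0 : ∀ n, z n w.x₀ = P n z₀)
    (h1 : ∀ n, w.vel (D n) (z n) (Y n) w.x₀ = P n v₀) (hy : ∀ n, P n y₀ = D n z₀)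
    {n k : ℕ} (hnk : n ≤ k) {x : ℝ} (hx : x ∈ Ico w.x₀ w.x₁) :
    w.modeEnergy x (z k x - z n x) (D k (z k x) - D n (z n x))
        (w.vel (D k) (z k) (Y k) x - w.vel (D n) (z n) (Y n) x)
      ≤ growth m M (w.x₁ - w.x₀) *
        w.modeEnergy w.x₀ (P k z₀ - P n z₀) (P k y₀ - P n y₀) (P k v₀ - P n v₀) := by
  have hx₀ : w.x₀ ∈ Ico w.x₀ w.x₁ := ⟨le_rfl, hw.lt⟩
  -- The compatibility of cut-offs with `k = n`: a mode with data in the range of `P n` stays there.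
  have hPz : ∀ x ∈ Ico w.x₀ w.x₁, P n (z n x) = z n x := fun x hx =>
    IsMode.proj_eq hw hS hz h0 h1 le_rfl (hz n) (h0 n) (h1 n) hx
  have hDk : ∀ x ∈ Ico w.x₀ w.x₁, D k (z n x) = D n (z n x) := fun x hx => by
    conv_lhs => rw [← hPz x hx]
    exact hS.D_P hnk _
  have hvel : ∀ x ∈ Ico w.x₀ w.x₁, w.vel (D k) (z n) (Y n) x = w.vel (D n) (z n) (Y n) x :=
    fun x hx => vel_map (P := ContinuousLinearMap.id ℝ E) (hDk x hx)
  have hmode : w.IsMode (D k) (z n) (Y n) :=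
    (hz n).map (D' := D k) (ContinuousLinearMap.id ℝ E) (fun x hx => hDk x hx)
      (fun x _ => by
        simp only [ContinuousLinearMap.id_apply]
        rw [← hS.P_D_le (le_refl n), hS.D_P hnk, hS.P_D_le (le_refl n)])
  have := hw.modeEnergy_le (hS.skew k) ((hz k).sub hmode) hx
  simp only [vel_sub, map_sub] at this
  rwa [hDk x hx, hvel x hx, hDk _ hx₀, hvel _ hx₀, h0, h0, h1, h1, hS.D_P le_rfl, hS.D_P le_rfl,
    ← hy, ← hy] at this

end Galerkin

/-- The wave equation with an unbounded skew-adjoint operator, represented by its spectral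
cut-offs. -/
structure IsLimitMode (w : WaveCoeff) (m M : ℝ) (P D : ℕ → E →L[ℝ] E) (z₀ y₀ v₀ : E)
    (z y v : ℝ → E) : Prop where
  cont_z : ContinuousOn z (Icc w.x₀ w.x₁)
  cont_y : ContinuousOn y (Icc w.x₀ w.x₁)
  cont_v : ContinuousOn v (Ico w.x₀ w.x₁)
  init_z : z w.x₀ = z₀
  init_y : y w.x₀ = y₀
  init_v : v w.x₀ = v₀
  grad : ∀ x ∈ Icc w.x₀ w.x₁, ∀ n, P n (y x) = D n (z x)
  deriv_z : ∀ x ∈ Ico w.x₀ w.x₁, HasDerivWithinAt z (v x) (Ico w.x₀ w.x₁) x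
  energy_le : ∀ x ∈ Icc w.x₀ w.x₁, w.modeEnergy x (z x) (y x) (v x)
    ≤ growth m M (w.x₁ - w.x₀) * w.modeEnergy w.x₀ z₀ y₀ v₀
  equation : ∀ L L' : E →L[ℝ] ℝ, (∀ n u, L (D n u) = -L' (P n u)) → ∀ x ∈ Ico w.x₀ w.x₁,
    HasDerivWithinAt (fun x => w.a x * L (v x) + 2 * w.b x * L (y x) + w.s * w.b x * L (z x))
      (w.c x * L' (y x) + (w.db x - w.s * w.c x) * L (y x) + (w.h x + w.s * w.db x) * L (z x))
      (Ico w.x₀ w.x₁) x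
  proj : ∀ n (ζ Υ : ℝ → E), w.IsMode (D n) ζ Υ → ζ w.x₀ = P n z₀ →
    w.vel (D n) ζ Υ w.x₀ = P n v₀ → ∀ x ∈ Ico w.x₀ w.x₁, P n (z x) = ζ x

/-- The data differences `P k u - P n u` tend to zero, so by `IsMode.energy_sub_le` the modes are
Cauchy in the energy norm, uniformly in `x`. The differential identities survive the limit in
integrated form. -/
lemma Regular.exists_isLimitMode [CompleteSpace E] (hw : w.Regular m M) {P D : ℕ → E →L[ℝ] E}
    (hS : IsSpectralFamily P D) {z₀ y₀ v₀ : E} (hy : ∀ n, P n y₀ = D n z₀) :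
    ∃ z y v : ℝ → E, w.IsLimitMode m M P D z₀ y₀ v₀ z y v := by
  choose z Y hz h0 h1 using fun n => hw.exists_isMode (D n) (P n z₀) (P n v₀)
  set v := fun n => w.vel (D n) (z n) (Y n) with hv
  have vc : ∀ n, ContinuousOn (v n) (Ico w.x₀ w.x₁) := fun n => (hz n).continuousOn_vel hw
  choose ζ ζc hζ using fun n => (hz n).exists_extension hw (hS.skew n)
  have hx₀ : w.x₀ ∈ Ico w.x₀ w.x₁ := ⟨le_rfl, hw.lt⟩
  have hx₀' : w.x₀ ∈ Icc w.x₀ w.x₁ := Ico_subset_Icc_self hx₀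
  have hclos : closure (Ico w.x₀ w.x₁) = Icc w.x₀ w.x₁ := closure_Ico hw.lt.ne
  -- smallness of the data differences
  have hsmall : ∀ ε > 0, ∃ N, ∀ k ≥ N, ∀ n ≥ N, ∀ x ∈ Ico w.x₀ w.x₁,
      w.modeEnergy x (z k x - z n x) (D k (z k x) - D n (z n x)) (v k x - v n x) < ε := by
    intro ε hε
    have hG := growth_pos m M (w.x₁ - w.x₀)
    have hT : Tendsto (fun p : ℕ × ℕ => growth m M (w.x₁ - w.x₀) *
        w.modeEnergy w.x₀ (P p.1 z₀ - P p.2 z₀) (P p.1 y₀ - P p.2 y₀) (P p.1 v₀ - P p.2 v₀))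
        (atTop ×ˢ atTop) (𝓝 (growth m M (w.x₁ - w.x₀) *
          w.modeEnergy w.x₀ (z₀ - z₀) (y₀ - y₀) (v₀ - v₀))) := by
      have ht : ∀ u : E, Tendsto (fun p : ℕ × ℕ => P p.1 u - P p.2 u) (atTop ×ˢ atTop)
          (𝓝 (u - u)) := fun u =>
        ((hS.tendsto u).comp tendsto_fst).sub ((hS.tendsto u).comp tendsto_snd)
      unfold modeEnergy
      exact ((((ht v₀).norm.pow 2).const_mul _).add (((ht y₀).norm.pow 2).const_mul _) |>.add
        ((ht z₀).norm.pow 2)).const_mul _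
    have hz0 : growth m M (w.x₁ - w.x₀) *
          w.modeEnergy w.x₀ (z₀ - z₀) (y₀ - y₀) (v₀ - v₀) = 0 := by simp [modeEnergy]
    rw [hz0, prod_atTop_atTop_eq] at hT
    obtain ⟨⟨N₁, N₂⟩, hN⟩ := eventually_atTop.1 (hT.eventually (gt_mem_nhds hε))
    have key : ∀ k ≥ max N₁ N₂, ∀ n ≥ max N₁ N₂, n ≤ k → ∀ x ∈ Ico w.x₀ w.x₁,
      w.modeEnergy x (z k x - z n x) (D k (z k x) - D n (z n x)) (v k x - v n x) < ε := by
      intro k hk n hn hnk x hx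
      exact (IsMode.energy_sub_le hw hS hz h0 h1 hy hnk hx).trans_lt
        (hN (k, n) ⟨(le_max_left _ _).trans hk, (le_max_right _ _).trans hn⟩)
    refine ⟨max N₁ N₂, fun k hk n hn x hx => ?_⟩
    rcases le_total n k with h | h
    · exact key k hk n hn h x hx
    · have := key n hn k hk h x hx
      unfold modeEnergy at this ⊢
      rwa [norm_sub_rev (v k x), norm_sub_rev (D k _), norm_sub_rev (z k x)]
  have hm := hw.m_pos
  have lt_of_sq : ∀ {r ε : ℝ}, 0 ≤ r → 0 < ε → m * r ^ 2 < m * ε ^ 2 → r < ε := by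
    intro r ε hr hε h
    exact lt_of_pow_lt_pow_left₀ 2 hε.le (lt_of_mul_lt_mul_left h hm.le)
  -- the limits
  obtain ⟨Z, hZ⟩ : ∃ Z, TendstoUniformlyOn ζ Z atTop (Icc w.x₀ w.x₁) := by
    refine exists_tendstoUniformlyOn fun ε hε => ?_
    obtain ⟨N, hN⟩ := hsmall ((ε / 2) ^ 2) (by positivity)
    refine ⟨N, fun k hk n hn x hx => ?_⟩
    have : ‖ζ k x - ζ n x‖ ≤ ε / 2 := by
      refine le_on_closure (f := fun x => ‖ζ k x - ζ n x‖) (g := fun _ => ε / 2)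
        (s := Ico w.x₀ w.x₁) (fun x hx => ?_) ?_ continuousOn_const (by rwa [hclos])
      · have := (hw.sq_norm_left_le (Ico_subset_Icc_self hx) _ _ _).trans_lt (hN k hk n hn x hx)
        rw [hζ k hx, hζ n hx] at this
        exact (lt_of_pow_lt_pow_left₀ 2 (by positivity) this).le
      · rw [hclos]; exact ((ζc k).sub (ζc n)).norm
    linarith
  obtain ⟨y, hY⟩ : ∃ y, TendstoUniformlyOn (fun n x => D n (ζ n x)) y atTop (Icc w.x₀ w.x₁) := by
    refine exists_tendstoUniformlyOn fun ε hε => ?_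
    obtain ⟨N, hN⟩ := hsmall (m * (ε / 2) ^ 2) (by positivity)
    refine ⟨N, fun k hk n hn x hx => ?_⟩
    have : ‖D k (ζ k x) - D n (ζ n x)‖ ≤ ε / 2 := by
      refine le_on_closure (f := fun x => ‖D k (ζ k x) - D n (ζ n x)‖) (g := fun _ => ε / 2)
        (s := Ico w.x₀ w.x₁) (fun x hx => ?_) ?_ continuousOn_const (by rwa [hclos])
      · have := (hw.sq_norm_grad_le (Ico_subset_Icc_self hx) _ _ _).trans_lt (hN k hk n hn x hx)
        rw [hζ k hx, hζ n hx] at this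
        exact (lt_of_sq (norm_nonneg _) (by positivity) this).le
      · rw [hclos]
        exact (((D k).continuous.comp_continuousOn (ζc k)).sub
          ((D n).continuous.comp_continuousOn (ζc n))).norm
    linarith
  -- The energy weight of the velocity degenerates like `x₁ - x`, so only the velocities multiplied
  -- by `√(x₁ - x)` converge uniformly.
  obtain ⟨u, hu⟩ : ∃ u, TendstoUniformlyOn (fun n x => √(w.x₁ - x) • v n x) u atTop
      (Ico w.x₀ w.x₁) := by
    refine exists_tendstoUniformlyOn fun ε hε => ?_
    obtain ⟨N, hN⟩ := hsmall (m * ε ^ 2) (by positivity)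
    refine ⟨N, fun k hk n hn x hx => ?_⟩
    rw [← smul_sub]
    exact lt_of_sq (norm_nonneg _) hε
      ((hw.sq_norm_vel_le (Ico_subset_Icc_self hx) _ _ _).trans_lt (hN k hk n hn x hx))
  have hsq : ∀ x ∈ Ico w.x₀ w.x₁, 0 < √(w.x₁ - x) := fun x hx =>
    Real.sqrt_pos.2 (sub_pos.2 hx.2)
  -- At `x₁` the convention `0⁻¹ = 0` makes `V` vanish; the energy bound at the horizon uses this
  -- value.
  set V : ℝ → E := fun x => (√(w.x₁ - x))⁻¹ • u x with hV
  have Zc : ContinuousOn Z (Icc w.x₀ w.x₁) := hZ.continuousOn (Frequently.of_forall ζc)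
  have Yc : ContinuousOn y (Icc w.x₀ w.x₁) := hY.continuousOn
    (Frequently.of_forall fun n => (D n).continuous.comp_continuousOn (ζc n))
  have hsc : ContinuousOn (fun x => √(w.x₁ - x)) (Ico w.x₀ w.x₁) := by fun_prop
  have hisc : ContinuousOn (fun x => (√(w.x₁ - x))⁻¹) (Ico w.x₀ w.x₁) :=
    hsc.inv₀ fun x hx => (hsq x hx).ne'
  have Vc : ContinuousOn V (Ico w.x₀ w.x₁) := hisc.smul
    (hu.continuousOn (Frequently.of_forall fun n => hsc.smul (vc n)))
  have tZ : ∀ x ∈ Icc w.x₀ w.x₁, Tendsto (fun n => ζ n x) atTop (𝓝 (Z x)) := fun x hx =>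
    hZ.tendsto_at hx
  have tz : ∀ x ∈ Ico w.x₀ w.x₁, Tendsto (fun n => z n x) atTop (𝓝 (Z x)) := fun x hx =>
    (tZ x (Ico_subset_Icc_self hx)).congr fun n => (hζ n hx).symm
  have tY : ∀ x ∈ Icc w.x₀ w.x₁, Tendsto (fun n => D n (ζ n x)) atTop (𝓝 (y x)) := fun x hx =>
    hY.tendsto_at hx
  have ty : ∀ x ∈ Ico w.x₀ w.x₁, Tendsto (fun n => D n (z n x)) atTop (𝓝 (y x)) := fun x hx =>
    (tY x (Ico_subset_Icc_self hx)).congr fun n => by rw [hζ n hx]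
  have tv : ∀ x ∈ Ico w.x₀ w.x₁, Tendsto (fun n => v n x) atTop (𝓝 (V x)) := fun x hx => by
    have := (hu.tendsto_at hx).const_smul (√(w.x₁ - x))⁻¹
    refine this.congr fun n => ?_
    rw [smul_smul, inv_mul_cancel₀ (hsq x hx).ne', one_smul]
  have bz : ∀ᶠ n in atTop, ∀ x ∈ Ico w.x₀ w.x₁, ‖z n x‖ ≤ ‖Z x‖ + 1 := by
    filter_upwards [Metric.tendstoUniformlyOn_iff.1 hZ 1 one_pos] with n hn x hx
    have := hn x (Ico_subset_Icc_self hx)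
    rw [dist_comm, dist_eq_norm, ← hζ n hx] at this
    linarith [norm_le_norm_add_norm_sub' (z n x) (Z x)]
  have by' : ∀ᶠ n in atTop, ∀ x ∈ Ico w.x₀ w.x₁, ‖D n (z n x)‖ ≤ ‖y x‖ + 1 := by
    filter_upwards [Metric.tendstoUniformlyOn_iff.1 hY 1 one_pos] with n hn x hx
    have := hn x (Ico_subset_Icc_self hx)
    rw [dist_comm, dist_eq_norm, ← hζ n hx] at this
    linarith [norm_le_norm_add_norm_sub' (D n (z n x)) (y x)]
  have bv : ∀ᶠ n in atTop, ∀ x ∈ Ico w.x₀ w.x₁, ‖v n x‖ ≤ (√(w.x₁ - x))⁻¹ * (‖u x‖ + 1) := by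
    filter_upwards [Metric.tendstoUniformlyOn_iff.1 hu 1 one_pos] with n hn x hx
    have := hn x hx
    rw [dist_comm, dist_eq_norm] at this
    have h2 := norm_le_norm_add_norm_sub' (√(w.x₁ - x) • v n x) (u x)
    rw [← div_eq_inv_mul, le_div_iff₀ (hsq x hx), mul_comm]
    rw [norm_smul, Real.norm_eq_abs, abs_of_pos (hsq x hx)] at h2
    linarith
  have uc : ContinuousOn u (Ico w.x₀ w.x₁) :=
    hu.continuousOn (Frequently.of_forall fun n => hsc.smul (vc n))
  have Zc' : ContinuousOn Z (Ico w.x₀ w.x₁) := Zc.mono Ico_subset_Icc_self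
  have Yc' : ContinuousOn y (Ico w.x₀ w.x₁) := Yc.mono Ico_subset_Icc_self
  have bc := hw.cont_b.mono (Ico_subset_Icc_self : Ico w.x₀ w.x₁ ⊆ Icc w.x₀ w.x₁)
  have cc := hw.cont_c.mono (Ico_subset_Icc_self : Ico w.x₀ w.x₁ ⊆ Icc w.x₀ w.x₁)
  have dbc := hw.cont_db.mono (Ico_subset_Icc_self : Ico w.x₀ w.x₁ ⊆ Icc w.x₀ w.x₁)
  have hc := hw.cont_h.mono (Ico_subset_Icc_self : Ico w.x₀ w.x₁ ⊆ Icc w.x₀ w.x₁)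
  have iZ : Z w.x₀ = z₀ := tendsto_nhds_unique (tz _ hx₀) (by simpa only [h0] using hS.tendsto z₀)
  have iY : y w.x₀ = y₀ := tendsto_nhds_unique (ty _ hx₀) (by
    simpa only [h0, hS.D_P le_rfl, ← hy] using hS.tendsto y₀)
  have iV : V w.x₀ = v₀ := tendsto_nhds_unique (tv _ hx₀) (by
    simpa only [hv, h1] using hS.tendsto v₀)
  have hen : ∀ x ∈ Ico w.x₀ w.x₁, w.modeEnergy x (Z x) (y x) (V x)
      ≤ growth m M (w.x₁ - w.x₀) * w.modeEnergy w.x₀ z₀ y₀ v₀ := by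
    have tE : ∀ x ∈ Ico w.x₀ w.x₁, Tendsto
        (fun n => w.modeEnergy x (z n x) (D n (z n x)) (v n x)) atTop
        (𝓝 (w.modeEnergy x (Z x) (y x) (V x))) := fun x hx =>
      ((((tv x hx).norm.pow 2).const_mul _).add (((ty x hx).norm.pow 2).const_mul _)).add
        ((tz x hx).norm.pow 2)
    intro x hx
    have t0 := (tE _ hx₀).const_mul (growth m M (w.x₁ - w.x₀))
    rw [iZ, iY, iV] at t0
    exact le_of_tendsto_of_tendsto' (tE x hx) t0 fun n => hw.modeEnergy_le (hS.skew n) (hz n) hx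
  refine ⟨Z, y, V, Zc, Yc, Vc, iZ, iY, iV, ?_, ?_, ?_, ?_, ?_⟩
  · intro x hx n
    have e1 : ∀ᶠ k in atTop, P n (D k (ζ k x)) = D n (ζ k x) := by
      filter_upwards [eventually_ge_atTop n] with k hk using hS.P_D hk _
    exact tendsto_nhds_unique (((P n).continuous.tendsto _).comp (tY x hx))
      ((((D n).continuous.tendsto _).comp (tZ x hx)).congr' (e1.mono fun k h => h.symm))
  · have hint : ∀ x ∈ Ico w.x₀ w.x₁, Z x = z₀ + ∫ t in w.x₀..x, V t := by
      intro x hx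
      have h2 := tendsto_intervalIntegral_of_bound_Ico vc (hisc.mul (uc.norm.add continuousOn_const))
        bv tv hx
      refine tendsto_nhds_unique (tz x hx) (((hS.tendsto z₀).add h2).congr fun n => ?_)
      rw [eq_add_integral_of_hasDerivWithinAt_Ico (hz n).left (vc n) hx, h0]
    intro x hx
    exact ((hasDerivWithinAt_primitive_Ico Vc hx).const_add z₀).congr hint (hint x hx)
  · intro x hx
    rcases eq_or_lt_of_le hx.2 with hx1 | hx1
    · have hV1 : V x = 0 := by simp [hV, hx1]
      have : w.c x * ‖y x‖ ^ 2 + ‖Z x‖ ^ 2 ≤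
          growth m M (w.x₁ - w.x₀) * w.modeEnergy w.x₀ z₀ y₀ v₀ := by
        refine le_on_closure (f := fun x => w.c x * ‖y x‖ ^ 2 + ‖Z x‖ ^ 2) (g := fun _ => _)
          (s := Ico w.x₀ w.x₁) (fun x hx => ?_) ?_ continuousOn_const (by rwa [hclos])
        · have h2 := mul_nonneg (hw.neg_a_nonneg (Ico_subset_Icc_self hx)) (sq_nonneg ‖V x‖)
          have h3 := hen x hx
          unfold modeEnergy at h3 ⊢
          linarith
        · rw [hclos]
          exact (hw.cont_c.mul (Yc.norm.pow 2)).add (Zc.norm.pow 2)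
      have h4 : w.modeEnergy x (Z x) (y x) (V x) = w.c x * ‖y x‖ ^ 2 + ‖Z x‖ ^ 2 := by
        simp [modeEnergy, hV1]
      rwa [h4]
    · exact hen x ⟨hx.1, hx1⟩
  -- `L` and `L'` model pairing with `η` and `η'`. The hypothesis moves one `D n` onto the test
  -- function, so that no second derivative of the limit is needed; the integrated identity for `L
  -- (Y n)` then converges by domination.
  · intro L L' hL
    set F : ℝ → ℝ := fun x => w.c x * L' (y x) + (w.db x - w.s * w.c x) * L (y x)
      + (w.h x + w.s * w.db x) * L (Z x) with hF
    have Fc : ContinuousOn F (Ico w.x₀ w.x₁) := by simp only [hF]; fun_prop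
    set Fn : ℕ → ℝ → ℝ := fun n x => w.c x * L' (D n (z n x))
      + (w.db x - w.s * w.c x) * L (D n (z n x)) + (w.h x + w.s * w.db x) * L (z n x) with hFn
    have zc := fun n => (hz n).continuousOn_left
    have Fnc : ∀ n, ContinuousOn (Fn n) (Ico w.x₀ w.x₁) := fun n => by
      have := zc n
      simp only [hFn]; fun_prop
    have Yd : ∀ n, ∀ x ∈ Ico w.x₀ w.x₁,
        HasDerivWithinAt (fun x => L (Y n x)) (Fn n x) (Ico w.x₀ w.x₁) x := by
      intro n x hx
      convert! L.hasFDerivAt.comp_hasDerivWithinAt x ((hz n).right x hx) using 1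
      simp only [hFn, force, map_add, map_neg, map_smul, smul_eq_mul, hL, hS.P_D_le le_rfl]
      have h2 : L' (D n (z n x)) = L' (P n (D n (z n x))) := by rw [hS.P_D_le le_rfl]
      ring
    have YV : ∀ n, ∀ x ∈ Ico w.x₀ w.x₁, Y n x = w.a x • v n x + (2 * w.b x) • D n (z n x)
        + (w.s * w.b x) • z n x := by
      intro n x hx
      simp only [hv, vel, smul_smul, mul_inv_cancel₀ (hw.a_neg hx).ne, one_smul]
      abel
    have tL : ∀ (L : E →L[ℝ] ℝ) {f : ℕ → E} {g : E}, Tendsto f atTop (𝓝 g) →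
        Tendsto (fun n => L (f n)) atTop (𝓝 (L g)) := fun L _ g h =>
      (L.continuous.tendsto g).comp h
    set p : ℝ → ℝ := fun x => w.a x * L (V x) + 2 * w.b x * L (y x) + w.s * w.b x * L (Z x) with hp
    have tp : ∀ x ∈ Ico w.x₀ w.x₁, Tendsto (fun n => L (Y n x)) atTop (𝓝 (p x)) := by
      intro x hx
      refine ((((tL L (tv x hx)).const_mul (w.a x)).add
        ((tL L (ty x hx)).const_mul (2 * w.b x))).add
        ((tL L (tz x hx)).const_mul (w.s * w.b x))).congr fun n => ?_
      simp only [YV n x hx, map_add, map_smul, smul_eq_mul]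
    have hint : ∀ x ∈ Ico w.x₀ w.x₁, p x = p w.x₀ + ∫ t in w.x₀..x, F t := by
      intro x hx
      have h2 : Tendsto (fun n => ∫ t in w.x₀..x, Fn n t) atTop (𝓝 (∫ t in w.x₀..x, F t)) := by
        refine tendsto_intervalIntegral_of_bound_Ico Fnc
          (B := fun t => |w.c t| * (‖L'‖ * (‖y t‖ + 1)) +
            |w.db t - w.s * w.c t| * (‖L‖ * (‖y t‖ + 1))
            + |w.h t + w.s * w.db t| * (‖L‖ * (‖Z t‖ + 1))) (by fun_prop) ?_ ?_ hx
        · filter_upwards [bz, by'] with n hn1 hn2 t ht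
          have e1 : ∀ (L : E →L[ℝ] ℝ) {u : E} {r : ℝ}, ‖u‖ ≤ r → |L u| ≤ ‖L‖ * r :=
            fun L u r h => (L.le_opNorm u).trans (mul_le_mul_of_nonneg_left h (norm_nonneg _))
          simp only [hFn, Real.norm_eq_abs]
          refine (abs_add_three _ _ _).trans ?_
          simp only [abs_mul]
          gcongr
          · exact e1 _ (hn2 t ht)
          · exact e1 _ (hn2 t ht)
          · exact e1 _ (hn1 t ht)
        · intro t ht
          exact (((tL L' (ty t ht)).const_mul _).add ((tL L (ty t ht)).const_mul _)).add
            ((tL L (tz t ht)).const_mul _)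
      refine tendsto_nhds_unique (tp x hx) (((tp _ hx₀).add h2).congr fun n => ?_)
      rw [← eq_add_integral_of_hasDerivWithinAt_Ico (Yd n) (Fnc n) hx]
    intro x hx
    exact ((hasDerivWithinAt_primitive_Ico Fc hx).const_add (p w.x₀)).congr hint (hint x hx)
  · intro n ξ Υ hξ hξ0 hξ1 x hx
    have e1 : ∀ᶠ k in atTop, P n (z k x) = ξ x := by
      filter_upwards [eventually_ge_atTop n] with k hk
      exact IsMode.proj_eq hw hS hz h0 h1 hk hξ hξ0 hξ1 hx
    exact tendsto_nhds_unique (((P n).continuous.tendsto _).comp (tz x hx))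
      (tendsto_const_nhds.congr' (e1.mono fun k h => h.symm))

end WaveCoeff
end MultipoleWave

end

/-! ### Spectral cut-offs of `∂_ρ` on the Fourier side. -/

section
open MeasureTheory Set Filter Topology
open scoped ContDiff BoundedContinuousFunction RealInnerProductSpace SchwartzMap FourierTransform
open scoped ENNReal LineDeriv

namespace MultipoleWave

/-- Complex `L²(ℝ)`. -/
abbrev L2C : Type := Lp ℂ 2 (volume : Measure ℝ)

/-- The indicator function of `[-n, n]`. -/
noncomputable def cutSymbol (n : ℕ) (ξ : ℝ) : ℂ := if |ξ| ≤ n then 1 else 0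

/-- The Fourier symbol of `∂_ρ`. -/
noncomputable def derivSymbol (ξ : ℝ) : ℂ := 2 * Real.pi * Complex.I * ξ

lemma measurable_cutSymbol (n : ℕ) : Measurable (cutSymbol n) :=
  Measurable.ite (measurableSet_le (by fun_prop) measurable_const) measurable_const measurable_const

lemma norm_cutSymbol_le (n : ℕ) (ξ : ℝ) : ‖cutSymbol n ξ‖ ≤ 1 := by
  unfold cutSymbol; split_ifs <;> simp

lemma norm_derivSymbol (ξ : ℝ) : ‖derivSymbol ξ‖ = 2 * Real.pi * |ξ| := by
  simp [derivSymbol, abs_of_pos Real.pi_pos]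

lemma memLp_cutSymbol (n : ℕ) : MemLp (cutSymbol n) ⊤ (volume : Measure ℝ) :=
  memLp_top_of_bound (measurable_cutSymbol n).aestronglyMeasurable 1
    (ae_of_all _ (norm_cutSymbol_le n))

lemma continuous_derivSymbol : Continuous derivSymbol := by unfold derivSymbol; fun_prop

lemma memLp_cutSymbol_mul (n : ℕ) :
    MemLp (fun ξ => cutSymbol n ξ * derivSymbol ξ) ⊤ (volume : Measure ℝ) := by
  refine memLp_top_of_bound ((measurable_cutSymbol n).mul
    continuous_derivSymbol.measurable).aestronglyMeasurable (2 * Real.pi * n) (ae_of_all _ fun ξ => ?_)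
  rw [norm_mul, norm_derivSymbol]
  unfold cutSymbol
  split_ifs with h
  · rw [norm_one, one_mul]
    gcongr
  · simp; positivity

/-- Multiplication by `1_{|ξ| ≤ n}`. -/
noncomputable def cutOp (n : ℕ) : L2C →L[ℝ] L2C :=
  (ContinuousLinearMap.mul ℝ ℂ).holderL volume ⊤ 2 2 (memLp_cutSymbol n).toLp

/-- Multiplication by `2πiξ 1_{|ξ| ≤ n}`. -/
noncomputable def derivOp (n : ℕ) : L2C →L[ℝ] L2C :=
  (ContinuousLinearMap.mul ℝ ℂ).holderL volume ⊤ 2 2 (memLp_cutSymbol_mul n).toLp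

lemma coeFn_cutOp (n : ℕ) (u : L2C) : cutOp n u =ᵐ[volume] fun ξ => cutSymbol n ξ * u ξ := by
  have h := (ContinuousLinearMap.mul ℝ ℂ).coeFn_holder (r := 2)
    ((memLp_cutSymbol n).toLp : Lp ℂ ⊤ (volume : Measure ℝ)) u
  filter_upwards [h, (memLp_cutSymbol n).coeFn_toLp] with ξ h1 h2
  rw [← h2]
  exact h1

lemma coeFn_derivOp (n : ℕ) (u : L2C) :
    derivOp n u =ᵐ[volume] fun ξ => cutSymbol n ξ * derivSymbol ξ * u ξ := by
  have h := (ContinuousLinearMap.mul ℝ ℂ).coeFn_holder (r := 2)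
    ((memLp_cutSymbol_mul n).toLp : Lp ℂ ⊤ (volume : Measure ℝ)) u
  filter_upwards [h, (memLp_cutSymbol_mul n).coeFn_toLp] with ξ h1 h2
  rw [← h2]
  exact h1

lemma cutSymbol_mul_of_le {n m : ℕ} (h : n ≤ m) (ξ : ℝ) :
    cutSymbol n ξ * cutSymbol m ξ = cutSymbol n ξ := by
  unfold cutSymbol
  have : (n : ℝ) ≤ m := by exact_mod_cast h
  split_ifs with h1 h2
  · simp
  · exact (h2 (h1.trans this)).elim
  · simp
  · simp

lemma tendsto_cutOp (u : L2C) : Tendsto (fun n => cutOp n u) atTop (𝓝 u) := by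
  rw [tendsto_iff_norm_sub_tendsto_zero]
  have h2 : Tendsto (fun n => ∫ ξ, ‖(cutOp n u - u : L2C) ξ‖ ^ 2) atTop (𝓝 (∫ _ : ℝ, (0 : ℝ))) := by
    refine tendsto_integral_of_dominated_convergence (fun ξ => ‖u ξ‖ ^ 2) (fun n => ?_) ?_ ?_ ?_
    · exact (Lp.aestronglyMeasurable _).norm.pow 2
    · exact (Lp.memLp u).integrable_norm_pow (by norm_num)
    · intro n
      filter_upwards [Lp.coeFn_sub (cutOp n u) u, coeFn_cutOp n u] with ξ h1 h2
      rw [h1, Pi.sub_apply, h2, norm_pow, norm_norm]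
      gcongr
      unfold cutSymbol
      split_ifs <;> simp
    · have := ae_all_iff.2 fun n => (Lp.coeFn_sub (cutOp n u) u)
      have h' := ae_all_iff.2 fun n => coeFn_cutOp n u
      filter_upwards [this, h'] with ξ h1 h2
      refine tendsto_const_nhds.congr' ?_
      obtain ⟨N, hN⟩ := exists_nat_ge |ξ|
      filter_upwards [eventually_ge_atTop N] with n hn
      have : |ξ| ≤ n := hN.trans (by exact_mod_cast hn)
      rw [h1, Pi.sub_apply, h2]
      simp [cutSymbol, this]
  have h3 : ∀ v : L2C, ‖v‖ = √(∫ ξ, ‖v ξ‖ ^ 2) := by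
    intro v
    rw [← Real.sqrt_sq (norm_nonneg v), ← real_inner_self_eq_norm_sq, L2.inner_def]
    simp only [real_inner_self_eq_norm_sq]
  simp only [h3]
  simpa using h2.sqrt

/-- A real multiple of `derivSymbol ξ` is purely imaginary, hence skew for the real inner product on
`ℂ`. -/
lemma inner_derivSymbol_mul (r : ℂ) (hr : r.im = 0) (ξ : ℝ) (a b : ℂ) :
    ⟪r * derivSymbol ξ * a, b⟫ = -⟪a, r * derivSymbol ξ * b⟫ := by
  simp [Complex.inner, derivSymbol, hr]
  ring

theorem isSpectralFamily : IsSpectralFamily cutOp derivOp where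
  skew n u v := by
    rw [L2.inner_def, L2.inner_def, ← integral_neg]
    refine integral_congr_ae ?_
    filter_upwards [coeFn_derivOp n u, coeFn_derivOp n v] with ξ h1 h2
    rw [h1, h2]
    refine inner_derivSymbol_mul _ ?_ _ _ _
    unfold cutSymbol
    split_ifs <;> simp
  tendsto := tendsto_cutOp
  P_P {n m} h u := by
    apply Lp.ext
    filter_upwards [coeFn_cutOp n u, coeFn_cutOp m u, coeFn_cutOp n (cutOp m u)] with ξ h1 h2 h3
    rw [h3, h2, h1, ← mul_assoc, cutSymbol_mul_of_le h]
  D_P {n m} h u := by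
    apply Lp.ext
    filter_upwards [coeFn_derivOp n u, coeFn_cutOp n u, coeFn_derivOp m (cutOp n u)] with ξ h1 h2 h3
    rw [h3, h2, h1]
    linear_combination (derivSymbol ξ * u ξ) * cutSymbol_mul_of_le h ξ
  P_D {n m} h u := by
    apply Lp.ext
    filter_upwards [coeFn_derivOp n u, coeFn_derivOp m u, coeFn_cutOp n (derivOp m u)] with ξ h1 h2 h3
    rw [h3, h2, h1]
    linear_combination (derivSymbol ξ * u ξ) * cutSymbol_mul_of_le h ξ
  D_P_le {n m} h u := by
    apply Lp.ext
    filter_upwards [coeFn_derivOp n u, coeFn_cutOp m u, coeFn_derivOp n (cutOp m u)] with ξ h1 h2 h3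
    rw [h3, h2, h1]
    linear_combination (derivSymbol ξ * u ξ) * cutSymbol_mul_of_le h ξ
  P_D_le {n m} h u := by
    apply Lp.ext
    filter_upwards [coeFn_derivOp n u, coeFn_derivOp n u, coeFn_cutOp m (derivOp n u)] with ξ h1 h2 h3
    rw [h3, h1]
    linear_combination (derivSymbol ξ * u ξ) * cutSymbol_mul_of_le h ξ

/-- `y` is the product of `z` with the symbol of `∂_ρ` iff this holds after every cut-off. -/
lemma cutOp_eq_derivOp_iff {z y : L2C} :
    (∀ n, cutOp n y = derivOp n z) ↔ ∀ᵐ ξ, y ξ = derivSymbol ξ * z ξ := by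
  constructor
  · intro h
    have h1 := ae_all_iff.2 fun n => coeFn_cutOp n y
    have h2 := ae_all_iff.2 fun n => coeFn_derivOp n z
    filter_upwards [h1, h2] with ξ h1 h2
    obtain ⟨n, hn⟩ := exists_nat_ge |ξ|
    have h3 := h1 n
    rw [h n, h2 n] at h3
    simpa [cutSymbol, hn] using h3.symm
  · intro h n
    apply Lp.ext
    filter_upwards [h, coeFn_cutOp n y, coeFn_derivOp n z] with ξ h1 h2 h3
    rw [h2, h3, h1, mul_assoc]

/-- Real functions as complex functions. -/
noncomputable def toComplex : L2 →L[ℝ] L2C := Complex.ofRealCLM.compLpL 2 volume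

/-- The real part. -/
noncomputable def realPart : L2C →L[ℝ] L2 := Complex.reCLM.compLpL 2 volume

lemma coeFn_toComplex (u : L2) : toComplex u =ᵐ[volume] fun x => (u x : ℂ) :=
  Complex.ofRealCLM.coeFn_compLpL u

lemma coeFn_realPart (u : L2C) : realPart u =ᵐ[volume] fun x => (u x).re :=
  Complex.reCLM.coeFn_compLpL u

lemma norm_toComplex_le (u : L2) : ‖toComplex u‖ ≤ ‖u‖ :=
  (Complex.ofRealCLM.norm_compLp_le u).trans (by simp)

lemma norm_realPart_le (u : L2C) : ‖realPart u‖ ≤ ‖u‖ :=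
  (Complex.reCLM.norm_compLp_le u).trans (by simp)

/-- The Fourier transform of a real function. -/
noncomputable def realFourier : L2 →L[ℝ] L2C :=
  ((Lp.fourierTransformₗᵢ ℝ ℂ).toContinuousLinearEquiv.toContinuousLinearMap.restrictScalars ℝ).comp
    toComplex

/-- The real part of the inverse Fourier transform. -/
noncomputable def realFourierInv : L2C →L[ℝ] L2 :=
  realPart.comp
    ((Lp.fourierTransformₗᵢ ℝ ℂ).symm.toContinuousLinearEquiv.toContinuousLinearMap.restrictScalars ℝ)

lemma realFourier_apply (u : L2) : realFourier u = 𝓕 (toComplex u) := rfl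

lemma realFourierInv_apply (u : L2C) : realFourierInv u = realPart (𝓕⁻ u) := rfl

lemma realFourierInv_realFourier (u : L2) : realFourierInv (realFourier u) = u := by
  rw [realFourierInv_apply, realFourier_apply, FourierTransform.fourierInv_fourier_eq]
  apply Lp.ext
  filter_upwards [coeFn_realPart (toComplex u), coeFn_toComplex u] with x h1 h2
  rw [h1, h2, Complex.ofReal_re]

lemma norm_realFourier_le (u : L2) : ‖realFourier u‖ ≤ ‖u‖ := by
  rw [realFourier_apply, Lp.norm_fourier_eq]; exact norm_toComplex_le u

lemma norm_realFourierInv_le (u : L2C) : ‖realFourierInv u‖ ≤ ‖u‖ := by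
  rw [realFourierInv_apply]
  exact (norm_realPart_le _).trans ((Lp.fourierTransformₗᵢ ℝ ℂ).symm.norm_map u).le

/-- The weak derivative may be tested with functions in `H^{1,2}` that are not compactly
supported. -/
lemma IsWeakDeriv.integral_mul_deriv {u u' : L2} (h : IsWeakDeriv u u') {q : ℝ → ℝ}
    (hq : ContDiff ℝ ∞ q) (hq2 : MemLp q 2) (hq2' : MemLp (deriv q) 2) :
    ∫ x, u x * deriv q x = -∫ x, u' x * q x := by
  obtain ⟨χ⟩ : Nonempty (ContDiffBump (0 : ℝ)) := inferInstance
  have χs : ContDiff ℝ ∞ (χ : ℝ → ℝ) := χ.contDiff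
  have χd : Differentiable ℝ (χ : ℝ → ℝ) := χs.differentiable (by norm_num)
  have qd : Differentiable ℝ q := hq.differentiable (by norm_num)
  obtain ⟨C, hC⟩ : ∃ C, ∀ x, ‖deriv χ x‖ ≤ C :=
    (χ.hasCompactSupport.deriv).exists_bound_of_continuous
      ((contDiff_infty_iff_deriv.1 χs).2.continuous)
  have C0 : 0 ≤ C := (norm_nonneg _).trans (hC 0)
  let t : ℕ → ℝ := fun n => 1 / ((n : ℝ) + 1)
  have t0 : Tendsto t atTop (𝓝 0) := tendsto_one_div_add_atTop_nhds_zero_nat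
  have tpos : ∀ n, 0 < t n := fun n => by positivity
  have tle : ∀ n, t n ≤ 1 := fun n => by
    simp only [t]; rw [div_le_one (by positivity)]; linarith [n.cast_nonneg (α := ℝ)]
  -- Dilated bumps cut `q` off. The extra term in the derivative carries the factor `t n`, which
  -- tends to `0`.
  let η : ℕ → ℝ → ℝ := fun n x => χ (t n * x) * q x
  have dη : ∀ n x, deriv (η n) x = t n * deriv χ (t n * x) * q x + χ (t n * x) * deriv q x := by
    intro n x
    have h1 : HasDerivAt (fun x => t n * x) (t n) x := by simpa using (hasDerivAt_id x).const_mul (t n)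
    have h2 : HasDerivAt (fun x => χ (t n * x)) (deriv χ (t n * x) * t n) x :=
      (χd (t n * x)).hasDerivAt.comp x h1
    refine ((h2.mul (qd x).hasDerivAt).deriv.trans ?_)
    ring
  have ηt : ∀ n, IsTest (η n) := by
    intro n
    refine ⟨(χs.comp (contDiff_const.mul contDiff_id)).mul hq, ?_⟩
    exact HasCompactSupport.mul_right
      (χ.hasCompactSupport.comp_homeomorph (Homeomorph.mulLeft₀ (t n) (tpos n).ne'))
  have tχ : ∀ x, Tendsto (fun n => χ (t n * x)) atTop (𝓝 1) := by
    intro x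
    have h1 : Tendsto (fun n => t n * x) atTop (𝓝 0) := by simpa using t0.mul_const x
    have h2 := (χ.continuous.tendsto 0).comp h1
    rwa [χ.one_of_mem_closedBall (by simpa using χ.rIn_pos.le)] at h2
  have l1 : Tendsto (fun n => ∫ x, u x * deriv (η n) x) atTop (𝓝 (∫ x, u x * deriv q x)) := by
    refine tendsto_integral_of_dominated_convergence
      (fun x => C * ‖u x * q x‖ + ‖u x * deriv q x‖) (fun n => ?_) ?_ ?_ ?_
    · exact (Lp.aestronglyMeasurable u).mul
        (contDiff_infty_iff_deriv.1 (ηt n).1).2.continuous.aestronglyMeasurable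
    · exact (((Lp.memLp u).integrable_mul hq2).norm.const_mul C).add
        ((Lp.memLp u).integrable_mul hq2').norm
    · intro n
      refine ae_of_all _ fun x => ?_
      rw [dη, mul_add]
      refine (norm_add_le _ _).trans (add_le_add ?_ ?_)
      · have : ‖t n * deriv χ (t n * x)‖ ≤ C := by
          rw [norm_mul, Real.norm_eq_abs, abs_of_pos (tpos n)]
          calc _ ≤ 1 * C := mul_le_mul (tle n) (hC _) (norm_nonneg _) zero_le_one
            _ = C := one_mul C
        calc ‖u x * (t n * deriv χ (t n * x) * q x)‖
            = ‖t n * deriv χ (t n * x)‖ * ‖u x * q x‖ := by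
              rw [← norm_mul]; congr 1; ring
          _ ≤ _ := by gcongr
      · calc ‖u x * (χ (t n * x) * deriv q x)‖ = χ (t n * x) * ‖u x * deriv q x‖ := by
              rw [← abs_of_nonneg (χ.nonneg (x := t n * x)), ← Real.norm_eq_abs, ← norm_mul]
              simp only [Real.norm_eq_abs]
              congr 1
              rw [abs_of_nonneg χ.nonneg]; ring
          _ ≤ 1 * ‖u x * deriv q x‖ := by gcongr; exact χ.le_one
          _ = _ := one_mul _
    · refine ae_of_all _ fun x => ?_
      simp only [dη]
      have e1 : Tendsto (fun n => t n * deriv χ (t n * x) * q x) atTop (𝓝 0) := by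
        refine squeeze_zero_norm (a := fun n => t n * (C * ‖q x‖)) (fun n => ?_)
          (by simpa using t0.mul_const (C * ‖q x‖))
        rw [norm_mul, norm_mul, Real.norm_eq_abs (t n), abs_of_pos (tpos n), mul_assoc]
        gcongr
        exact hC _
      simpa using (e1.add ((tχ x).mul_const (deriv q x))).const_mul (u x)
  have l2 : Tendsto (fun n => ∫ x, u' x * η n x) atTop (𝓝 (∫ x, u' x * q x)) := by
    refine tendsto_integral_of_dominated_convergence
      (fun x => ‖u' x * q x‖) (fun n => ?_) ?_ ?_ ?_
    · exact (Lp.aestronglyMeasurable u').mul (ηt n).1.continuous.aestronglyMeasurable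
    · exact ((Lp.memLp u').integrable_mul hq2).norm
    · intro n
      refine ae_of_all _ fun x => ?_
      simp only [η, norm_mul, Real.norm_eq_abs]
      rw [abs_of_nonneg (χ.nonneg (x := t n * x))]
      gcongr
      exact mul_le_of_le_one_left (abs_nonneg _) χ.le_one
    · refine ae_of_all _ fun x => ?_
      simpa using ((tχ x).mul_const (q x)).const_mul (u' x)
  refine tendsto_nhds_unique l1 (l2.neg.congr fun n => ?_)
  exact (h (η n) (ηt n)).symm

end MultipoleWave

end

/-! ### Weak derivatives as multiplication by `2πiξ`. -/

section
open MeasureTheory Set Filter Topology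
open scoped ContDiff BoundedContinuousFunction RealInnerProductSpace SchwartzMap FourierTransform
open scoped ENNReal LineDeriv

namespace MultipoleWave

lemma integral_mul_toComplex (w : L2) {g : ℝ → ℂ} (hg : MemLp g 2) :
    ∫ x, g x * toComplex w x
      = ((∫ x, w x * (g x).re : ℝ) : ℂ) + ((∫ x, w x * (g x).im : ℝ) : ℂ) * Complex.I := by
  have hw : MemLp (fun x => (w x : ℂ)) 2 := (Lp.memLp w).ofReal
  have hi : Integrable (fun x => g x * (w x : ℂ)) := hg.integrable_mul hw
  have h1 : ∫ x, g x * toComplex w x = ∫ x, g x * (w x : ℂ) := by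
    refine integral_congr_ae ?_
    filter_upwards [coeFn_toComplex w] with x hx
    rw [hx]
  rw [h1, ← integral_re_add_im (𝕜 := ℂ) hi]
  have e1 : ∀ x, RCLike.re (g x * (w x : ℂ)) = w x * (g x).re := fun x => by simp [mul_comm]
  have e2 : ∀ x, RCLike.im (g x * (w x : ℂ)) = w x * (g x).im := fun x => by simp [mul_comm]
  simp only [e1, e2]
  rfl

lemma hasDerivAt_re_im (g : 𝓢(ℝ, ℂ)) (x : ℝ) :
    HasDerivAt (fun x => (g x).re) (deriv g x).re x ∧
      HasDerivAt (fun x => (g x).im) (deriv g x).im x :=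
  have h := (g.differentiable x).hasDerivAt
  ⟨Complex.reCLM.hasFDerivAt.comp_hasDerivAt x h, Complex.imCLM.hasFDerivAt.comp_hasDerivAt x h⟩

/-- The real and imaginary parts of a Schwartz function are smooth and square integrable together
with their derivatives, so `IsWeakDeriv.integral_mul_deriv` applies to each. -/
lemma IsWeakDeriv.integral_schwartz {u u' : L2} (h : IsWeakDeriv u u') (g : 𝓢(ℝ, ℂ)) :
    ∫ x, deriv g x * toComplex u x = -∫ x, g x * toComplex u' x := by
  have g2 : MemLp g 2 (volume : Measure ℝ) := g.memLp 2
  have g2' : MemLp (deriv g) 2 (volume : Measure ℝ) := by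
    have h1 := (SchwartzMap.derivCLM ℂ ℂ g).memLp 2 (volume : Measure ℝ)
    rwa [show ⇑(SchwartzMap.derivCLM ℂ ℂ g) = deriv g from
      funext fun x => SchwartzMap.derivCLM_apply ℂ g x] at h1
  have dr : deriv (fun x => (g x).re) = fun x => (deriv g x).re :=
    funext fun x => (hasDerivAt_re_im g x).1.deriv
  have di : deriv (fun x => (g x).im) = fun x => (deriv g x).im :=
    funext fun x => (hasDerivAt_re_im g x).2.deriv
  have e1 := h.integral_mul_deriv (q := fun x => (g x).re)
    (Complex.reCLM.contDiff.comp (g.smooth ⊤)) g2.re (by rw [dr]; exact g2'.re)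
  have e2 := h.integral_mul_deriv (q := fun x => (g x).im)
    (Complex.imCLM.contDiff.comp (g.smooth ⊤)) g2.im (by rw [di]; exact g2'.im)
  rw [dr] at e1
  rw [di] at e2
  rw [integral_mul_toComplex u g2', integral_mul_toComplex u' g2, e1, e2]
  push_cast
  ring

/-- The weak derivative is multiplication by `2πiξ` on the Fourier side. -/
theorem IsWeakDeriv.realFourier_ae {u u' : L2} (h : IsWeakDeriv u u') :
    ∀ᵐ ξ, realFourier u' ξ = derivSymbol ξ * realFourier u ξ := by
  -- The weak derivative is the derivative as a tempered distribution, for which the Fourier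
  -- transform is already known to give multiplication by `2πiξ`.
  have hd : ∂_{(1 : ℝ)} (toComplex u : 𝓢'(ℝ, ℂ)) = (toComplex u' : 𝓢'(ℝ, ℂ)) := by
    ext g
    have := h.integral_schwartz g
    simp only [TemperedDistribution.lineDerivOp_apply_apply, map_neg, Lp.toTemperedDistribution_apply,
      smul_eq_mul]
    rw [← neg_eq_iff_eq_neg] at this
    rw [← this]
    rfl
  have hF : (realFourier u' : 𝓢'(ℝ, ℂ)) = (2 * Real.pi * Complex.I) •
      TemperedDistribution.smulLeftCLM ℂ (fun x : ℝ => ((inner ℝ x (1 : ℝ) : ℝ) : ℂ))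
        (realFourier u : 𝓢'(ℝ, ℂ)) := by
    rw [realFourier_apply, realFourier_apply, ← Lp.fourier_toTemperedDistribution_eq,
      ← Lp.fourier_toTemperedDistribution_eq, ← hd, TemperedDistribution.fourier_lineDerivOp_eq]
  have hloc : ∀ v : L2C, LocallyIntegrable (fun x => v x) (volume : Measure ℝ) := fun v =>
    (Lp.memLp v).locallyIntegrable (by norm_num)
  refine ae_eq_of_integral_contDiff_smul_eq (hloc _) ?_ ?_
  · have := (hloc (realFourier u)).locallyIntegrableOn univ
    have := this.continuousOn_mul continuous_derivSymbol.continuousOn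
      isOpen_univ.isLocallyClosed
    exact locallyIntegrableOn_univ.1 this
  · intro g hg hgc
    have hg₁ : HasCompactSupport (Complex.ofRealCLM ∘ g) := hgc.comp_left rfl
    have hg₂ : ContDiff ℝ ∞ (Complex.ofRealCLM ∘ g) := by fun_prop
    have hts : ∀ x, hg₁.toSchwartzMap hg₂ x = ((g x : ℝ) : ℂ) := fun _ => rfl
    have h1 := congrArg (fun T : 𝓢'(ℝ, ℂ) => T (hg₁.toSchwartzMap hg₂)) hF
    have ht : (fun x : ℝ => ((inner ℝ x (1 : ℝ) : ℝ) : ℂ)).HasTemperateGrowth := by fun_prop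
    simp only [Lp.toTemperedDistribution_apply, smul_apply,
      TemperedDistribution.smulLeftCLM_apply_apply, SchwartzMap.smulLeftCLM_apply_apply ht,
      hts, smul_eq_mul] at h1
    rw [← integral_const_mul] at h1
    simp only [Complex.real_smul]
    rw [h1]
    refine integral_congr_ae (ae_of_all _ fun x => ?_)
    simp [derivSymbol]
    ring

lemma IsWeakDeriv.cutOp_realFourier {u u' : L2} (h : IsWeakDeriv u u') (n : ℕ) :
    cutOp n (realFourier u') = derivOp n (realFourier u) :=
  cutOp_eq_derivOp_iff.2 h.realFourier_ae n

/-- The inverse Fourier transform turns multiplication by `2πiξ` into the weak derivative. -/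
theorem isWeakDeriv_realFourierInv {z y : L2C} (h : ∀ n, cutOp n y = derivOp n z) :
    IsWeakDeriv (realFourierInv z) (realFourierInv y) := by
  rw [cutOp_eq_derivOp_iff] at h
  intro η hη
  have hF : ((2 * Real.pi * Complex.I) •
      TemperedDistribution.smulLeftCLM ℂ (fun x : ℝ => ((inner ℝ x (1 : ℝ) : ℝ) : ℂ))
        (z : 𝓢'(ℝ, ℂ))) = (y : 𝓢'(ℝ, ℂ)) := by
    have ht : (fun x : ℝ => ((inner ℝ x (1 : ℝ) : ℝ) : ℂ)).HasTemperateGrowth := by fun_prop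
    ext g
    simp only [Lp.toTemperedDistribution_apply, smul_apply,
      TemperedDistribution.smulLeftCLM_apply_apply, SchwartzMap.smulLeftCLM_apply_apply ht,
      smul_eq_mul]
    rw [← integral_const_mul]
    refine integral_congr_ae ?_
    filter_upwards [h] with x hx
    rw [hx]
    simp [derivSymbol]
    ring
  have hd : ∂_{(1 : ℝ)} ((𝓕⁻ z : L2C) : 𝓢'(ℝ, ℂ)) = ((𝓕⁻ y : L2C) : 𝓢'(ℝ, ℂ)) := by
    rw [← Lp.fourierInv_toTemperedDistribution_eq, ← Lp.fourierInv_toTemperedDistribution_eq,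
      TemperedDistribution.lineDerivOp_fourierInv_eq, hF]
  have hg₁ : HasCompactSupport (Complex.ofRealCLM ∘ η) := hη.2.comp_left rfl
  have hη1 := hη.1
  have hg₂ : ContDiff ℝ ∞ (Complex.ofRealCLM ∘ η) := by fun_prop
  have hts : ∀ x, hg₁.toSchwartzMap hg₂ x = ((η x : ℝ) : ℂ) := fun _ => rfl
  have h1 := congrArg (fun T : 𝓢'(ℝ, ℂ) => (T (hg₁.toSchwartzMap hg₂)).re) hd
  simp only [TemperedDistribution.lineDerivOp_apply_apply, map_neg, Lp.toTemperedDistribution_apply,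
      smul_eq_mul, hts, Complex.neg_re] at h1
  have hdη : ∀ x, (∂_{(1 : ℝ)} (hg₁.toSchwartzMap hg₂)) x = ((deriv η x : ℝ) : ℂ) := by
    intro x
    have h2 : HasDerivAt (fun x => ((η x : ℝ) : ℂ)) ((deriv η x : ℝ) : ℂ) x :=
      ((hη1.differentiable (by norm_num) x).hasDerivAt).ofReal_comp
    exact h2.deriv
  have hre : ∀ (v : L2C) {q : ℝ → ℝ}, IsTest q →
      (∫ x, ((q x : ℝ) : ℂ) * v x).re = pairing (realPart v) q := by
    intro v q hq
    have hq1 := hq.1.continuous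
    have hi : Integrable (fun x => ((q x : ℝ) : ℂ) * v x) :=
      ((hq1.memLp_of_hasCompactSupport hq.2).ofReal : MemLp (fun x => ((q x : ℝ) : ℂ)) 2 _).integrable_mul
        (Lp.memLp v)
    have := integral_re hi
    simp only [RCLike.re_eq_complex_re] at this
    rw [← this, pairing]
    refine integral_congr_ae ?_
    filter_upwards [coeFn_realPart v] with x hx
    rw [hx, Complex.re_ofReal_mul, mul_comm]
  simp only [hdη] at h1
  rw [hre _ hη, hre _ hη.deriv] at h1
  rw [realFourierInv_apply, realFourierInv_apply]
  linarith

end MultipoleWave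

end

/-! ### The Sobolev embedding and the space `H^{1,2}(ℝ)`. -/

section
open MeasureTheory Set Filter Topology
open scoped ContDiff BoundedContinuousFunction RealInnerProductSpace SchwartzMap FourierTransform
open scoped ENNReal LineDeriv

namespace MultipoleWave

/-- The function `(1 + 2πiξ)⁻¹`. -/
noncomputable def resolventSymbol (ξ : ℝ) : ℂ := (1 + derivSymbol ξ)⁻¹

lemma one_add_derivSymbol_ne_zero (ξ : ℝ) : 1 + derivSymbol ξ ≠ 0 := by
  intro h
  have := congrArg Complex.re h
  simp [derivSymbol] at this

lemma memLp_resolventSymbol : MemLp resolventSymbol 2 (volume : Measure ℝ) := by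
  have hc : Continuous resolventSymbol :=
    (continuous_const.add continuous_derivSymbol).inv₀ one_add_derivSymbol_ne_zero
  rw [memLp_two_iff_integrable_sq_norm hc.aestronglyMeasurable]
  refine integrable_inv_one_add_sq.mono' (hc.norm.pow 2).aestronglyMeasurable
    (ae_of_all _ fun ξ => ?_)
  rw [norm_pow, norm_norm, resolventSymbol, norm_inv, inv_pow, ← Complex.normSq_eq_norm_sq]
  have h1 : Complex.normSq (1 + derivSymbol ξ) = 1 + (2 * Real.pi) ^ 2 * ξ ^ 2 := by
    simp [Complex.normSq_apply, derivSymbol]; ring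
  rw [h1]
  have : 1 ≤ (2 * Real.pi) ^ 2 := one_le_pow₀ (by linarith [Real.pi_gt_three])
  gcongr
  nlinarith [sq_nonneg ξ]

/-- Multiplication by `(1 + 2πiξ)⁻¹` as a map from `L²` to `L¹`. -/
noncomputable def resolventOp : L2C →L[ℝ] Lp ℂ 1 (volume : Measure ℝ) :=
  (ContinuousLinearMap.mul ℝ ℂ).holderL volume 2 2 1 memLp_resolventSymbol.toLp

/-- The Sobolev embedding: the continuous representative of an element of `H^{1,2}(ℝ)`. -/
noncomputable def sobolevEmbedding : L2 × L2 →L[ℝ] (ℝ →ᵇ ℂ) :=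
  ((Real.Lp.fourierTransformInvCLM ℝ ℂ).restrictScalars ℝ).comp
    (resolventOp.comp (realFourier.comp (ContinuousLinearMap.fst ℝ L2 L2) +
      realFourier.comp (ContinuousLinearMap.snd ℝ L2 L2)))

/-- The Fourier transform of `u + u'` is `(1 + 2πiξ)` times that of `u`. Dividing by this factor,
whose inverse is in `L²`, exhibits the transform of `u` as an `L¹` function. -/
lemma resolventOp_ae {u u' : L2} (h : IsWeakDeriv u u') :
    resolventOp (realFourier u + realFourier u') =ᵐ[volume] realFourier u := by
  have h1 := (ContinuousLinearMap.mul ℝ ℂ).coeFn_holder (r := 1)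
    (memLp_resolventSymbol.toLp : Lp ℂ 2 (volume : Measure ℝ)) (realFourier u + realFourier u')
  filter_upwards [h1, memLp_resolventSymbol.coeFn_toLp, h.realFourier_ae,
    Lp.coeFn_add (realFourier u) (realFourier u')] with ξ h1 h2 h3 h4
  refine h1.trans ?_
  simp only [ContinuousLinearMap.mul_apply']
  rw [h2, h4, Pi.add_apply, h3, resolventSymbol]
  field_simp [one_add_derivSymbol_ne_zero ξ]

/-- The embedding is the integral inverse transform of an `L¹` function, which is continuous, while
`u` is given by the `L²` inverse transform of the same function. Tested against smooth compactly
supported functions, both inverse transforms can be moved onto the test function, so they agree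
almost everywhere. -/
theorem sobolevEmbedding_ae {u u' : L2} (h : IsWeakDeriv u u') :
    (fun ρ => (sobolevEmbedding (u, u') ρ).re) =ᵐ[volume] u := by
  set q : Lp ℂ 1 (volume : Measure ℝ) := resolventOp (realFourier u + realFourier u') with hq
  have hs : ∀ ρ, sobolevEmbedding (u, u') ρ = 𝓕⁻ (q : ℝ → ℂ) ρ := fun ρ => by
    rw [hq, ← Real.Lp.fourierTransformInv_apply, ← Real.Lp.fourierTransformInvCLM_apply]
    rfl
  have hae : (𝓕⁻ (q : ℝ → ℂ)) =ᵐ[volume] (𝓕⁻ (realFourier u) : L2C) := by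
    refine ae_eq_of_integral_contDiff_smul_eq ?_ ?_ ?_
    · rw [← Real.Lp.coe_fourierTransformInv]
      exact (Real.Lp.fourierTransformInv q).continuous.locallyIntegrable
    · exact (Lp.memLp _).locallyIntegrable (by norm_num)
    · intro g hg hgc
      have hg₁ : HasCompactSupport (Complex.ofRealCLM ∘ g) := hgc.comp_left rfl
      have hg₂ : ContDiff ℝ ∞ (Complex.ofRealCLM ∘ g) := by fun_prop
      set s : 𝓢(ℝ, ℂ) := hg₁.toSchwartzMap hg₂ with hs'
      have hs : ∀ x, s x = ((g x : ℝ) : ℂ) := fun _ => rfl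
      have e1 : ∫ x, s x * (𝓕⁻ (realFourier u) : L2C) x = ∫ x, (𝓕⁻ s) x * realFourier u x := by
        have := congrArg (fun T : 𝓢'(ℝ, ℂ) => T s)
          (Lp.fourierInv_toTemperedDistribution_eq (realFourier u))
        simp only [TemperedDistribution.fourierInv_apply, Lp.toTemperedDistribution_apply,
          smul_eq_mul] at this
        exact this.symm
      have e2 : ∫ x, s x * (𝓕⁻ (q : ℝ → ℂ)) x = ∫ x, (𝓕⁻ s) x * q x := by
        have := VectorFourier.integral_fourierIntegral_smul_eq_flip (μ := volume) (ν := volume)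
          (L := -innerₗ ℝ) (f := fun x => s x) (g := fun x => q x) Real.continuous_fourierChar
          (by
            have : Continuous fun p : ℝ × ℝ => -(inner ℝ p.1 p.2) := by fun_prop
            exact this) s.integrable (L1.integrable_coeFn q)
        rw [SchwartzMap.fourierInv_coe]
        refine Eq.trans ?_ this.symm
        simp only [smul_eq_mul]
        refine integral_congr_ae (ae_of_all _ fun x => ?_)
        simp only
        congr 1
        rw [show (-innerₗ ℝ).flip = -innerₗ ℝ from by ext; simp]
        rfl
      simp only [Complex.real_smul, ← hs]
      rw [e1, e2]
      refine integral_congr_ae ?_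
      filter_upwards [resolventOp_ae h] with x hx
      rw [hq, hx]
  have h2 : realPart (𝓕⁻ (realFourier u) : L2C) = u := realFourierInv_realFourier u
  have h3 := coeFn_realPart (𝓕⁻ (realFourier u) : L2C)
  rw [h2] at h3
  filter_upwards [hae, h3] with ρ h4 h5
  rw [h5, hs, h4]

/-- `H1.val` as a continuous linear map. -/
noncomputable def H1.valL : H1 →L[ℝ] L2 :=
  ((ContinuousLinearMap.fst ℝ L2 L2).comp
    (WithLp.prodContinuousLinearEquiv 2 ℝ L2 L2).toContinuousLinearMap).comp H1Submodule.subtypeL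

/-- `H1.grad` as a continuous linear map. -/
noncomputable def H1.gradL : H1 →L[ℝ] L2 :=
  ((ContinuousLinearMap.snd ℝ L2 L2).comp
    (WithLp.prodContinuousLinearEquiv 2 ℝ L2 L2).toContinuousLinearMap).comp H1Submodule.subtypeL

lemma H1.isWeakDeriv (u : H1) : IsWeakDeriv u.val u.grad := u.2

lemma realFourier_injective : Function.Injective realFourier := fun u v h => by
  rw [← realFourierInv_realFourier u, h, realFourierInv_realFourier]

/-- On the Fourier side the weak derivative is a multiple of the function, so it carries no further
information. -/
lemma H1.ext {u v : H1} (h : u.val = v.val) : u = v := by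
  have hg : u.grad = v.grad := by
    apply realFourier_injective
    apply Lp.ext
    filter_upwards [u.isWeakDeriv.realFourier_ae, v.isWeakDeriv.realFourier_ae] with ξ h1 h2
    rw [h1, h2, h]
  apply Subtype.ext
  apply (WithLp.prodContinuousLinearEquiv 2 ℝ L2 L2).injective
  exact Prod.ext h hg

/-- The element of `H^{1,2}(ℝ)` with given function and weak derivative. -/
def H1.mk (u u' : L2) (h : IsWeakDeriv u u') : H1 := ⟨WithLp.toLp 2 (u, u'), h⟩

lemma H1.continuousOn_mk {S : Set ℝ} {u u' : ℝ → L2} (h : ∀ x, IsWeakDeriv (u x) (u' x))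
    (hu : ContinuousOn u S) (hu' : ContinuousOn u' S) :
    ContinuousOn (fun x => H1.mk (u x) (u' x) (h x)) S := by
  refine continuousOn_iff_continuous_domRestrict.2 (Continuous.subtype_mk ?_ _)
  exact (WithLp.prodContinuousLinearEquiv 2 ℝ L2 L2).symm.continuous.comp
    (continuousOn_iff_continuous_domRestrict.1 (hu.prodMk hu'))

/-- The pairing with a test function as a continuous linear functional. -/
lemma IsTest.exists_functional {η : ℝ → ℝ} (h : IsTest η) :
    ∃ L : L2 →L[ℝ] ℝ, ∀ u, L u = pairing u η := by
  have hη : MemLp η 2 (volume : Measure ℝ) := h.1.continuous.memLp_of_hasCompactSupport h.2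
  refine ⟨innerSL ℝ (hη.toLp : L2), fun u => ?_⟩
  rw [innerSL_apply_apply, L2.inner_def, pairing]
  refine integral_congr_ae ?_
  filter_upwards [hη.coeFn_toLp] with x hx
  rw [hx]
  simp

end MultipoleWave

end

/-! ### Geometry of the background and regularity of the coefficients. -/

section
open MeasureTheory Set Filter Topology
open scoped ContDiff

/-- The difference quotient at `b`, completed by the derivative, is continuous on a compact interval
and hence bounded. -/
lemma exists_abs_sub_le_mul_sub {f : ℝ → ℝ} {a b : ℝ} (hab : a ≤ b)
    (hf : ∀ x ∈ Icc a b, DifferentiableAt ℝ f x) :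
    ∃ C, 0 ≤ C ∧ ∀ x ∈ Icc a b, |f x - f b| ≤ C * (b - x) := by
  have hc : ContinuousOn (dslope f b) (Icc a b) := by
    intro x hx
    refine ContinuousAt.continuousWithinAt ?_
    rcases eq_or_ne x b with rfl | h
    · exact continuousAt_dslope_same.2 (hf x hx)
    · exact (continuousAt_dslope_of_ne h).2 (hf x hx).continuousAt
  obtain ⟨C, hC⟩ := isCompact_Icc.exists_bound_of_continuousOn hc
  refine ⟨C, (norm_nonneg _).trans (hC b ⟨hab, le_rfl⟩), fun x hx => ?_⟩
  have h := sub_smul_dslope f b x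
  rw [← h, smul_eq_mul, abs_mul, mul_comm, abs_sub_comm x b, abs_of_nonneg (sub_nonneg.2 hx.2)]
  exact mul_le_mul_of_nonneg_right (hC x hx) (sub_nonneg.2 hx.2)

/-- The completed difference quotient at `b` is positive everywhere, at `b` because the zero is
simple. Its minimum on the compact interval serves as `m`. -/
lemma exists_mul_sub_le_neg {f : ℝ → ℝ} {a b : ℝ} (hab : a ≤ b)
    (hf : ∀ x ∈ Icc a b, DifferentiableAt ℝ f x) (hneg : ∀ x ∈ Ico a b, f x < 0) (hb : f b = 0)
    (hd : 0 < deriv f b) : ∃ m, 0 < m ∧ ∀ x ∈ Icc a b, m * (b - x) ≤ -f x := by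
  have hc : ContinuousOn (dslope f b) (Icc a b) := by
    intro x hx
    refine ContinuousAt.continuousWithinAt ?_
    rcases eq_or_ne x b with rfl | h
    · exact continuousAt_dslope_same.2 (hf x hx)
    · exact (continuousAt_dslope_of_ne h).2 (hf x hx).continuousAt
  obtain ⟨x₀, hx₀, hmin⟩ := isCompact_Icc.exists_isMinOn ⟨b, hab, le_rfl⟩ hc
  have key : ∀ x, (b - x) * dslope f b x = -f x := by
    intro x
    have h := sub_smul_dslope f b x
    rw [smul_eq_mul, hb] at h
    linarith
  refine ⟨dslope f b x₀, ?_, fun x hx => ?_⟩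
  · rcases eq_or_lt_of_le hx₀.2 with h | h
    · rw [h, dslope_same]; exact hd
    · have h1 := key x₀
      have h2 := hneg x₀ ⟨hx₀.1, h⟩
      have h3 : 0 < b - x₀ := sub_pos.2 h
      exact pos_of_mul_pos_right (by linarith) h3.le
  · rw [← key x, mul_comm]
    exact mul_le_mul_of_nonneg_left (hmin hx) (sub_nonneg.2 hx.2)

/-- At `d = 0` the form is at most `(s - A)(-2r² + 4rt/X) = (s - A)(2(t/X)² - 2(r - t/X)²)`, hence
at most `4t²/X²`. Both coefficients carry the same factor `s - A`, so the constant stays bounded as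
`s` tends to `A`. The remaining errors are `O(d)`, and `m d ≤ a` absorbs their `r²` part. -/
lemma degenerate_form_le {P Q A s r t d X m a C₁ C₂ M : ℝ} (hs1 : 0 ≤ s - A) (hs2 : s - A ≤ 2)
    (hX : 0 < X) (d0 : 0 ≤ d) (dX : d ≤ X) (hC₁ : 0 ≤ C₁) (hC₂ : 0 ≤ C₂) (hm : 0 < m)
    (ha : m * d ≤ a) (hM₁ : (C₁ + C₂) / m ≤ M) (hM₂ : 4 / X ^ 2 + C₂ * X ≤ M)
    (e1 : P ≤ 2 * (A - s) + C₁ * d) (e2 : |Q - 2 * (s - A) / X| ≤ C₂ * d) :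
    P * r ^ 2 + 2 * Q * r * t ≤ M * (a * r ^ 2 + t ^ 2) := by
  have e3 : (Q - 2 * (s - A) / X) * (2 * (r * t)) ≤ C₂ * d * (r ^ 2 + t ^ 2) := by
    have k1 : |2 * (r * t)| ≤ r ^ 2 + t ^ 2 := by
      rw [abs_le]; constructor <;> nlinarith [sq_nonneg (r + t), sq_nonneg (r - t)]
    calc _ ≤ |(Q - 2 * (s - A) / X) * (2 * (r * t))| := le_abs_self _
      _ ≤ _ := by
          rw [abs_mul]
          exact mul_le_mul e2 k1 (abs_nonneg _) (by positivity)
  have e4 : 2 * (A - s) * r ^ 2 + 2 * (2 * (s - A) / X) * r * t ≤ 4 / X ^ 2 * t ^ 2 := by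
    have j1 : 2 * (A - s) * r ^ 2 + 2 * (2 * (s - A) / X) * r * t
        = (s - A) * (2 * (t / X) ^ 2 - 2 * (r - t / X) ^ 2) := by field_simp; ring
    have j2 : (s - A) * (2 * (t / X) ^ 2 - 2 * (r - t / X) ^ 2) ≤ (s - A) * (2 * (t / X) ^ 2) :=
      mul_le_mul_of_nonneg_left (by linarith [sq_nonneg (r - t / X)]) hs1
    have j3 : (s - A) * (2 * (t / X) ^ 2) ≤ 2 * (2 * (t / X) ^ 2) :=
      mul_le_mul_of_nonneg_right hs2 (by positivity)
    have j4 : 2 * (2 * (t / X) ^ 2) = 4 / X ^ 2 * t ^ 2 := by field_simp; ring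
    linarith
  have e5 : (C₁ + C₂) * (d * r ^ 2) ≤ (C₁ + C₂) / m * (a * r ^ 2) := by
    have j1 := mul_le_mul_of_nonneg_right ha (sq_nonneg r)
    rw [div_mul_eq_mul_div, le_div_iff₀ hm]
    have := mul_le_mul_of_nonneg_left j1 (add_nonneg hC₁ hC₂)
    linarith
  have ev : 0 ≤ a * r ^ 2 := mul_nonneg ((mul_nonneg hm.le d0).trans ha) (sq_nonneg r)
  have e6 := mul_le_mul_of_nonneg_right hM₁ ev
  have e7 := mul_le_mul_of_nonneg_right hM₂ (sq_nonneg t)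
  have e8 : C₂ * d * t ^ 2 ≤ C₂ * X * t ^ 2 := by gcongr
  have e9 := mul_le_mul_of_nonneg_right e1 (sq_nonneg r)
  linarith

namespace MultipoleWave

/-- The coefficients of the rescaled multipole wave equation. -/
noncomputable def waveCoeff (G ψ : ℝ → ℝ) (l : ℕ) (κ xi xc : ℝ) : WaveCoeff where
  a := alpha G
  b := beta G
  c := gamma G
  h := potential G ψ l κ
  da := deriv (alpha G)
  db := deriv (beta G)
  dc := deriv (gamma G)
  s := 2 * (1 - κ)
  x₀ := xi
  x₁ := xc

namespace IsNakedBackground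
variable {G ψ : ℝ → ℝ} {xc : ℝ} (h : IsNakedBackground G ψ xc)
include h

lemma xc_pos : 0 < xc := h.horizon.1.1

lemma xc_mul_G : xc * G xc = 1 := by linarith [h.horizon.1.2]

lemma mem_xc : xc ∈ Ioc 0 xc := ⟨h.xc_pos, le_rfl⟩

lemma differentiableAt_G {x : ℝ} (hx : x ∈ Ioc 0 xc) : DifferentiableAt ℝ G x :=
  (h.analytic_G x hx).differentiableAt

/-- By `nondegenerate`, `xG` increases through `1` at `xc`, so it is below `1` just before `xc`. A
point with `xG ≥ 1` would give, by the intermediate value theorem, a root smaller than `xc`. -/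
lemma mul_G_lt_one {x : ℝ} (hx : x ∈ Ioo 0 xc) : x * G x < 1 := by
  by_contra hcon
  push Not at hcon
  have hxc := h.xc_pos
  have hd : HasDerivAt (fun x => x * G x) (1 * G xc + xc * deriv G xc) xc :=
    (hasDerivAt_id xc).mul (h.differentiableAt_G h.mem_xc).hasDerivAt
  have hpos : 0 < 1 * G xc + xc * deriv G xc := by
    have h1 := h.nondegenerate
    have h2 := h.xc_mul_G
    have : 0 < xc * (1 * G xc + xc * deriv G xc) := by nlinarith
    exact pos_of_mul_pos_right this hxc.le
  have hev := hd.tendsto_slope.eventually (lt_mem_nhds hpos)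
  have hev' : ∀ᶠ y in 𝓝[<] xc, 0 < slope (fun x => x * G x) xc y :=
    hev.filter_mono (nhdsWithin_mono _ fun y (hy : y < xc) => hy.ne)
  have hev2 : ∀ᶠ y in 𝓝[<] xc, y ∈ Ioo x xc := Ioo_mem_nhdsLT hx.2
  obtain ⟨y, hy1, hy2⟩ := (hev'.and hev2).exists
  have hy3 : y * G y < 1 := by
    rw [slope_def_field, h.xc_mul_G] at hy1
    by_contra hc
    push Not at hc
    have : (y * G y - 1) / (y - xc) ≤ 0 :=
      div_nonpos_of_nonneg_of_nonpos (by linarith) (by linarith [hy2.2])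
    linarith
  have hcont : ContinuousOn (fun x => x * G x) (Icc x y) := fun t ht =>
    (continuousAt_id.mul (h.differentiableAt_G
      ⟨hx.1.trans_le ht.1, ht.2.trans hy2.2.le⟩).continuousAt).continuousWithinAt
  obtain ⟨t, ht, ht1⟩ := intermediate_value_Icc' hy2.1.le hcont ⟨hy3.le, hcon⟩
  have := h.horizon.2 (show 0 < t ∧ t * G t - 1 = 0 from
    ⟨hx.1.trans_le ht.1, sub_eq_zero.2 ht1⟩)
  linarith [ht.2, hy2.2]

lemma mul_G_le_one {x : ℝ} (hx : x ∈ Ioc 0 xc) : x * G x ≤ 1 := by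
  rcases eq_or_lt_of_le hx.2 with rfl | h1
  · exact h.xc_mul_G.le
  · exact (h.mul_G_lt_one ⟨hx.1, h1⟩).le

/-- The energy conditions bound `G'` by `ψ'(1 - xG)G` with `ψ' ≤ 0` and `1 - xG ≥ 0`. -/
lemma deriv_G_nonpos {x : ℝ} (hx : x ∈ Ioc 0 xc) (hG : 0 ≤ G x) : deriv G x ≤ 0 := by
  have h1 := h.energy_G x hx
  have h2 : deriv ψ x ≤ 0 := by
    by_contra hc
    push Not at hc
    have := h.energy_psi x hx
    have := mul_pos hx.1 hc
    linarith
  have h3 := mul_nonneg (mul_nonneg (neg_nonneg.2 h2) (sub_nonneg.2 (h.mul_G_le_one hx))) hG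
  linarith

lemma antitoneOn_G_of_nonneg {x : ℝ} (hx : 0 < x) (hG : ∀ y ∈ Ioo x xc, 0 ≤ G y) :
    AntitoneOn G (Icc x xc) := by
  have hsub : ∀ y ∈ Icc x xc, y ∈ Ioc 0 xc := fun y hy => ⟨hx.trans_le hy.1, hy.2⟩
  refine antitoneOn_of_deriv_nonpos (convex_Icc _ _) (fun y hy =>
    (h.differentiableAt_G (hsub y hy)).continuousAt.continuousWithinAt) ?_ ?_
  · intro y hy
    exact (h.differentiableAt_G (hsub y (interior_subset hy))).differentiableWithinAt
  · intro y hy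
    rw [interior_Icc] at hy
    exact h.deriv_G_nonpos (hsub y (Ioo_subset_Icc_self hy)) (hG y hy)

/-- After the last point `y` with `G y ≤ 0` the function `G` is positive, hence decreasing up to
`xc`. This forces `G y ≥ G xc > 0`. -/
lemma G_pos {x : ℝ} (hx : x ∈ Ioc 0 xc) : 0 < G x := by
  by_contra hcon
  push Not at hcon
  have hGc : 0 < G xc := by
    have := h.xc_mul_G
    exact pos_of_mul_pos_right (by rw [this]; exact one_pos) h.xc_pos.le
  have hcont : ContinuousOn G (Icc x xc) := fun y hy =>
    (h.differentiableAt_G ⟨hx.1.trans_le hy.1, hy.2⟩).continuousAt.continuousWithinAt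
  have hcpt : IsCompact (Icc x xc ∩ G ⁻¹' Iic 0) :=
    isCompact_Icc.of_isClosed_subset (hcont.preimage_isClosed_of_isClosed isClosed_Icc isClosed_Iic)
      inter_subset_left
  obtain ⟨y, hy, hmax⟩ := hcpt.exists_isGreatest ⟨x, ⟨le_rfl, hx.2⟩, hcon⟩
  have hanti := h.antitoneOn_G_of_nonneg (x := y) (hx.1.trans_le hy.1.1) (fun t ht => by
    by_contra hc
    push Not at hc
    have := hmax ⟨⟨hy.1.1.trans ht.1.le, ht.2.le⟩, hc.le⟩
    linarith [ht.1])
  have := hanti ⟨le_rfl, hy.1.2⟩ ⟨hy.1.2, le_rfl⟩ hy.1.2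
  have := hy.2
  simp only [mem_preimage, mem_Iic] at this
  linarith

lemma analytic_alpha : AnalyticOnNhd ℝ (alpha G) (Ioc 0 xc) := fun x hx =>
  (analyticAt_const.mul analyticAt_id).mul
    (analyticAt_const.sub (analyticAt_id.mul (h.analytic_G x hx)))

lemma analytic_beta : AnalyticOnNhd ℝ (beta G) (Ioc 0 xc) := fun x hx =>
  analyticAt_const.sub ((analyticAt_const.mul analyticAt_id).mul (h.analytic_G x hx))

lemma analytic_gamma : AnalyticOnNhd ℝ (gamma G) (Ioc 0 xc) := fun x hx =>
  analyticAt_const.mul (h.analytic_G x hx)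

lemma analytic_potential (l : ℕ) (κ : ℝ) : AnalyticOnNhd ℝ (potential G ψ l κ) (Ioc 0 xc) :=
  fun x hx => ((analyticAt_const.mul (h.analytic_psi x hx).rexp).sub
    (analyticAt_const.mul (h.analytic_gamma x hx))).add
    (analyticAt_const.mul (h.analytic_beta.deriv x hx))

/-- This value and `deriv_beta_xc` contain the same quantity `A`; that coincidence makes the
quadratic form at the horizon a multiple of `s - A`. -/
lemma deriv_alpha_xc : deriv (alpha G) xc = 2 * (1 + xc ^ 2 * deriv G xc) := by
  have hd : HasDerivAt (alpha G) ((-2 * 1) * (1 - xc * G xc)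
      + (-2 * xc) * -(1 * G xc + xc * deriv G xc)) xc :=
    ((hasDerivAt_id xc).const_mul (-2)).mul (((hasDerivAt_id xc).mul
      (h.differentiableAt_G h.mem_xc).hasDerivAt).const_sub 1)
  rw [hd.deriv]
  linear_combination (4 : ℝ) * h.xc_mul_G

lemma deriv_beta_xc : xc * deriv (beta G) xc = -2 * (1 + xc ^ 2 * deriv G xc) := by
  have hd : HasDerivAt (beta G) (-((2 * 1) * G xc + (2 * xc) * deriv G xc)) xc :=
    (((hasDerivAt_id xc).const_mul 2).mul
      (h.differentiableAt_G h.mem_xc).hasDerivAt).const_sub 1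
  rw [hd.deriv]
  linear_combination (-2 : ℝ) * h.xc_mul_G

/-- The coefficients of the rescaled multipole wave equation are regular, uniformly in the
admissible range of `κ`. -/
theorem exists_regular (l : ℕ) {xi : ℝ} (hxi : xi ∈ Ioo 0 xc) :
    ∃ m M, ∀ κ ∈ Icc (0 : ℝ) (min 2 ((1 - xc ^ 2 * deriv G xc) / 2)),
      (waveCoeff G ψ l κ xi xc).Regular m M := by
  have hsub : ∀ x ∈ Icc xi xc, x ∈ Ioc 0 xc := fun x hx => ⟨hxi.1.trans_le hx.1, hx.2⟩
  have hxc := h.xc_pos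
  have hle : xi ≤ xc := hxi.2.le
  set A := 1 + xc ^ 2 * deriv G xc with hA
  have hA0 : 0 < A := h.nondegenerate
  have da : ∀ x ∈ Icc xi xc, DifferentiableAt ℝ (alpha G) x := fun x hx =>
    (h.analytic_alpha x (hsub x hx)).differentiableAt
  have db : ∀ x ∈ Icc xi xc, DifferentiableAt ℝ (beta G) x := fun x hx =>
    (h.analytic_beta x (hsub x hx)).differentiableAt
  have dc : ∀ x ∈ Icc xi xc, DifferentiableAt ℝ (gamma G) x := fun x hx =>
    (h.analytic_gamma x (hsub x hx)).differentiableAt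
  have dda : ∀ x ∈ Icc xi xc, DifferentiableAt ℝ (deriv (alpha G)) x := fun x hx =>
    (h.analytic_alpha.deriv x (hsub x hx)).differentiableAt
  have ddb : ∀ x ∈ Icc xi xc, DifferentiableAt ℝ (deriv (beta G)) x := fun x hx =>
    (h.analytic_beta.deriv x (hsub x hx)).differentiableAt
  have cont : ∀ {f : ℝ → ℝ}, (∀ x ∈ Icc xi xc, DifferentiableAt ℝ f x) →
      ContinuousOn f (Icc xi xc) := fun hf x hx => (hf x hx).continuousAt.continuousWithinAt
  have bdd : ∀ {f : ℝ → ℝ}, ContinuousOn f (Icc xi xc) →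
      ∃ C, 0 ≤ C ∧ ∀ x ∈ Icc xi xc, |f x| ≤ C := fun hf => by
    obtain ⟨C, hC⟩ := isCompact_Icc.exists_bound_of_continuousOn hf
    exact ⟨C, (norm_nonneg _).trans (hC xc ⟨hle, le_rfl⟩), hC⟩
  have hac : alpha G xc = 0 := by simp [alpha, h.xc_mul_G]
  obtain ⟨m₁, m₁0, hm₁⟩ := exists_mul_sub_le_neg hle da (fun x hx => by
    have h1 := h.mul_G_lt_one ⟨hxi.1.trans_le hx.1, hx.2⟩
    have h2 := mul_pos (hxi.1.trans_le hx.1) (sub_pos.2 h1)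
    unfold alpha
    linarith) hac (by rw [h.deriv_alpha_xc]; positivity)
  obtain ⟨Ca, Ca0, hCa⟩ := exists_abs_sub_le_mul_sub hle dda
  obtain ⟨Cb, Cb0, hCb⟩ := exists_abs_sub_le_mul_sub hle db
  obtain ⟨Cd, Cd0, hCd⟩ := exists_abs_sub_le_mul_sub hle ddb
  obtain ⟨Cc, Cc0, hCc⟩ := exists_abs_sub_le_mul_sub hle dc
  obtain ⟨B₁, B₁0, hB₁⟩ := bdd (cont fun x hx => (h.analytic_gamma.deriv x (hsub x hx)).differentiableAt)
  obtain ⟨B₂, B₂0, hB₂⟩ := bdd (cont dc)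
  obtain ⟨B₃, B₃0, hB₃⟩ := bdd (cont ddb)
  obtain ⟨B₄, B₄0, hB₄⟩ := bdd (f := fun x => (l : ℝ) * (l + 1) * Real.exp (ψ x))
    (cont fun x hx => (h.analytic_psi x (hsub x hx)).differentiableAt.exp.const_mul _)
  -- `m₁` bounds `-α / (xc - x)` from below; `2 / xc` is the value of `γ` at `xc`, its minimum since
  -- `G` decreases.
  set m := min m₁ (2 / xc) with hm
  have m0 : 0 < m := lt_min m₁0 (by positivity)
  set C₁ := Ca + 4 * Cb with hC₁
  set C₂ := Cd + 2 * Cc with hC₂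
  -- The summands bound `γ'`, the potential, and the `r²` and `t²` parts of the quadratic form, in
  -- this order. None depends on `κ`.
  set M := B₁ + (B₄ + B₂ + B₃) + (C₁ + C₂) / m₁ + (4 / xc ^ 2 + C₂ * xc) with hM
  have i1 : 0 ≤ (C₁ + C₂) / m₁ := by positivity
  have i2 : 0 ≤ 4 / xc ^ 2 + C₂ * xc := by positivity
  refine ⟨m, M, fun κ hκ => ?_⟩
  -- This is where the upper bound on `κ` enters.
  have hs1 : A ≤ 2 * (1 - κ) := by
    have := hκ.2.trans (min_le_right _ _)
    linarith
  have hs2 : 2 * (1 - κ) ≤ 2 := by linarith [hκ.1]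
  have hκ0 := hκ.1
  refine ⟨hxi.2, m0, by positivity, fun x hx => (da x hx).hasDerivAt,
    fun x hx => (db x hx).hasDerivAt, fun x hx => (dc x hx).hasDerivAt, cont dda, cont ddb,
    cont fun x hx => (h.analytic_potential l κ x (hsub x hx)).differentiableAt, ?_, ?_, ?_, ?_, ?_⟩
  · intro x hx
    exact (mul_le_mul_of_nonneg_right (min_le_left _ _) (sub_nonneg.2 hx.2)).trans (hm₁ x hx)
  · intro x hx
    have h1 := h.antitoneOn_G_of_nonneg hxi.1
      (fun y hy => (h.G_pos (hsub y (Ioo_subset_Icc_self hy))).le) hx ⟨hle, le_rfl⟩ hx.2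
    have h2 : G xc = 1 / xc := by rw [eq_div_iff hxc.ne', mul_comm]; exact h.xc_mul_G
    refine (min_le_right _ _).trans ?_
    change 2 / xc ≤ 2 * G x
    rw [h2] at h1
    calc 2 / xc = 2 * (1 / xc) := by ring
      _ ≤ _ := by linarith
  · intro x hx
    have := (le_abs_self _).trans (hB₁ x hx)
    change deriv (gamma G) x ≤ M
    linarith
  · intro x hx
    change |potential G ψ l κ x| ≤ M
    have h1 := hB₄ x hx
    have h2 := hB₂ x hx
    have h3 := hB₃ x hx
    -- `A > 0` and `A ≤ 2(1 - κ)` confine `κ` to `[0, 1)`, which bounds the potential uniformly.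
    have k1 : |-(κ ^ 2 - 2 * κ)| ≤ 1 := by rw [abs_le]; constructor <;> nlinarith
    have k2 : |κ| ≤ 1 := by rw [abs_le]; constructor <;> linarith
    have e : potential G ψ l κ x = (l : ℝ) * (l + 1) * Real.exp (ψ x)
        + -(κ ^ 2 - 2 * κ) * gamma G x + κ * deriv (beta G) x := by unfold potential; ring
    have h4 : |-(κ ^ 2 - 2 * κ) * gamma G x| ≤ 1 * B₂ := by
      rw [abs_mul]; exact mul_le_mul k1 h2 (abs_nonneg _) zero_le_one
    have h5 : |κ * deriv (beta G) x| ≤ 1 * B₃ := by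
      rw [abs_mul]; exact mul_le_mul k2 h3 (abs_nonneg _) zero_le_one
    rw [e]
    have := abs_add_three ((l : ℝ) * (l + 1) * Real.exp (ψ x)) (-(κ ^ 2 - 2 * κ) * gamma G x)
      (κ * deriv (beta G) x)
    linarith
  · intro x hx r t
    change (deriv (alpha G) x + 2 * (2 * (1 - κ)) * beta G x) * r ^ 2
      + 2 * (deriv (beta G) x + 2 * (1 - κ) * gamma G x) * r * t ≤ M * (-alpha G x * r ^ 2 + t ^ 2)
    set s := 2 * (1 - κ) with hs
    have s0 : 0 ≤ s := hA0.le.trans hs1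
    set d := xc - x with hd
    have d0 : 0 ≤ d := sub_nonneg.2 hx.2
    have dxc : d ≤ xc := by linarith [(hsub x hx).1]
    have hbc : beta G xc = -1 := by unfold beta; linarith [h.xc_mul_G]
    have hcc : xc * gamma G xc = 2 := by unfold gamma; linarith [h.xc_mul_G]
    have e1 : deriv (alpha G) x + 2 * s * beta G x ≤ 2 * (A - s) + C₁ * d := by
      have j1 := (le_abs_self _).trans (hCa x hx)
      have j2 := mul_le_mul_of_nonneg_left ((le_abs_self _).trans (hCb x hx)) s0
      have j3 : s * (Cb * d) ≤ 2 * (Cb * d) := mul_le_mul_of_nonneg_right hs2 (by positivity)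
      rw [h.deriv_alpha_xc] at j1
      rw [hbc] at j2
      rw [hC₁]
      linarith
    have e2 : |deriv (beta G) x + s * gamma G x - 2 * (s - A) / xc| ≤ C₂ * d := by
      have j0 : 2 * (s - A) / xc = deriv (beta G) xc + s * gamma G xc := by
        rw [div_eq_iff hxc.ne']
        linear_combination -h.deriv_beta_xc - s * hcc
      have j1 := hCd x hx
      have j2 : |s * (gamma G x - gamma G xc)| ≤ 2 * (Cc * d) := by
        rw [abs_mul, abs_of_nonneg s0]
        exact mul_le_mul hs2 (hCc x hx) (abs_nonneg _) (by norm_num)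
      have j3 := abs_add_le (deriv (beta G) x - deriv (beta G) xc) (s * (gamma G x - gamma G xc))
      rw [j0]
      have : deriv (beta G) x + s * gamma G x - (deriv (beta G) xc + s * gamma G xc)
        = deriv (beta G) x - deriv (beta G) xc + s * (gamma G x - gamma G xc) := by ring
      rw [this, hC₂]
      linarith
    exact degenerate_form_le (sub_nonneg.2 hs1) (by linarith) hxc d0 dxc (by positivity)
      (by positivity) m₁0 (hm₁ x hx) (by rw [hM]; linarith) (by rw [hM]; linarith) e1 e2

end IsNakedBackground
end MultipoleWave

end

/-! ### Equivalence with the weak conservation form, and existence of weak solutions. -/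

section
open MeasureTheory Set Filter Topology
open scoped ContDiff

lemma contDiffOn_one_of_hasDerivWithinAt {f f' : ℝ → ℝ} {S : Set ℝ} (hS : UniqueDiffOn ℝ S)
    (hf : ∀ x ∈ S, HasDerivWithinAt f (f' x) S x) (hf' : ContinuousOn f' S) :
    ContDiffOn ℝ 1 f S := by
  rw [← zero_add (1 : WithTop ℕ∞), contDiffOn_succ_iff_derivWithin hS]
  refine ⟨fun x hx => (hf x hx).differentiableWithinAt, by simp, contDiffOn_zero.2 ?_⟩
  exact hf'.congr fun x hx => (hf x hx).derivWithin (hS x hx)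

lemma contDiffOn_two_of_hasDerivWithinAt {f f' : ℝ → ℝ} {S : Set ℝ} (hS : UniqueDiffOn ℝ S)
    (hf : ∀ x ∈ S, HasDerivWithinAt f (f' x) S x) (hf' : ContDiffOn ℝ 1 f' S) :
    ContDiffOn ℝ 2 f S := by
  rw [← one_add_one_eq_two, contDiffOn_succ_iff_derivWithin hS]
  refine ⟨fun x hx => (hf x hx).differentiableWithinAt, by simp, ?_⟩
  exact hf'.congr fun x hx => (hf x hx).derivWithin (hS x hx)

namespace MultipoleWave

lemma H1.continuousOn_val {φ : ℝ → H1} {S : Set ℝ} (h : ContinuousOn φ S) :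
    ContinuousOn (fun x => (φ x).val) S := H1.valL.continuous.comp_continuousOn h

lemma H1.continuousOn_grad {φ : ℝ → H1} {S : Set ℝ} (h : ContinuousOn φ S) :
    ContinuousOn (fun x => (φ x).grad) S := H1.gradL.continuous.comp_continuousOn h

lemma IsTest.continuousOn_pairing {η : ℝ → ℝ} (h : IsTest η) {u : ℝ → L2} {S : Set ℝ}
    (hu : ContinuousOn u S) : ContinuousOn (fun x => pairing (u x) η) S := by
  obtain ⟨L, hL⟩ := h.exists_functional
  simp_rw [← hL]
  exact L.continuous.comp_continuousOn hu

lemma H1.pairing_grad (u : H1) {η : ℝ → ℝ} (h : IsTest η) :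
    pairing u.grad η = -pairing u.val (deriv η) := by rw [u.isWeakDeriv η h, neg_neg]

namespace WaveCoeff

/-- The wave equation in conservation form, weakly in `ρ`, with initial data `f`, `g`. -/
structure IsWeakSolution (w : WaveCoeff) (f : H1) (g : L2) (φ : ℝ → H1) : Prop where
  cont : ContinuousOn φ (Icc w.x₀ w.x₁)
  init : φ w.x₀ = f
  weak : ∀ η, IsTest η → ∃ p : ℝ → ℝ, p w.x₀ = pairing g η ∧
    (∀ x ∈ Ico w.x₀ w.x₁,
      HasDerivWithinAt (fun x => pairing (φ x).val η) (p x) (Ico w.x₀ w.x₁) x) ∧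
    ∀ x ∈ Ico w.x₀ w.x₁, HasDerivWithinAt
      (fun x => w.a x * p x + 2 * w.b x * pairing (φ x).grad η + w.s * w.b x * pairing (φ x).val η)
      (w.c x * pairing (φ x).grad (deriv η) + (w.db x - w.s * w.c x) * pairing (φ x).grad η
        + (w.h x + w.s * w.db x) * pairing (φ x).val η) (Ico w.x₀ w.x₁) x

end WaveCoeff

section
variable {G ψ : ℝ → ℝ} {l : ℕ} {κ xi xc m M : ℝ} {f : H1} {g : L2} {φ : ℝ → H1}

/-- By the product rule, the paired equation says precisely that the flux `a p + 2b q + s b r` has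
the stated derivative, where `r`, `q` are the pairings of `φ`, `φ_ρ` and `p = r'`. -/
theorem IsSolution.isWeakSolution (hw : (waveCoeff G ψ l κ xi xc).Regular m M)
    (h : IsSolution G ψ l κ xi xc f g φ) :
    (waveCoeff G ψ l κ xi xc).IsWeakSolution f g φ := by
  have hS : UniqueDiffOn ℝ (Ico xi xc) := uniqueDiffOn_Ico _ _
  refine ⟨h.cont, h.init, fun η hη => ⟨_, h.init_deriv η hη, fun x hx => ?_, fun x hx => ?_⟩⟩
  · exact ((h.smooth η hη).differentiableOn (by norm_num) x hx).hasDerivWithinAt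
  · have hx' : x ∈ Icc xi xc := Ico_subset_Icc_self hx
    have hp := ((h.smooth η hη).differentiableOn (by norm_num) x hx).hasDerivWithinAt
    have hq := ((h.smooth_grad η hη).differentiableOn (by norm_num) x hx).hasDerivWithinAt
    have hs := h.smooth η hη
    rw [← one_add_one_eq_two, contDiffOn_succ_iff_derivWithin hS] at hs
    have hp' := (hs.2.2.differentiableOn (by norm_num) x hx).hasDerivWithinAt
    have heq := h.equation η hη x hx
    rw [iteratedDerivWithin_succ, iteratedDerivWithin_one] at heq
    have da := (hw.hasDerivAt_a x hx').hasDerivWithinAt (s := Ico xi xc)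
    have db := (hw.hasDerivAt_b x hx').hasDerivWithinAt (s := Ico xi xc)
    refine (((da.mul hp').add ((db.const_mul 2).mul hq)).add
      ((db.const_mul _).mul hp)).congr_deriv ?_
    simp only [waveCoeff] at *
    linear_combination heq

/-- A regularity bootstrap: the flux is `C¹` and `a ≠ 0` before the horizon, so `p` can be solved
for and is first continuous, then `C¹`. The product rule then gives back the equation. -/
theorem WaveCoeff.IsWeakSolution.isSolution (hw : (waveCoeff G ψ l κ xi xc).Regular m M)
    (h : (waveCoeff G ψ l κ xi xc).IsWeakSolution f g φ) : IsSolution G ψ l κ xi xc f g φ := by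
  set w := waveCoeff G ψ l κ xi xc with hwd
  have hS : UniqueDiffOn ℝ (Ico xi xc) := uniqueDiffOn_Ico _ _
  have hx₀ : xi ∈ Ico xi xc := ⟨le_rfl, hw.lt⟩
  have hsub : Ico xi xc ⊆ Icc xi xc := Ico_subset_Icc_self
  choose! p hp0 hp hY using h.weak
  have ca : ContDiffOn ℝ 1 w.a (Ico xi xc) := contDiffOn_one_of_hasDerivWithinAt hS
    (fun x hx => (hw.hasDerivAt_a x (hsub hx)).hasDerivWithinAt) (hw.cont_da.mono hsub)
  have cb : ContDiffOn ℝ 1 w.b (Ico xi xc) := contDiffOn_one_of_hasDerivWithinAt hS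
    (fun x hx => (hw.hasDerivAt_b x (hsub hx)).hasDerivWithinAt) (hw.cont_db.mono hsub)
  have cc := hw.cont_c.mono hsub
  have cdb := hw.cont_db.mono hsub
  have ch := hw.cont_h.mono hsub
  have cia : ContDiffOn ℝ 1 (fun x => (w.a x)⁻¹) (Ico xi xc) := ca.inv fun x hx => (hw.a_neg hx).ne
  have cval : ∀ η, IsTest η → ContinuousOn (fun x => pairing (φ x).val η) (Ico xi xc) :=
    fun η hη => hη.continuousOn_pairing (H1.continuousOn_val (h.cont.mono hsub))
  have cgrad : ∀ η, IsTest η → ContinuousOn (fun x => pairing (φ x).grad η) (Ico xi xc) :=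
    fun η hη => hη.continuousOn_pairing (H1.continuousOn_grad (h.cont.mono hsub))
  have cY : ∀ η, IsTest η → ContDiffOn ℝ 1 (fun x => w.a x * p η x
      + 2 * w.b x * pairing (φ x).grad η + w.s * w.b x * pairing (φ x).val η) (Ico xi xc) := by
    intro η hη
    refine contDiffOn_one_of_hasDerivWithinAt hS (hY η hη) ?_
    have := cval η hη
    have := cgrad η hη
    have := cgrad _ hη.deriv
    fun_prop
  have hpY : ∀ η, ∀ x ∈ Ico xi xc, p η x = (w.a x)⁻¹ * ((w.a x * p η x
      + 2 * w.b x * pairing (φ x).grad η + w.s * w.b x * pairing (φ x).val η)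
      - 2 * w.b x * pairing (φ x).grad η - w.s * w.b x * pairing (φ x).val η) := by
    intro η x hx
    have := (hw.a_neg hx).ne
    field_simp
    ring
  have cp : ∀ η, IsTest η → ContinuousOn (p η) (Ico xi xc) := by
    intro η hη
    refine ContinuousOn.congr ?_ (hpY η)
    have := cval η hη
    have := cgrad η hη
    have := (cY η hη).continuousOn
    have := cia.continuousOn
    have := cb.continuousOn
    fun_prop
  -- Pairing `φ_ρ` with `η` is minus pairing `φ` with `η'`, so differentiability in `x` follows from
  -- the case of the test function `η'`.
  have dq : ∀ η, IsTest η → ∀ x ∈ Ico xi xc,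
      HasDerivWithinAt (fun x => pairing (φ x).grad η) (-p (deriv η) x) (Ico xi xc) x := by
    intro η hη x hx
    simp_rw [H1.pairing_grad _ hη]
    exact (hp _ hη.deriv x hx).neg
  have c1q : ∀ η, IsTest η → ContDiffOn ℝ 1 (fun x => pairing (φ x).grad η) (Ico xi xc) :=
    fun η hη => contDiffOn_one_of_hasDerivWithinAt hS (dq η hη) (cp _ hη.deriv).neg
  have c1v : ∀ η, IsTest η → ContDiffOn ℝ 1 (fun x => pairing (φ x).val η) (Ico xi xc) :=
    fun η hη => contDiffOn_one_of_hasDerivWithinAt hS (hp η hη) (cp η hη)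
  have c1p : ∀ η, IsTest η → ContDiffOn ℝ 1 (p η) (Ico xi xc) := by
    intro η hη
    refine ContDiffOn.congr ?_ (hpY η)
    exact cia.mul (((cY η hη).sub ((contDiffOn_const.mul cb).mul (c1q η hη))).sub
      ((contDiffOn_const.mul cb).mul (c1v η hη)))
  have hpd : ∀ η, IsTest η → ∀ x ∈ Ico xi xc,
      derivWithin (fun x => pairing (φ x).val η) (Ico xi xc) x = p η x :=
    fun η hη x hx => (hp η hη x hx).derivWithin (hS x hx)
  refine ⟨h.cont, h.init, fun η hη => contDiffOn_two_of_hasDerivWithinAt hS (hp η hη) (c1p η hη),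
    c1q, fun η hη => (hpd η hη xi hx₀).trans (hp0 η hη), fun η hη x hx => ?_⟩
  have hp' := ((c1p η hη).differentiableOn (by norm_num) x hx).hasDerivWithinAt
  have hx' := hsub hx
  have da := (hw.hasDerivAt_a x hx').hasDerivWithinAt (s := Ico xi xc)
  have db := (hw.hasDerivAt_b x hx').hasDerivWithinAt (s := Ico xi xc)
  have e1 := (((da.mul hp').add ((db.const_mul 2).mul (dq η hη x hx))).add
      ((db.const_mul w.s).mul (hp η hη x hx))).derivWithin (hS x hx)
  have e2 := (hY η hη x hx).derivWithin (hS x hx)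
  have e3 := e1.symm.trans e2
  rw [iteratedDerivWithin_succ, iteratedDerivWithin_one,
    derivWithin_congr (hpd η hη) (hpd η hη x hx), hpd η hη x hx,
    (dq η hη x hx).derivWithin (hS x hx)]
  simp only [hwd, waveCoeff] at e3
  linear_combination e3

end

namespace WaveCoeff
variable {w : WaveCoeff} {m M : ℝ} {f : H1} {g : L2}

/-- The solution that belongs to a limit mode on the Fourier side. -/
theorem IsLimitMode.exists_isWeakSolution (hw : w.Regular m M) {z y v : ℝ → L2C}
    (h : w.IsLimitMode m M cutOp derivOp (realFourier f.val) (realFourier f.grad) (realFourier g)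
      z y v) :
    ∃ φ : ℝ → H1, w.IsWeakSolution f g φ ∧ ∀ x ∈ Icc w.x₀ w.x₁,
      (φ x).val = realFourierInv (z x) ∧ (φ x).grad = realFourierInv (y x) := by
  -- Projecting onto the interval makes the weak derivative relation available for every real `x`,
  -- as an `H1`-valued function on `ℝ` requires.
  set t : ℝ → ℝ := fun x => projIcc w.x₀ w.x₁ hw.lt.le x with ht
  have htI : ∀ x, t x ∈ Icc w.x₀ w.x₁ := fun x => (projIcc w.x₀ w.x₁ hw.lt.le x).2
  have hte : ∀ x ∈ Icc w.x₀ w.x₁, t x = x := fun x hx => by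
    simp only [ht, projIcc_of_mem hw.lt.le hx]
  have hx₀ : w.x₀ ∈ Icc w.x₀ w.x₁ := ⟨le_rfl, hw.lt.le⟩
  have hsub : Ico w.x₀ w.x₁ ⊆ Icc w.x₀ w.x₁ := Ico_subset_Icc_self
  have hwd : ∀ x, IsWeakDeriv (realFourierInv (z (t x))) (realFourierInv (y (t x))) :=
    fun x => isWeakDeriv_realFourierInv (h.grad _ (htI x))
  have hval : ∀ x ∈ Icc w.x₀ w.x₁, (H1.mk _ _ (hwd x)).val = realFourierInv (z x) := fun x hx => by
    rw [show (H1.mk _ _ (hwd x)).val = realFourierInv (z (t x)) from rfl, hte x hx]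
  have hgrad : ∀ x ∈ Icc w.x₀ w.x₁, (H1.mk _ _ (hwd x)).grad = realFourierInv (y x) :=
    fun x hx => by
    rw [show (H1.mk _ _ (hwd x)).grad = realFourierInv (y (t x)) from rfl, hte x hx]
  refine ⟨fun x => H1.mk _ _ (hwd x), ⟨?_, ?_, fun η hη => ?_⟩, fun x hx => ⟨hval x hx, hgrad x hx⟩⟩
  · refine H1.continuousOn_mk hwd ?_ ?_
    · exact (realFourierInv.continuous.comp_continuousOn h.cont_z).congr
        fun x hx => by simp only [hte x hx, Function.comp]
    · exact (realFourierInv.continuous.comp_continuousOn h.cont_y).congr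
        fun x hx => by simp only [hte x hx, Function.comp]
  · refine H1.ext ?_
    rw [hval _ hx₀, h.init_z, realFourierInv_realFourier]
  · obtain ⟨L₀, hL₀⟩ := hη.exists_functional
    obtain ⟨L₁, hL₁⟩ := hη.deriv.exists_functional
    have hLL : ∀ n u, L₀.comp realFourierInv (derivOp n u) = -L₁.comp realFourierInv (cutOp n u) := by
      intro n u
      have hS := isSpectralFamily
      -- This exhibits `derivOp n u` as the transform of the derivative of the band-limited function
      -- `cutOp n u`.
      have hk : ∀ k, cutOp k (derivOp n u) = derivOp k (cutOp n u) := by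
        intro k
        rcases le_total k n with hkn | hkn
        · rw [hS.P_D hkn, hS.D_P_le hkn]
        · rw [hS.P_D_le hkn, hS.D_P hkn]
      have := isWeakDeriv_realFourierInv hk η hη
      simp only [ContinuousLinearMap.comp_apply, hL₀, hL₁]
      rw [this, neg_neg]
    have p_eq : ∀ x ∈ Icc w.x₀ w.x₁, pairing (H1.mk _ _ (hwd x)).val η
        = L₀.comp realFourierInv (z x) := fun x hx => by
      rw [hval x hx, ContinuousLinearMap.comp_apply, hL₀]
    have q_eq : ∀ x ∈ Icc w.x₀ w.x₁, pairing (H1.mk _ _ (hwd x)).grad η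
        = L₀.comp realFourierInv (y x) := fun x hx => by
      rw [hgrad x hx, ContinuousLinearMap.comp_apply, hL₀]
    have r_eq : ∀ x ∈ Icc w.x₀ w.x₁, pairing (H1.mk _ _ (hwd x)).grad (deriv η)
        = L₁.comp realFourierInv (y x) := fun x hx => by
      rw [hgrad x hx, ContinuousLinearMap.comp_apply, hL₁]
    refine ⟨fun x => L₀.comp realFourierInv (v x), ?_, fun x hx => ?_, fun x hx => ?_⟩
    · simp only [h.init_v, ContinuousLinearMap.comp_apply, realFourierInv_realFourier, hL₀]
    · exact ((L₀.comp realFourierInv).hasFDerivAt.comp_hasDerivWithinAt x (h.deriv_z x hx)).congr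
        (fun x hx => p_eq x (hsub hx)) (p_eq x (hsub hx))
    · have := h.equation _ _ hLL x hx
      rw [p_eq x (hsub hx), q_eq x (hsub hx), r_eq x (hsub hx)]
      refine this.congr (fun x hx => ?_) ?_
      · rw [p_eq x (hsub hx), q_eq x (hsub hx)]
      · rw [p_eq x (hsub hx), q_eq x (hsub hx)]

end WaveCoeff
end MultipoleWave

end

/-! ### Uniqueness: low-frequency parts of weak solutions are modes. -/

section
open MeasureTheory Set Filter Topology
open scoped ContDiff

namespace MultipoleWave

lemma intervalIntegral_clm_add_clm {E F : Type*} [NormedAddCommGroup E] [NormedSpace ℝ E]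
    [CompleteSpace E] [NormedAddCommGroup F] [NormedSpace ℝ F] [CompleteSpace F] (L L' : E →L[ℝ] F)
    {u v : ℝ → E} {a b x : ℝ} (hu : ContinuousOn u (Ico a b)) (hv : ContinuousOn v (Ico a b))
    (hx : x ∈ Ico a b) :
    ∫ t in a..x, (L (u t) + L' (v t)) = L (∫ t in a..x, u t) + L' (∫ t in a..x, v t) := by
  have iu := intervalIntegrable_of_continuousOn_Ico hu hx
  have iv := intervalIntegrable_of_continuousOn_Ico hv hx
  rw [intervalIntegral.integral_add
    (intervalIntegrable_of_continuousOn_Ico (f := fun t => L (u t))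
      (L.continuous.comp_continuousOn hu) hx)
    (intervalIntegrable_of_continuousOn_Ico (f := fun t => L' (v t))
      (L'.continuous.comp_continuousOn hv) hx),
    L.intervalIntegral_comp_comm iu, L'.intervalIntegral_comp_comm iv]

namespace WaveCoeff
variable {w : WaveCoeff} {m M : ℝ} {f : H1} {g : L2} {φ : ℝ → H1}

/-- A weak solution solves a system of integral equations in `L²`. -/
theorem IsWeakSolution.exists_flux (hw : w.Regular m M) (h : w.IsWeakSolution f g φ) :
    ∃ B Θ J U : ℝ → L2,
      B w.x₀ = w.a w.x₀ • g + (2 * w.b w.x₀) • f.grad + (w.s * w.b w.x₀) • f.val ∧ Θ w.x₀ = 0 ∧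
      ∀ x ∈ Ico w.x₀ w.x₁,
        HasDerivWithinAt B ((w.db x - w.s * w.c x) • (φ x).grad
          + (w.h x + w.s * w.db x) • (φ x).val) (Ico w.x₀ w.x₁) x ∧
        HasDerivWithinAt Θ (w.c x • (φ x).grad) (Ico w.x₀ w.x₁) x ∧
        HasDerivWithinAt J ((w.a x)⁻¹ • (B x - (2 * w.b x) • (φ x).grad
          - (w.s * w.b x) • (φ x).val)) (Ico w.x₀ w.x₁) x ∧
        HasDerivWithinAt U ((w.a x)⁻¹ • Θ x) (Ico w.x₀ w.x₁) x ∧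
        IsWeakDeriv (U x) (J x - (φ x).val) := by
  have hsub : Ico w.x₀ w.x₁ ⊆ Icc w.x₀ w.x₁ := Ico_subset_Icc_self
  have hx₀ : w.x₀ ∈ Ico w.x₀ w.x₁ := ⟨le_rfl, hw.lt⟩
  have cb := hw.cont_b.mono hsub
  have cc := hw.cont_c.mono hsub
  have cdb := hw.cont_db.mono hsub
  have ch := hw.cont_h.mono hsub
  have cia := hw.cont_inv_a
  have cval := H1.continuousOn_val (h.cont.mono hsub)
  have cgrad := H1.continuousOn_grad (h.cont.mono hsub)
  set B' : ℝ → L2 := fun x => (w.db x - w.s * w.c x) • (φ x).grad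
    + (w.h x + w.s * w.db x) • (φ x).val with hB'
  have cB' : ContinuousOn B' (Ico w.x₀ w.x₁) := by simp only [hB']; fun_prop
  -- The part of the flux paired with `η'` is kept apart, because `φ` has only one derivative in
  -- `ρ`. Formally, the flux is `B - ∂_ρ Θ`.
  set Θ' : ℝ → L2 := fun x => w.c x • (φ x).grad with hΘ'
  have cΘ' : ContinuousOn Θ' (Ico w.x₀ w.x₁) := by simp only [hΘ']; fun_prop
  set B₀ : L2 := w.a w.x₀ • g + (2 * w.b w.x₀) • f.grad + (w.s * w.b w.x₀) • f.val with hB₀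
  set B : ℝ → L2 := fun x => B₀ + ∫ t in w.x₀..x, B' t with hB
  set Θ : ℝ → L2 := fun x => ∫ t in w.x₀..x, Θ' t with hΘ
  have dB : ∀ x ∈ Ico w.x₀ w.x₁, HasDerivWithinAt B (B' x) (Ico w.x₀ w.x₁) x := fun x hx =>
    (hasDerivWithinAt_primitive_Ico cB' hx).const_add _
  have dΘ : ∀ x ∈ Ico w.x₀ w.x₁, HasDerivWithinAt Θ (Θ' x) (Ico w.x₀ w.x₁) x := fun x hx =>
    hasDerivWithinAt_primitive_Ico cΘ' hx
  have cB : ContinuousOn B (Ico w.x₀ w.x₁) := fun x hx => (dB x hx).continuousWithinAt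
  have cΘ : ContinuousOn Θ (Ico w.x₀ w.x₁) := fun x hx => (dΘ x hx).continuousWithinAt
  set J' : ℝ → L2 := fun x => (w.a x)⁻¹ • (B x - (2 * w.b x) • (φ x).grad
    - (w.s * w.b x) • (φ x).val) with hJ'
  have cJ' : ContinuousOn J' (Ico w.x₀ w.x₁) := by simp only [hJ']; fun_prop
  set U' : ℝ → L2 := fun x => (w.a x)⁻¹ • Θ x with hU'
  have cU' : ContinuousOn U' (Ico w.x₀ w.x₁) := by simp only [hU']; fun_prop
  refine ⟨B, Θ, fun x => f.val + ∫ t in w.x₀..x, J' t, fun x => ∫ t in w.x₀..x, U' t,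
    by simp [hB], by simp [hΘ], fun x hx => ⟨dB x hx, dΘ x hx,
      (hasDerivWithinAt_primitive_Ico cJ' hx).const_add _, hasDerivWithinAt_primitive_Ico cU' hx,
      fun η hη => ?_⟩⟩
  obtain ⟨L, hL⟩ := hη.exists_functional
  obtain ⟨L', hL'⟩ := hη.deriv.exists_functional
  obtain ⟨p, hp0, hp, hY⟩ := h.weak η hη
  simp only [← hL, ← hL'] at hp0 hp hY ⊢
  -- the flux
  have hflux : ∀ x ∈ Ico w.x₀ w.x₁, w.a x * p x + 2 * w.b x * L (φ x).grad
      + w.s * w.b x * L (φ x).val = L (B x) + L' (Θ x) := by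
    intro x hx
    have e := eq_add_integral_of_hasDerivWithinAt_Ico hY (by
      have := L.continuous.comp_continuousOn cval
      have := L.continuous.comp_continuousOn cgrad
      have := L'.continuous.comp_continuousOn cgrad
      simp only [Function.comp_def] at *
      fun_prop) hx
    have e1 : ∀ t, w.c t * L' (φ t).grad + (w.db t - w.s * w.c t) * L (φ t).grad
        + (w.h t + w.s * w.db t) * L (φ t).val = L (B' t) + L' (Θ' t) := by
      intro t
      simp only [hB', hΘ', map_add, map_smul, smul_eq_mul]
      ring
    simp only [e1] at e
    rw [e, intervalIntegral_clm_add_clm L L' cB' cΘ' hx, hp0, h.init]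
    simp only [hB, hB₀, hΘ, map_add, map_smul, smul_eq_mul]
    ring
  have hpe : ∀ x ∈ Ico w.x₀ w.x₁, p x = L (J' x) + L' (U' x) := by
    intro x hx
    have ha := (hw.a_neg hx).ne
    have e := hflux x hx
    simp only [hJ', hU', map_sub, map_smul, smul_eq_mul]
    rw [← mul_add, eq_inv_mul_iff_mul_eq₀ ha]
    linear_combination e
  -- Integrating once more gives `φ = J - ∂_ρ U` weakly in `ρ`, an identity between `L²` curves
  -- instead of one scalar identity for each `η`.
  have e := eq_add_integral_of_hasDerivWithinAt_Ico
    (fun x hx => (hp x hx).congr_deriv (hpe x hx)) (by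
      have := L.continuous.comp_continuousOn cJ'
      have := L'.continuous.comp_continuousOn cU'
      simp only [Function.comp_def] at *
      fun_prop) hx
  rw [intervalIntegral_clm_add_clm L L' cJ' cU' hx, h.init] at e
  rw [map_sub, map_add, e]
  ring

/-- The low-frequency part of a weak solution is a mode. -/
theorem IsWeakSolution.exists_isMode (hw : w.Regular m M) (h : w.IsWeakSolution f g φ) (n : ℕ) :
    ∃ ζ Υ : ℝ → L2C, w.IsMode (derivOp n) ζ Υ ∧ ζ w.x₀ = cutOp n (realFourier f.val) ∧
      w.vel (derivOp n) ζ Υ w.x₀ = cutOp n (realFourier g) ∧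
      ∀ x, ζ x = cutOp n (realFourier (φ x).val) := by
  obtain ⟨B, Θ, J, U, hB0, hΘ0, hd⟩ := h.exists_flux hw
  have hS := isSpectralFamily
  have hx₀ : w.x₀ ∈ Ico w.x₀ w.x₁ := ⟨le_rfl, hw.lt⟩
  set A : L2 →L[ℝ] L2C := (cutOp n).comp realFourier with hA
  set A' : L2 →L[ℝ] L2C := (derivOp n).comp realFourier with hA'
  have hAg : ∀ u : H1, A u.grad = derivOp n (A u.val) := fun u => by
    simp only [hA, ContinuousLinearMap.comp_apply]
    rw [u.isWeakDeriv.cutOp_realFourier, hS.D_P le_rfl]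
  have hA'g : ∀ u : H1, A' u.grad = derivOp n (derivOp n (A u.val)) := fun u => by
    simp only [hA, hA', ContinuousLinearMap.comp_apply]
    rw [hS.D_P le_rfl, ← u.isWeakDeriv.cutOp_realFourier, hS.D_P le_rfl]
  -- After the cut-off `∂_ρ U` becomes a bounded operator applied to `U`, so the right-hand side is
  -- differentiable in `L²`, although `φ` itself was only assumed continuous.
  have hζ : ∀ x ∈ Ico w.x₀ w.x₁, A (φ x).val = A (J x) - A' (U x) := by
    intro x hx
    have := (hd x hx).2.2.2.2.cutOp_realFourier n
    simp only [map_sub] at this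
    simp only [hA, hA', ContinuousLinearMap.comp_apply, ← this]
    abel
  refine ⟨fun x => A (φ x).val, fun x => A (B x) - A' (Θ x), ⟨fun x hx => ?_, fun x hx => ?_⟩,
    by simp only [h.init]; rfl, ?_, fun x => rfl⟩
  · obtain ⟨-, -, dJ, dU, -⟩ := hd x hx
    have := (A.hasFDerivAt.comp_hasDerivWithinAt x dJ).sub (A'.hasFDerivAt.comp_hasDerivWithinAt x dU)
    refine (this.congr hζ (hζ x hx)).congr_deriv ?_
    simp only [vel, map_sub, map_smul, hAg, smul_sub]
    abel
  · obtain ⟨dB, dΘ, -⟩ := hd x hx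
    refine ((A.hasFDerivAt.comp_hasDerivWithinAt x dB).sub
      (A'.hasFDerivAt.comp_hasDerivWithinAt x dΘ)).congr_deriv ?_
    simp only [force, map_add, map_smul, hAg, hA'g]
    abel
  · have ha := (hw.a_neg hx₀).ne
    simp only [vel, hB0, hΘ0, h.init, map_add, map_smul, hAg, map_zero, sub_zero]
    rw [add_sub_right_comm, add_sub_cancel_right, add_sub_cancel_right, smul_smul,
      inv_mul_cancel₀ ha, one_smul]
    rfl

/-- A weak solution agrees with the limit mode. -/
theorem IsLimitMode.realFourier_val_eq (hw : w.Regular m M) {z y v : ℝ → L2C}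
    (hz : w.IsLimitMode m M cutOp derivOp (realFourier f.val) (realFourier f.grad)
      (realFourier g) z y v) (h : w.IsWeakSolution f g φ) {x : ℝ} (hx : x ∈ Icc w.x₀ w.x₁) :
    realFourier (φ x).val = z x := by
  have hsub : Ico w.x₀ w.x₁ ⊆ Icc w.x₀ w.x₁ := Ico_subset_Icc_self
  have key : EqOn (fun x => realFourier (φ x).val) z (Ico w.x₀ w.x₁) := by
    intro x hx
    refine tendsto_nhds_unique (isSpectralFamily.tendsto (realFourier (φ x).val)) ?_
    refine (isSpectralFamily.tendsto (z x)).congr fun n => ?_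
    obtain ⟨ζ, Υ, h1, h2, h3, h4⟩ := h.exists_isMode hw n
    rw [hz.proj n ζ Υ h1 h2 h3 x hx, h4]
  have hc : ContinuousOn (fun x => realFourier (φ x).val) (Icc w.x₀ w.x₁) :=
    realFourier.continuous.comp_continuousOn (H1.continuousOn_val h.cont)
  exact key.of_subset_closure hc hz.cont_z hsub (closure_Ico hw.lt.ne).ge hx

end WaveCoeff
end MultipoleWave

end

/-! ### Well-posedness of the weak problem, and comparison of norms and energies. -/

section
open MeasureTheory Set Filter Topology
open scoped ContDiff BoundedContinuousFunction

namespace MultipoleWave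

namespace WaveCoeff
variable {w : WaveCoeff} {m M : ℝ} {f : H1} {g : L2}

/-- `realFourier` and `realFourierInv` do not increase norms, so this transfers the energy bound to
the Fourier side and back without loss. -/
lemma Regular.modeEnergy_mono {E F : Type*} [NormedAddCommGroup E] [NormedAddCommGroup F]
    (hw : w.Regular m M) {x : ℝ} (hx : x ∈ Icc w.x₀ w.x₁) {z y v : E} {z' y' v' : F}
    (hz : ‖z‖ ≤ ‖z'‖) (hy : ‖y‖ ≤ ‖y'‖) (hv : ‖v‖ ≤ ‖v'‖) :
    w.modeEnergy x z y v ≤ w.modeEnergy x z' y' v' := by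
  have h1 := hw.neg_a_nonneg hx
  have h2 := hw.m_pos.le.trans (hw.le_c x hx)
  unfold modeEnergy
  gcongr

/-- Well-posedness and the energy estimate for the weak formulation. -/
theorem Regular.exists_unique_weakSolution (hw : w.Regular m M) (f : H1) (g : L2) :
    ∃ (φ : ℝ → H1) (v : ℝ → L2), w.IsWeakSolution f g φ ∧
      (∀ φ', w.IsWeakSolution f g φ' → EqOn φ' φ (Icc w.x₀ w.x₁)) ∧
      ContinuousOn v (Ico w.x₀ w.x₁) ∧ v w.x₀ = g ∧
      (∀ x ∈ Ico w.x₀ w.x₁,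
        HasDerivWithinAt (fun y => (φ y).val) (v x) (Ico w.x₀ w.x₁) x) ∧
      ∀ x ∈ Icc w.x₀ w.x₁, w.modeEnergy x (φ x).val (φ x).grad (v x)
        ≤ growth m M (w.x₁ - w.x₀) * w.modeEnergy w.x₀ f.val f.grad g := by
  obtain ⟨z, y, v, h⟩ := hw.exists_isLimitMode isSpectralFamily (z₀ := realFourier f.val)
    (y₀ := realFourier f.grad) (v₀ := realFourier g) f.isWeakDeriv.cutOp_realFourier
  obtain ⟨φ, hφ, hφv⟩ := h.exists_isWeakSolution hw
  have hsub : Ico w.x₀ w.x₁ ⊆ Icc w.x₀ w.x₁ := Ico_subset_Icc_self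
  refine ⟨φ, fun x => realFourierInv (v x), hφ, fun φ' hφ' x hx => H1.ext ?_,
    realFourierInv.continuous.comp_continuousOn h.cont_v,
    by simp only [h.init_v, realFourierInv_realFourier], fun x hx => ?_, fun x hx => ?_⟩
  · exact realFourier_injective
      ((h.realFourier_val_eq hw hφ' hx).trans (h.realFourier_val_eq hw hφ hx).symm)
  · exact (realFourierInv.hasFDerivAt.comp_hasDerivWithinAt x (h.deriv_z x hx)).congr
      (fun x hx => (hφv x (hsub hx)).1) (hφv x (hsub hx)).1
  · rw [(hφv x hx).1, (hφv x hx).2]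
    refine (hw.modeEnergy_mono hx (norm_realFourierInv_le _) (norm_realFourierInv_le _)
      (norm_realFourierInv_le _)).trans ((h.energy_le x hx).trans ?_)
    exact mul_le_mul_of_nonneg_left (hw.modeEnergy_mono ⟨le_rfl, hw.lt.le⟩ (norm_realFourier_le _)
      (norm_realFourier_le _) (norm_realFourier_le _)) (growth_pos _ _ _).le

end WaveCoeff

lemma integral_sq_eq_norm_sq (u : L2) : ∫ ρ, u ρ ^ 2 = ‖u‖ ^ 2 := by
  rw [← real_inner_self_eq_norm_sq, L2.inner_def]
  refine integral_congr_ae (ae_of_all _ fun ρ => ?_)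
  simp [sq]

lemma integrable_sq (u : L2) : Integrable (fun ρ => u ρ ^ 2) := (Lp.memLp u).integrable_sq

lemma integral_sq_add_sq_add_sq (a b c : ℝ) (u v w : L2) :
    ∫ ρ, (a * u ρ ^ 2 + b * v ρ ^ 2 + c * w ρ ^ 2)
      = a * ‖u‖ ^ 2 + b * ‖v‖ ^ 2 + c * ‖w‖ ^ 2 := by
  have h1 := (integrable_sq u).const_mul a
  have h2 := (integrable_sq v).const_mul b
  have h3 := (integrable_sq w).const_mul c
  have h12 : Integrable fun ρ => a * u ρ ^ 2 + b * v ρ ^ 2 := h1.add h2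
  rw [integral_add h12 h3, integral_add h1 h2]
  simp only [integral_const_mul, integral_sq_eq_norm_sq]

lemma hatEnergy_eq (G : ℝ → ℝ) (x : ℝ) (u : H1) (v : L2) :
    hatEnergy G x u v = ‖u.val‖ ^ 2 + ‖alpha G x • v + beta G x • u.grad‖ ^ 2 + ‖u.grad‖ ^ 2 := by
  have h : hatEnergy G x u v = ∫ ρ, (u.val ρ ^ 2
      + (alpha G x • v + beta G x • u.grad : L2) ρ ^ 2 + u.grad ρ ^ 2) := by
    refine integral_congr_ae ?_
    filter_upwards [Lp.coeFn_add (alpha G x • v) (beta G x • u.grad), Lp.coeFn_smul (alpha G x) v,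
      Lp.coeFn_smul (beta G x) u.grad] with ρ h1 h2 h3
    rw [h1, Pi.add_apply, h2, h3]
    rfl
  rw [h]
  simpa only [one_mul] using integral_sq_add_sq_add_sq 1 1 1 u.val
    (alpha G x • v + beta G x • u.grad) u.grad

lemma energy_eq (G ψ : ℝ → ℝ) (l : ℕ) (κ x : ℝ) (u : H1) (v : L2) :
    energy G ψ l κ x u v = -alpha G x * ‖v‖ ^ 2 + gamma G x * ‖u.grad‖ ^ 2
      + potential G ψ l κ x * ‖u.val‖ ^ 2 :=
  integral_sq_add_sq_add_sq _ _ _ _ _ _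

/-- The energy of the data is controlled by the first-order energy. -/
lemma energy_data_le_hatEnergy (G : ℝ → ℝ) {x : ℝ} (ha : alpha G x < 0) (hc : 0 ≤ gamma G x)
    (u : H1) (v : L2) :
    -alpha G x * ‖v‖ ^ 2 + gamma G x * ‖u.grad‖ ^ 2 + ‖u.val‖ ^ 2
      ≤ (1 + gamma G x + 2 / -alpha G x * (1 + beta G x ^ 2)) * hatEnergy G x u v := by
  rw [hatEnergy_eq]
  set q : L2 := alpha G x • v + beta G x • u.grad with hq
  have h0 : 0 < -alpha G x := neg_pos.2 ha
  have h1 : -alpha G x * ‖v‖ ^ 2 ≤ 2 / -alpha G x * (‖q‖ ^ 2 + beta G x ^ 2 * ‖u.grad‖ ^ 2) := by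
    rw [div_mul_eq_mul_div, le_div_iff₀ h0]
    have e1 : alpha G x • v = q - beta G x • u.grad := by rw [hq, add_sub_cancel_right]
    have e2 : ‖alpha G x • v‖ ^ 2 = alpha G x ^ 2 * ‖v‖ ^ 2 := by
      rw [norm_smul, mul_pow, Real.norm_eq_abs, sq_abs]
    have e3 : ‖beta G x • u.grad‖ ^ 2 = beta G x ^ 2 * ‖u.grad‖ ^ 2 := by
      rw [norm_smul, mul_pow, Real.norm_eq_abs, sq_abs]
    have e4 : ‖alpha G x • v‖ ≤ ‖q‖ + ‖beta G x • u.grad‖ := e1 ▸ norm_sub_le _ _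
    have e5 := pow_le_pow_left₀ (norm_nonneg _) e4 2
    rw [← e3]
    nlinarith [sq_nonneg (‖q‖ - ‖beta G x • u.grad‖)]
  have h2 : 0 < 2 / -alpha G x := by positivity
  set r := 2 / -alpha G x
  have a1 := sq_nonneg ‖q‖
  have a2 := sq_nonneg ‖u.grad‖
  have a3 := sq_nonneg ‖u.val‖
  have b1 := mul_nonneg hc a1
  have b2 := mul_nonneg hc a3
  have b3 := mul_nonneg h2.le a2
  have b4 := mul_nonneg h2.le a3
  have b5 := mul_nonneg h2.le (mul_nonneg (sq_nonneg (beta G x)) a1)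
  have b6 := mul_nonneg h2.le (mul_nonneg (sq_nonneg (beta G x)) a3)
  linarith

/-- The values of a continuous curve in `H^{1,2}(ℝ)` are jointly continuous. -/
lemma continuousOn_sobolevEmbedding {φ : ℝ → H1} {S : Set ℝ} (h : ContinuousOn φ S) :
    ContinuousOn (Function.uncurry fun x ρ => (sobolevEmbedding ((φ x).val, (φ x).grad) ρ).re)
      (S ×ˢ univ) := by
  have h1 : ContinuousOn (fun x => sobolevEmbedding ((φ x).val, (φ x).grad)) S :=
    sobolevEmbedding.continuous.comp_continuousOn
      ((H1.continuousOn_val h).prodMk (H1.continuousOn_grad h))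
  have h2 : ContinuousOn (fun p : ℝ × ℝ => sobolevEmbedding ((φ p.1).val, (φ p.1).grad) p.2)
      (S ×ˢ univ) := by
    have e : Continuous fun p : (ℝ →ᵇ ℂ) × ℝ => p.1 p.2 := by fun_prop
    exact e.comp_continuousOn ((h1.comp continuousOn_fst fun p hp => hp.1).prodMk continuousOn_snd)
  exact Complex.continuous_re.comp_continuousOn h2

lemma abs_sobolevEmbedding_sq_le (u : H1) (ρ : ℝ) :
    |(sobolevEmbedding (u.val, u.grad) ρ).re| ^ 2
      ≤ ‖sobolevEmbedding‖ ^ 2 * (‖u.val‖ ^ 2 + ‖u.grad‖ ^ 2) := by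
  have h1 : |(sobolevEmbedding (u.val, u.grad) ρ).re| ≤ ‖sobolevEmbedding‖ * ‖(u.val, u.grad)‖ :=
    (Complex.abs_re_le_norm _).trans
      (((sobolevEmbedding (u.val, u.grad)).norm_coe_le_norm ρ).trans
        (sobolevEmbedding.le_opNorm _))
  refine (pow_le_pow_left₀ (abs_nonneg _) h1 2).trans ?_
  rw [mul_pow]
  refine mul_le_mul_of_nonneg_left ?_ (sq_nonneg _)
  rw [Prod.norm_def]
  rcases max_choice ‖u.val‖ ‖u.grad‖ with h | h <;> rw [h] <;>
    linarith [sq_nonneg ‖u.val‖, sq_nonneg ‖u.grad‖]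

end MultipoleWave

end

/-! ### The main theorem. -/

theorem theorem5 (G ψ : ℝ → ℝ) (xc : ℝ) (hbg : IsNakedBackground G ψ xc)
    (l : ℕ) (xi : ℝ) (hxi : xi ∈ Set.Ioo 0 xc) :
    ∃ C₁ C₂ : ℝ, 0 < C₁ ∧ 0 < C₂ ∧
      ∀ κ ∈ Set.Icc (0 : ℝ) (min 2 ((1 - xc ^ 2 * deriv G xc) / 2)),
      ∀ (f : H1) (g : L2),
        -- existence and uniqueness in `C([xi, xc], H1)`
        (∃ φ : ℝ → H1, IsSolution G ψ l κ xi xc f g φ) ∧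
        (∀ φ φ' : ℝ → H1, IsSolution G ψ l κ xi xc f g φ →
          IsSolution G ψ l κ xi xc f g φ' → Set.EqOn φ φ' (Set.Icc xi xc)) ∧
        ∀ φ : ℝ → H1, IsSolution G ψ l κ xi xc f g φ →
          -- bound on the field values, i.e. on the continuous representative of the solution
          (∃ Φ : ℝ → ℝ → ℝ,
            ContinuousOn (Function.uncurry Φ) (Set.Icc xi xc ×ˢ Set.univ) ∧
            (∀ x ∈ Set.Icc xi xc, Φ x =ᵐ[MeasureTheory.volume] (φ x).val) ∧
            ∀ x ∈ Set.Icc xi xc, ∀ ρ : ℝ, |Φ x ρ| ^ 2 ≤ C₁ * hatEnergy G xi f g) ∧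
          -- existence of the `x`-derivative `v` in `L²` before the horizon, and the energy bound;
          -- the value of `v` at `xc` is immaterial since `α(xc) = 0`
          (∃ v : ℝ → L2,
            ContinuousOn v (Set.Ico xi xc) ∧ v xi = g ∧
            (∀ x ∈ Set.Ico xi xc,
              HasDerivWithinAt (fun y => (φ y).val) (v x) (Set.Ico xi xc) x) ∧
            ∀ x ∈ Set.Icc xi xc, energy G ψ l κ x (φ x) (v x) ≤ C₂ * hatEnergy G xi f g) := by
  obtain ⟨m, M, hreg⟩ := hbg.exists_regular l hxi
  -- The admissible range contains `κ = 0` because `G'(xc) < 0`. Facts that do not involve `κ` are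
  -- read off there, so that the constants can be chosen before `κ`.
  have hκ₀ : (0 : ℝ) ∈ Icc (0 : ℝ) (min 2 ((1 - xc ^ 2 * deriv G xc) / 2)) := by
    refine ⟨le_rfl, le_min zero_le_two ?_⟩
    have := mul_pos (pow_pos hbg.xc_pos 2) (neg_pos.2 hbg.flux)
    linarith
  have hx₀ : xi ∈ Ico xi xc := ⟨le_rfl, hxi.2⟩
  have ha : alpha G xi < 0 := (hreg 0 hκ₀).a_neg hx₀
  have hm : 0 < m := (hreg 0 hκ₀).m_pos
  have hM : 0 ≤ M := (hreg 0 hκ₀).M_nonneg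
  have hc : 0 ≤ gamma G xi := hm.le.trans ((hreg 0 hκ₀).le_c xi (Ico_subset_Icc_self hx₀))
  set K := 1 + gamma G xi + 2 / -alpha G xi * (1 + beta G xi ^ 2) with hK
  have hK0 : 0 < K := by
    have := neg_pos.2 ha
    positivity
  set N := WaveCoeff.growth m M (xc - xi) * K with hN
  have hN0 : 0 < N := mul_pos (WaveCoeff.growth_pos _ _ _) hK0
  -- `1 + 1/m` converts the mode energy into the `H^{1,2}` norm, `1 + M` pays for replacing `‖φ‖²`
  -- by `H‖φ‖²`, and the added `1` makes `C₁` positive without a lower bound on the embedding norm.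
  refine ⟨(‖sobolevEmbedding‖ ^ 2 + 1) * ((1 + 1 / m) * N), (1 + M) * N, by positivity,
    by positivity, fun κ hκ f g => ?_⟩
  have hw := hreg κ hκ
  obtain ⟨φ₀, v, hφ₀, huniq, hv, hv0, hvd, hE⟩ := hw.exists_unique_weakSolution f g
  refine ⟨⟨φ₀, hφ₀.isSolution hw⟩, fun φ φ' hφ hφ' => (huniq _ (hφ.isWeakSolution hw)).trans
    (huniq _ (hφ'.isWeakSolution hw)).symm, fun φ hφ => ?_⟩
  have heq : EqOn φ φ₀ (Icc xi xc) := huniq _ (hφ.isWeakSolution hw)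
  have hE' : ∀ x ∈ Icc xi xc, -alpha G x * ‖v x‖ ^ 2 + gamma G x * ‖(φ x).grad‖ ^ 2
      + ‖(φ x).val‖ ^ 2 ≤ N * hatEnergy G xi f g := by
    intro x hx
    rw [heq hx, hN, mul_assoc]
    exact (hE x hx).trans (mul_le_mul_of_nonneg_left (energy_data_le_hatEnergy G ha hc f g)
      (WaveCoeff.growth_pos _ _ _).le)
  refine ⟨⟨fun x ρ => (sobolevEmbedding ((φ x).val, (φ x).grad) ρ).re,
    continuousOn_sobolevEmbedding hφ.cont, fun x _ => sobolevEmbedding_ae (φ x).isWeakDeriv,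
    fun x hx ρ => ?_⟩, v, hv, hv0, fun x hx => ?_, fun x hx => ?_⟩
  · refine (abs_sobolevEmbedding_sq_le (φ x) ρ).trans ?_
    have h1 := hw.sq_norm_left_le hx (z := (φ x).val) (y := (φ x).grad) (v := v x)
    have h2 := hw.sq_norm_grad_le hx (z := (φ x).val) (y := (φ x).grad) (v := v x)
    have h3 : ‖(φ x).grad‖ ^ 2 ≤ 1 / m * (N * hatEnergy G xi f g) := by
      rw [div_mul_eq_mul_div, one_mul, le_div_iff₀ hm, mul_comm]
      exact h2.trans (hE' x hx)
    have h4 := h1.trans (hE' x hx)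
    have h5 : ‖(φ x).val‖ ^ 2 + ‖(φ x).grad‖ ^ 2 ≤ (1 + 1 / m) * N * hatEnergy G xi f g := by
      linarith
    rw [mul_assoc]
    exact mul_le_mul (by linarith) h5 (by positivity) (by positivity)
  · exact (hvd x hx).congr (fun y hy => congrArg H1.val (heq (Ico_subset_Icc_self hy)))
      (congrArg H1.val (heq (Ico_subset_Icc_self hx)))
  · have h1 := hE' x hx
    have h2 : 0 ≤ -alpha G x := hw.neg_a_nonneg hx
    have h3 : 0 ≤ gamma G x := hm.le.trans (hw.le_c x hx)
    have h4 : potential G ψ l κ x ≤ M := (abs_le.1 (hw.abs_h_le x hx)).2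
    have h5 := mul_le_mul_of_nonneg_left h1 (by linarith : 0 ≤ 1 + M)
    have h6 := mul_le_mul_of_nonneg_right h4 (sq_nonneg ‖(φ x).val‖)
    have h7 := mul_nonneg hM (mul_nonneg h2 (sq_nonneg ‖v x‖))
    have h8 := mul_nonneg hM (mul_nonneg h3 (sq_nonneg ‖(φ x).grad‖))
    rw [energy_eq]
    linarith [sq_nonneg ‖(φ x).val‖]
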